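/- Let $\alpha>0$ and let $\gamma:\mathbb{R}\to\mathbb{R}^2$ be the arc-length parametrization of a continuous, piecewise $C^2$ planar curve $\Gamma$: there is a finite set $\Pi\subset\mathbb{R}$ of vertices such that $\gamma$ is $C^2$ with $|\dot\gamma|=1$ on $\mathbb{R}\setminus\Pi$, and the signed curvature $k=\dot\gamma_2\ddot\gamma_1-\dot\gamma_1\ddot\gamma_2$ is integrable (which holds in particular if it is piecewise continuous). Assume that * there is $c\in(0,1)$ with $|\gamma(s)-\gamma(s')|\ge c|s-s'|$ for all $s,s'\in\mathbb{R}$; * there are $s_1>s_2$ such that $\gamma$ runs along a straight line for $s\ge s_1$ and along a straight line for $s\le s_2$; * the one-sided limits of $\dot\gamma$ exist at every $p\in\Pi$; * $\Gamma$ is not a straight line. Let $c(p)\in(-\pi,\pi)$ be the signed exterior angle at $p\in\Pi$: with $t_\pm=\dot\gamma(p\pm)$, $\cos c(p)=t_+\cdot t_-$ and $\sin c(p)=t_{-,2}t_{+,1}-t_{-,1}t_{+,2}$. For $s<s'$ let the bending be $$\phi(s,s')=\sum_{p\in\Pi\cap[s,s')}c(p)+\int_s^{s'}k(u)\,\mathrm{d}u,\qquad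 \phi(s',s)=-\phi(s,s'),\qquad \phi(s,s)=0.$$ For $\beta\in\mathbb{R}$ let $\Gamma_\beta$ be the curve $$\gamma_\beta(s)=\Bigl(\int_0^s\cos(\beta\phi(u,0))\,\mathrm{d}u,\ \int_0^s\sin(\beta\phi(u,0))\,\mathrm{d}u\Bigr),$$ and let $H_{\Gamma_\beta}$ (formally $-\Delta-\alpha\delta_{\Gamma_\beta}$) be the self-adjoint operator in $L^2(\mathbb{R}^2)$ associated with the quadratic form $$\mathrm{h}[f]=\int_{\mathbb{R}^2}|\nabla f|^2\,\mathrm{d}x-\alpha\int_{\mathbb{R}}|f(\gamma_\beta(s))|^2\,\mathrm{d}s,\qquad f\in W^{1,2}(\mathbb{R}^2),$$ where $f\circ\gamma_\beta$ is understood in the sense of traces. Let $K_0$ be the Macdonald function and $$\mathcal{A}(s,s')=\frac{\alpha^4}{32\pi}K_0'\Bigl(\frac{\alpha}{2}|s-s'|\Bigr)\Bigl(\frac{1}{|s-s'|}\Bigl(\int_{I(s,s')}\phi(u,s')\,\mathrm{d}u\Bigr)^2-\int_{I(s,s')}\phi(u,s')^2\,\mathrm{d}u\Bigr),$$ where $I(s,s')$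 is the (unoriented) interval with endpoints $s$ and $s'$. Then $\mathcal{A}$ is integrable on $\mathbb{R}\times\mathbb{R}$, and there is $\beta_0>0$ such that for every $\beta$ with $0<|\beta|<\beta_0$ the operator $H_{\Gamma_\beta}$ has exactly one eigenvalue $\lambda(H_{\Gamma_\beta})$ below $-\alpha^2/4$; this eigenvalue is simple, and $$\lambda(H_{\Gamma_\beta})=-\frac{\alpha^2}{4}-\Bigl(\int_{\mathbb{R}\times\mathbb{R}}\mathcal{A}(s,s')\,\mathrm{d}s\,\mathrm{d}s'\Bigr)^2\beta^4+o(\beta^4)\qquad(\beta\to0).$$ -/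

import Mathlib

open MeasureTheory Filter Topology Asymptotics
open scoped ContDiff

noncomputable section

namespace LeakyWire

/-- The Euclidean plane. -/
abbrev Plane : Type := EuclideanSpace ℝ (Fin 2)

/-- The complex Hilbert space `L²(ℝ²)`. -/
abbrev L2Plane : Type := Lp ℂ 2 (volume : Measure Plane)

/-- The complex Hilbert space `L²(ℝ)`, identified with `L²(Γ)` by the arc length. -/
abbrev L2Line : Type := Lp ℂ 2 (volume : Measure ℝ)

/-! ### Geometry of the curve -/

/-- On the parameter set `S` the curve runs along a straight line. -/
def StraightOn (γ : ℝ → Plane) (S : Set ℝ) : Prop :=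
  ∃ a v : Plane, ∀ s ∈ S, γ s = a + s • v

/-- The signed curvature `γ₂' γ₁'' - γ₁' γ₂''` of a curve parametrized by its arc length. -/
def curvature (γ : ℝ → Plane) (s : ℝ) : ℝ :=
  deriv γ s 1 * deriv (deriv γ) s 0 - deriv γ s 0 * deriv (deriv γ) s 1

/-- The tangent vector at `p` of the edge that follows `p`. -/
def tangentRight (γ : ℝ → Plane) (p : ℝ) : Plane := limUnder (𝓝[>] p) (deriv γ)

/-- The tangent vector at `p` of the edge that precedes `p`. -/
def tangentLeft (γ : ℝ → Plane) (p : ℝ) : Plane := limUnder (𝓝[<] p) (deriv γ)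

/-- The signed exterior angle at `p`, with values in `(-π, π]`. Its cosine is the inner product
of the two unit tangents, and its sign follows the same orientation as that of `curvature`. -/
def exteriorAngle (γ : ℝ → Plane) (p : ℝ) : ℝ :=
  Complex.arg
    ⟨tangentLeft γ p 0 * tangentRight γ p 0 + tangentLeft γ p 1 * tangentRight γ p 1,
      tangentLeft γ p 1 * tangentRight γ p 0 - tangentLeft γ p 0 * tangentRight γ p 1⟩

/-- A continuous, piecewise `C²` planar curve parametrized by its arc length, with finitely many
vertices `V`, no near self-intersections, straight outside a compact set, and with one-sided
tangents at the vertices. -/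
structure IsAdmissible (γ : ℝ → Plane) (V : Finset ℝ) : Prop where
  continuous : Continuous γ
  contDiffOn : ContDiffOn ℝ 2 γ ((V : Set ℝ)ᶜ)
  unit_speed : ∀ s ∉ V, ‖deriv γ s‖ = 1
  lower_bound : ∃ c : ℝ, 0 < c ∧ c < 1 ∧ ∀ s s' : ℝ, c * |s - s'| ≤ ‖γ s - γ s'‖
  straight_ends : ∃ s₁ s₂ : ℝ, s₂ < s₁ ∧ StraightOn γ (Set.Ici s₁) ∧ StraightOn γ (Set.Iic s₂)
  tangents : ∀ p ∈ V, (∃ t : Plane, Tendsto (deriv γ) (𝓝[>] p) (𝓝 t)) ∧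
    (∃ t : Plane, Tendsto (deriv γ) (𝓝[<] p) (𝓝 t))
  /-- Weaker than piecewise continuity of the curvature, and just what is needed
  for the bending to be defined as an integral of the curvature. -/
  curvature_integrable : Integrable (curvature γ)

/-- The bending `φ(s, s')`: the sum of the exterior angles at the vertices between `s` and `s'`
plus the integral of the curvature from `s` to `s'`; it is antisymmetric in `s, s'`.
If an endpoint is a vertex, then the tangent there is taken from the left. -/
def bending (γ : ℝ → Plane) (V : Finset ℝ) (s s' : ℝ) : ℝ :=
  (∑ p ∈ V with s ≤ p ∧ p < s', exteriorAngle γ p)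
    - (∑ p ∈ V with s' ≤ p ∧ p < s, exteriorAngle γ p)
    + ∫ u in s..s', curvature γ u

/-- The curve `γ_β` whose bending is `β` times the bending of `γ`. -/
def scaledCurve (γ : ℝ → Plane) (V : Finset ℝ) (β : ℝ) (s : ℝ) : Plane :=
  !₂[∫ u in (0 : ℝ)..s, Real.cos (β * bending γ V u 0),
    ∫ u in (0 : ℝ)..s, Real.sin (β * bending γ V u 0)]

/-! ### The Sobolev space, the trace and the Hamiltonian -/

/-- Smooth compactly supported complex functions on the plane. -/
def IsTest (u : Plane → ℂ) : Prop := ContDiff ℝ ∞ u ∧ HasCompactSupport u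

/-- The partial derivative of `u` in the `j`-th coordinate direction. -/
def pderiv (j : Fin 2) (u : Plane → ℂ) (x : Plane) : ℂ :=
  fderiv ℝ u x (EuclideanSpace.single j 1)

/-- `F = (F₀, F₁)` is the weak gradient of `f`; thus `f ∈ W^{1,2}(ℝ²)` if and only if
there is such an `F` in `L²`. -/
def IsWeakGradient (f : L2Plane) (F : Fin 2 → L2Plane) : Prop :=
  ∀ j : Fin 2, ∀ φ : Plane → ℂ, IsTest φ →
    ∫ x, f x * pderiv j φ x = - ∫ x, F j x * φ x

/-- The triples `(u, ∇u, u ∘ γ)` for the test functions `u` on the plane. -/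
def testTriples (γ : ℝ → Plane) : Set (L2Plane × (Fin 2 → L2Plane) × L2Line) :=
  {p | ∃ u : Plane → ℂ, IsTest u ∧ p.1 =ᵐ[volume] u ∧
    (∀ j, p.2.1 j =ᵐ[volume] pderiv j u) ∧ p.2.2 =ᵐ[volume] u ∘ γ}

/-- `f ∈ W^{1,2}(ℝ²)` has the weak gradient `F` and the trace `t` on the curve: the trace map
is the extension by continuity of `u ↦ u ∘ γ` from the test functions to `W^{1,2}(ℝ²)`, that is,
its graph is the closure of the graph over the test functions. -/
def InFormDomain (γ : ℝ → Plane) (f : L2Plane) (F : Fin 2 → L2Plane) (t : L2Line) : Prop :=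
  IsWeakGradient f F ∧ (f, F, t) ∈ closure (testTriples γ)

/-- The sesquilinear form `∫ ∇f · conj ∇g - α ∫_Γ f conj g`, for `f` and `g` with weak gradients
`F` and `G` and with traces `t` and `t'`. -/
def form (α : ℝ) (F : Fin 2 → L2Plane) (t : L2Line) (G : Fin 2 → L2Plane) (t' : L2Line) : ℂ :=
  (∑ j, inner ℂ (G j) (F j)) - (α : ℂ) * inner ℂ t' t

/-- The operator `H = -Δ - α δ_Γ` associated with the form, given by its graph:
`f ∈ D(H)` and `H f = w`, if and only if `f` lies in the form domain `W^{1,2}(ℝ²)` and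
`h(f, g) = (w, g)` for all `g` in the form domain. -/
def HamiltonianMaps (α : ℝ) (γ : ℝ → Plane) (f w : L2Plane) : Prop :=
  ∃ F t, InFormDomain γ f F t ∧
    ∀ g G t', InFormDomain γ g G t' → form α F t G t' = inner ℂ g w

theorem IsTest.zero : IsTest 0 := ⟨contDiff_const, HasCompactSupport.zero⟩

theorem IsTest.add {u v : Plane → ℂ} (hu : IsTest u) (hv : IsTest v) : IsTest (u + v) :=
  ⟨hu.1.add hv.1, hu.2.add hv.2⟩

theorem IsTest.smul {u : Plane → ℂ} (c : ℂ) (hu : IsTest u) : IsTest (c • u) :=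
  ⟨hu.1.const_smul c, hu.2.smul_left (f := fun _ => c)⟩

theorem IsTest.memLp {u : Plane → ℂ} (hu : IsTest u) : MemLp u 2 volume :=
  hu.1.continuous.memLp_of_hasCompactSupport hu.2

theorem IsTest.memLp_pderiv {u : Plane → ℂ} (hu : IsTest u) (j : Fin 2) :
    MemLp (pderiv j u) 2 volume := by
  refine Continuous.memLp_of_hasCompactSupport ?_ (hu.2.fderiv_apply ℝ _)
  exact (hu.1.continuous_fderiv (by simp)).clm_apply continuous_const

theorem IsTest.pderiv_add {u v : Plane → ℂ} (hu : IsTest u) (hv : IsTest v) (j : Fin 2) :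
    pderiv j (u + v) = pderiv j u + pderiv j v := by
  funext x
  simp only [pderiv, Pi.add_apply]
  rw [fderiv_add (hu.1.differentiable (by simp) x) (hv.1.differentiable (by simp) x)]
  rfl

theorem IsTest.pderiv_smul {u : Plane → ℂ} (c : ℂ) (hu : IsTest u) (j : Fin 2) :
    pderiv j (c • u) = c • pderiv j u := by
  funext x
  simp only [pderiv, Pi.smul_apply]
  rw [fderiv_const_smul (hu.1.differentiable (by simp) x)]
  rfl

/-- `testTriples` as a linear subspace. -/
def testSubmodule (γ : ℝ → Plane) : Submodule ℂ (L2Plane × (Fin 2 → L2Plane) × L2Line) where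
  carrier := testTriples γ
  zero_mem' := by
    refine ⟨0, IsTest.zero, Lp.coeFn_zero _ _ _, fun j => ?_, Lp.coeFn_zero _ _ _⟩
    have : pderiv j 0 = 0 := by
      funext x
      simp [pderiv]
    rw [this]
    exact Lp.coeFn_zero _ _ _
  add_mem' := by
    rintro p q ⟨u, hu, h1, h2, h3⟩ ⟨v, hv, k1, k2, k3⟩
    refine ⟨u + v, hu.add hv, (Lp.coeFn_add _ _).trans (h1.add k1), fun j => ?_,
      (Lp.coeFn_add _ _).trans (h3.add k3)⟩
    rw [hu.pderiv_add hv]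
    exact (Lp.coeFn_add _ _).trans ((h2 j).add (k2 j))
  smul_mem' := by
    rintro c p ⟨u, hu, h1, h2, h3⟩
    refine ⟨c • u, hu.smul c, (Lp.coeFn_smul _ _).trans (h1.const_smul c), fun j => ?_,
      (Lp.coeFn_smul _ _).trans (h3.const_smul c)⟩
    rw [hu.pderiv_smul c]
    exact (Lp.coeFn_smul _ _).trans ((h2 j).const_smul c)

theorem isWeakGradient_zero : IsWeakGradient 0 0 := by
  intro j φ _
  have h0 : ((0 : L2Plane) : Plane → ℂ) =ᵐ[volume] 0 := Lp.coeFn_zero _ _ _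
  have h1 : ∫ x, (0 : L2Plane) x * pderiv j φ x = 0 :=
    integral_eq_zero_of_ae (by filter_upwards [h0] with x hx; rw [hx]; simp)
  have h2 : ∫ x, (0 : L2Plane) x * φ x = 0 :=
    integral_eq_zero_of_ae (by filter_upwards [h0] with x hx; rw [hx]; simp)
  simp only [Pi.zero_apply]
  rw [h1, h2, neg_zero]

theorem integral_coeFn_add_mul (f g : L2Plane) {u : Plane → ℂ} (hu : MemLp u 2 volume) :
    ∫ x, (f + g : L2Plane) x * u x = (∫ x, f x * u x) + ∫ x, g x * u x := by
  have hf : Integrable (fun x => f x * u x) := (Lp.memLp f).integrable_mul hu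
  have hg : Integrable (fun x => g x * u x) := (Lp.memLp g).integrable_mul hu
  rw [← integral_add hf hg]
  refine integral_congr_ae ?_
  filter_upwards [Lp.coeFn_add f g] with x hx
  rw [hx, Pi.add_apply, add_mul]

theorem integral_coeFn_smul_mul (c : ℂ) (f : L2Plane) (u : Plane → ℂ) :
    ∫ x, (c • f : L2Plane) x * u x = c * ∫ x, f x * u x := by
  rw [← integral_const_mul]
  refine integral_congr_ae ?_
  filter_upwards [Lp.coeFn_smul c f] with x hx
  rw [hx, Pi.smul_apply, smul_eq_mul, mul_assoc]

theorem IsWeakGradient.add {f g : L2Plane} {F G : Fin 2 → L2Plane}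
    (hf : IsWeakGradient f F) (hg : IsWeakGradient g G) : IsWeakGradient (f + g) (F + G) := by
  intro j φ hφ
  rw [integral_coeFn_add_mul _ _ (hφ.memLp_pderiv j), hf j φ hφ, hg j φ hφ, Pi.add_apply,
    integral_coeFn_add_mul _ _ hφ.memLp]
  ring

theorem IsWeakGradient.smul {f : L2Plane} {F : Fin 2 → L2Plane} (c : ℂ)
    (hf : IsWeakGradient f F) : IsWeakGradient (c • f) (c • F) := by
  intro j φ hφ
  rw [integral_coeFn_smul_mul, hf j φ hφ, Pi.smul_apply, integral_coeFn_smul_mul]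
  ring

theorem inFormDomain_zero (γ : ℝ → Plane) : InFormDomain γ 0 0 0 :=
  ⟨isWeakGradient_zero, (testSubmodule γ).topologicalClosure.zero_mem⟩

theorem InFormDomain.add {γ : ℝ → Plane} {f g : L2Plane} {F G : Fin 2 → L2Plane} {t t' : L2Line}
    (hf : InFormDomain γ f F t) (hg : InFormDomain γ g G t') :
    InFormDomain γ (f + g) (F + G) (t + t') :=
  ⟨hf.1.add hg.1, (testSubmodule γ).topologicalClosure.add_mem hf.2 hg.2⟩

theorem InFormDomain.smul {γ : ℝ → Plane} {f : L2Plane} {F : Fin 2 → L2Plane} {t : L2Line}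
    (c : ℂ) (hf : InFormDomain γ f F t) : InFormDomain γ (c • f) (c • F) (c • t) :=
  ⟨hf.1.smul c, (testSubmodule γ).topologicalClosure.smul_mem c hf.2⟩

/-- The eigenspace `{f ∈ D(H) : H f = μ f}` of the Hamiltonian; the number `μ` is an eigenvalue
if and only if this space is nonzero. -/
def eigenspace (α : ℝ) (γ : ℝ → Plane) (μ : ℝ) : Submodule ℂ L2Plane where
  carrier := {f | HamiltonianMaps α γ f ((μ : ℂ) • f)}
  zero_mem' := by
    refine ⟨0, 0, inFormDomain_zero γ, fun g G t' _ => ?_⟩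
    simp [form]
  add_mem' := by
    rintro f g ⟨F, t, hf, h⟩ ⟨G, t', hg, k⟩
    refine ⟨F + G, t + t', hf.add hg, fun g' G' t'' hg' => ?_⟩
    rw [smul_add, inner_add_right, ← h g' G' t'' hg', ← k g' G' t'' hg']
    simp only [form, Pi.add_apply, inner_add_right, Finset.sum_add_distrib]
    ring
  smul_mem' := by
    rintro c f ⟨F, t, hf, h⟩
    refine ⟨c • F, c • t, hf.smul c, fun g' G' t'' hg' => ?_⟩
    rw [smul_comm, inner_smul_right, ← h g' G' t'' hg']
    simp only [form, Pi.smul_apply, inner_smul_right, ← Finset.mul_sum]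
    ring

/-- `μ` is an eigenvalue of the Hamiltonian. -/
def IsEigenvalue (α : ℝ) (γ : ℝ → Plane) (μ : ℝ) : Prop := eigenspace α γ μ ≠ ⊥

/-! ### The kernel in the leading coefficient -/

/-- The Macdonald function `K₀(x) = ∫₀^∞ exp(-x cosh t) dt`, for `x > 0`. -/
def macdonaldK0 (x : ℝ) : ℝ := ∫ t in Set.Ioi (0 : ℝ), Real.exp (-x * Real.cosh t)

/-- The kernel `𝒜(s, s')`. The integrals are over the interval between `s'` and `s`,
without regard to its orientation. -/
def kernelA (α : ℝ) (γ : ℝ → Plane) (V : Finset ℝ) (s s' : ℝ) : ℝ :=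
  α ^ 4 / (32 * Real.pi) * deriv macdonaldK0 (α / 2 * |s - s'|) *
    (|s - s'|⁻¹ * (∫ u in Set.uIoc s' s, bending γ V u s') ^ 2
      - ∫ u in Set.uIoc s' s, bending γ V u s' ^ 2)

end LeakyWire

end

noncomputable section

namespace LeakyWire

/-! ### The bending function -/

/-! The proof combines the Birman–Schwinger principle with a weak coupling argument at the threshold
-α²/4.

Birman–Schwinger. For κ > 0 the number -κ² is an eigenvalue exactly when t = α R t has a nonzero
solution in L²(ℝ), where R is the integral operator with kernel K₀(κ|γ_β(s) - γ_β(s')|)/(2π). The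
Bessel potential (-Δ + κ²)^{-1/2} maps L²(ℝ²) onto the form domain. If T sends a density u on the
curve to (-Δ + κ²)^{-1/2}(u δ_γ), then T* is the trace of the potential, T*T = R, and the eigenvalue
equation reads h = α T T* h (`mem_eigenspace_iff`). The identity T*T = R rests on
`IsHeatSuperposition.integral_symbol`: the symbol is a superposition of Gaussians and the Green
function is the same superposition of heat kernels.

The straight line. Write κ² = α²/4 + δ². For the line, R is the Fourier multiplier 1/(2√(4π²p² +
κ²)). Partial fractions split the inverse of 1 - αR into a multiplier that stays bounded as δ → 0
and α²/2 times the resolvent of the one-dimensional Laplacian, with kernel e^{-δ|s-s'|}/(2δ)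
(`inverse_symbol`). Between decaying weights w this becomes the rank one operator α²/(4δ) (w, ·) w
plus an operator N that is Lipschitz in δ up to δ = 0 (`weighted_lineInv`).

The perturbation. The difference of the kernels of the bent curve and of the line is nonnegative,
because chords are shorter than arcs and K₀ decreases. It is O(β²), and it vanishes when both points
lie on the same straight end, so it decays rapidly in both variables (`abs_bentKernel_le`). Dividing
it by the weights gives a bounded operator D of size O(β²).

Reduction to a scalar equation. Eliminating the rank one part leaves δ = F(δ) with F(δ) = (α³/4) (w,
(1 - αDN)⁻¹ D w), as carried out in `eq_zero_of_mem_ker` and `exists_span_ker`. The function F has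
Lipschitz constant O(β²) on δ ≥ 0 (`abs_couplingFn_sub_le`), so F(0) > 0 yields exactly one positive
fixed point, equal to F(0)(1 + O(β²)). The eigenvalue is -α²/4 - δ², and it is simple.

The coefficient. Up to O(β⁴), F(0) is α³/4 times the integral of the perturbation kernel. Expanding
the chord to second order in β shows that F(0)/β² tends to the integral of the kernel 𝒜, whose
geometric factor is minus length times variance of the bending on an interval
(`tendsto_bentKernel_div`, `kernelA_ae_eq`). This integral is positive unless the bending is almost
everywhere constant, and then the curve would be straight (`straight_of_turning_const`). -/

/-- The total turning angle up to `x`, a primitive of the bending. -/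
def turning (γ : ℝ → Plane) (V : Finset ℝ) (x : ℝ) : ℝ :=
  (∑ p ∈ V with p < x, exteriorAngle γ p) + ∫ u in (0 : ℝ)..x, curvature γ u

/-- Checked vertex by vertex, according to the position of the vertex relative to both endpoints; it
gives the bending a primitive. -/
theorem sum_filter_lt_sub (c : ℝ → ℝ) (V : Finset ℝ) (s s' : ℝ) :
    (∑ p ∈ V with s ≤ p ∧ p < s', c p) - (∑ p ∈ V with s' ≤ p ∧ p < s, c p)
      = (∑ p ∈ V with p < s', c p) - ∑ p ∈ V with p < s, c p := by
  simp only [Finset.sum_filter, ← Finset.sum_sub_distrib]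
  refine Finset.sum_congr rfl fun p _ => ?_
  by_cases h1 : p < s' <;> by_cases h2 : p < s
  · simp [h1, h2, not_le.2 h1, not_le.2 h2]
  · simp [h1, h2, not_lt.1 h2]
  · simp [h1, h2, not_lt.1 h1]
  · simp [h1, h2]

theorem bending_eq_turning {γ : ℝ → Plane} {V : Finset ℝ} (h : IsAdmissible γ V) (s s' : ℝ) :
    bending γ V s s' = turning γ V s' - turning γ V s := by
  have hi : ∀ a b, IntervalIntegrable (curvature γ) volume a b := fun a b =>
    h.curvature_integrable.intervalIntegrable
  rw [bending, turning, turning, sum_filter_lt_sub,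
    ← intervalIntegral.integral_interval_sub_left (hi 0 s') (hi 0 s)]
  ring

/-- Additivity of the turning angle. The two-point bending is therefore governed by the single
function u ↦ φ(u, 0), and changing the base point only subtracts a constant. -/
theorem bending_eq_sub {γ : ℝ → Plane} {V : Finset ℝ} (h : IsAdmissible γ V) (s s' : ℝ) :
    bending γ V s s' = bending γ V s 0 - bending γ V s' 0 := by
  simp only [bending_eq_turning h]
  ring

theorem measurable_bending {γ : ℝ → Plane} {V : Finset ℝ} (h : IsAdmissible γ V) :
    Measurable fun u => bending γ V u 0 := by
  simp only [bending_eq_turning h]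
  refine measurable_const.sub (Measurable.add ?_ ?_)
  · simp only [Finset.sum_filter]
    refine Finset.measurable_sum _ fun p _ => ?_
    exact Measurable.ite measurableSet_Ioi measurable_const measurable_const
  · exact (intervalIntegral.continuous_primitive
      (fun a b => h.curvature_integrable.intervalIntegrable) 0).measurable

theorem exists_bending_bound {γ : ℝ → Plane} {V : Finset ℝ} (h : IsAdmissible γ V) :
    ∃ M : ℝ, 0 ≤ M ∧ ∀ u, |bending γ V u 0| ≤ M := by
  have key : ∀ x, |turning γ V x| ≤ (∑ p ∈ V, |exteriorAngle γ p|) + ∫ u, |curvature γ u| := by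
    intro x
    refine (abs_add_le _ _).trans (add_le_add ?_ ?_)
    · refine (Finset.abs_sum_le_sum_abs _ _).trans ?_
      exact Finset.sum_le_sum_of_subset_of_nonneg (Finset.filter_subset _ _)
        fun _ _ _ => abs_nonneg _
    · rw [← Real.norm_eq_abs]
      refine intervalIntegral.norm_integral_le_integral_norm_uIoc.trans ?_
      simp only [Real.norm_eq_abs]
      exact setIntegral_le_integral h.curvature_integrable.abs
        (Eventually.of_forall fun _ => abs_nonneg _)
  refine ⟨|turning γ V 0| + ((∑ p ∈ V, |exteriorAngle γ p|) + ∫ u, |curvature γ u|), ?_, ?_⟩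
  · exact add_nonneg (abs_nonneg _) ((abs_nonneg _).trans (key 0))
  · intro u
    rw [bending_eq_turning h]
    exact (abs_sub _ _).trans (add_le_add le_rfl (key u))

theorem deriv_deriv_eq_zero_of_straight {γ : ℝ → Plane} {U : Set ℝ} (hU : IsOpen U)
    (h : StraightOn γ U) {s : ℝ} (hs : s ∈ U) : deriv (deriv γ) s = 0 := by
  obtain ⟨a, v, hav⟩ := h
  have h1 : ∀ x ∈ U, deriv γ x = v := by
    intro x hx
    have he : γ =ᶠ[𝓝 x] fun y => a + y • v := by
      filter_upwards [hU.mem_nhds hx] with y hy using hav y hy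
    rw [he.deriv_eq]
    have : HasDerivAt (fun y : ℝ => a + y • v) ((1 : ℝ) • v) x :=
      ((hasDerivAt_id x).smul_const v).const_add a
    rw [this.deriv, one_smul]
  have he : deriv γ =ᶠ[𝓝 s] fun _ => v := by
    filter_upwards [hU.mem_nhds hs] with y hy using h1 y hy
  rw [he.deriv_eq, deriv_const]

theorem curvature_eq_zero_of_straight {γ : ℝ → Plane} {U : Set ℝ} (hU : IsOpen U)
    (h : StraightOn γ U) {s : ℝ} (hs : s ∈ U) : curvature γ s = 0 := by
  simp [curvature, deriv_deriv_eq_zero_of_straight hU h hs]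

theorem StraightOn.mono {γ : ℝ → Plane} {S T : Set ℝ} (h : StraightOn γ T) (hST : S ⊆ T) :
    StraightOn γ S := by
  obtain ⟨a, v, hav⟩ := h
  exact ⟨a, v, fun s hs => hav s (hST hs)⟩

theorem exists_bending_const {γ : ℝ → Plane} {V : Finset ℝ} (h : IsAdmissible γ V) :
    ∃ S : ℝ, 0 < S ∧ (∀ u, S ≤ u → bending γ V u 0 = bending γ V S 0) ∧
      (∀ u, u ≤ -S → bending γ V u 0 = bending γ V (-S) 0) := by
  obtain ⟨s₁, s₂, -, h1, h2⟩ := h.straight_ends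
  have hi : ∀ a b, IntervalIntegrable (curvature γ) volume a b := fun a b =>
    h.curvature_integrable.intervalIntegrable
  -- This radius exceeds |s₁|, |s₂| and the modulus of every vertex, so neither curvature nor
  -- corners remain outside it.
  refine ⟨1 + |s₁| + |s₂| + ∑ p ∈ V, |p|, ?_, ?_, ?_⟩
  · have : 0 ≤ ∑ p ∈ V, |p| := Finset.sum_nonneg fun _ _ => abs_nonneg _
    positivity
  all_goals
    set S := 1 + |s₁| + |s₂| + ∑ p ∈ V, |p| with hS
    have hV : ∀ p ∈ V, |p| ≤ ∑ p ∈ V, |p| := fun p hp =>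
      Finset.single_le_sum (f := fun p => |p|) (fun _ _ => abs_nonneg _) hp
    have e1 := le_abs_self s₁
    have e2 := neg_abs_le s₂
    have e3 := abs_nonneg s₁
    have e4 := abs_nonneg s₂
    intro u hu
    rw [bending_eq_turning h, bending_eq_turning h]
    congr 1
    rw [turning, turning]
    congr 1
  · congr 1
    refine Finset.filter_congr fun p hp => ?_
    have := hV p hp
    have := le_abs_self p
    constructor <;> intro _ <;> linarith
  · rw [← sub_eq_zero, intervalIntegral.integral_interval_sub_left (hi 0 u) (hi 0 S)]
    refine intervalIntegral.integral_zero_ae (Eventually.of_forall fun x hx => ?_)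
    rw [Set.uIoc_of_le hu] at hx
    refine curvature_eq_zero_of_straight isOpen_Ioi (h1.mono Set.Ioi_subset_Ici_self) ?_
    have := Finset.sum_nonneg (s := V) (f := fun p => |p|) fun _ _ => abs_nonneg _
    simp only [Set.mem_Ioi]
    linarith [hx.1]
  · congr 1
    refine Finset.filter_congr fun p hp => ?_
    have := hV p hp
    have := neg_abs_le p
    constructor <;> intro _ <;> linarith
  · rw [← sub_eq_zero, intervalIntegral.integral_interval_sub_left (hi 0 u) (hi 0 (-S))]
    refine intervalIntegral.integral_zero_ae (Eventually.of_forall fun x hx => ?_)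
    rw [Set.uIoc_of_ge hu] at hx
    refine curvature_eq_zero_of_straight isOpen_Iio (h2.mono Set.Iio_subset_Iic_self) ?_
    have := Finset.sum_nonneg (s := V) (f := fun p => |p|) fun _ _ => abs_nonneg _
    simp only [Set.mem_Iio]
    linarith [hx.2]

/-! ### A curve without bending is straight -/

theorem isOpen_compl_finset (V : Finset ℝ) : IsOpen ((V : Set ℝ)ᶜ) :=
  V.finite_toSet.isClosed.isOpen_compl

theorem IsAdmissible.hasDerivAt {γ : ℝ → Plane} {V : Finset ℝ} (h : IsAdmissible γ V) {s : ℝ}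
    (hs : s ∉ V) : HasDerivAt γ (deriv γ s) s := by
  have := (h.contDiffOn.contDiffAt ((isOpen_compl_finset V).mem_nhds (by simpa using hs)))
  exact (this.differentiableAt (by norm_num)).hasDerivAt

theorem IsAdmissible.contDiffOn_deriv {γ : ℝ → Plane} {V : Finset ℝ} (h : IsAdmissible γ V) :
    ContDiffOn ℝ 1 (deriv γ) ((V : Set ℝ)ᶜ) :=
  ((contDiffOn_succ_iff_deriv_of_isOpen (n := 1) (isOpen_compl_finset V)).1
    (by simpa [one_add_one_eq_two] using h.contDiffOn)).2.2

theorem IsAdmissible.hasDerivAt_deriv {γ : ℝ → Plane} {V : Finset ℝ} (h : IsAdmissible γ V) {s : ℝ}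
    (hs : s ∉ V) : HasDerivAt (deriv γ) (deriv (deriv γ) s) s :=
  ((h.contDiffOn_deriv.contDiffAt ((isOpen_compl_finset V).mem_nhds
    (by simpa using hs))).differentiableAt (by norm_num)).hasDerivAt

theorem IsAdmissible.continuousOn_curvature {γ : ℝ → Plane} {V : Finset ℝ}
    (h : IsAdmissible γ V) : ContinuousOn (curvature γ) ((V : Set ℝ)ᶜ) := by
  have h1 : ContinuousOn (deriv γ) ((V : Set ℝ)ᶜ) := h.contDiffOn_deriv.continuousOn
  have h2 : ContinuousOn (deriv (deriv γ)) ((V : Set ℝ)ᶜ) :=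
    h.contDiffOn_deriv.continuousOn_deriv_of_isOpen (isOpen_compl_finset V) le_rfl
  have hp : ∀ (i : Fin 2) {f : ℝ → Plane} {s : Set ℝ}, ContinuousOn f s →
      ContinuousOn (fun x => f x i) s := fun i f s hf =>
    (EuclideanSpace.proj (𝕜 := ℝ) i).continuous.comp_continuousOn hf
  exact ((hp 1 h1).mul (hp 0 h2)).sub ((hp 0 h1).mul (hp 1 h2))

theorem norm_sq_plane (x : Plane) : ‖x‖ ^ 2 = x 0 ^ 2 + x 1 ^ 2 := by
  rw [EuclideanSpace.norm_sq_eq]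
  simp

/-- Two orthogonal vectors of the plane with vanishing determinant. -/
theorem eq_zero_of_dot_of_det {a b c d : ℝ} (h : a ^ 2 + b ^ 2 = 1) (h1 : a * c + b * d = 0)
    (h2 : b * c - a * d = 0) : c = 0 ∧ d = 0 := by
  constructor
  · linear_combination (-c) * h + a * h1 + b * h2
  · linear_combination (-d) * h + b * h1 - a * h2

/-- Differentiating |γ'|² = 1 makes γ'' orthogonal to γ', while vanishing curvature makes it
parallel to γ'. -/
theorem IsAdmissible.deriv_deriv_eq_zero {γ : ℝ → Plane} {V : Finset ℝ} (h : IsAdmissible γ V)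
    {s : ℝ} (hs : s ∉ V) (hk : curvature γ s = 0) : deriv (deriv γ) s = 0 := by
  have hd := h.hasDerivAt_deriv hs
  have hi : ∀ i : Fin 2, HasDerivAt (fun x => deriv γ x i) (deriv (deriv γ) s i) s := fun i =>
    (EuclideanSpace.proj (𝕜 := ℝ) i).hasFDerivAt.comp_hasDerivAt s hd
  have h2 := ((hi 0).pow 2).add ((hi 1).pow 2)
  have hc : ((fun x => deriv γ x 0) ^ 2 + (fun x => deriv γ x 1) ^ 2) =ᶠ[𝓝 s]
      fun _ => (1 : ℝ) := by
    filter_upwards [(isOpen_compl_finset V).mem_nhds (by simpa using hs)] with x hx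
    have := h.unit_speed x (by simpa using hx)
    simp only [Pi.add_apply, Pi.pow_apply]
    rw [← norm_sq_plane, this, one_pow]
  have h0 := (hc.hasDerivAt_iff.1 h2).unique (hasDerivAt_const s (1 : ℝ))
  have hn := norm_sq_plane (deriv γ s)
  rw [h.unit_speed s hs, one_pow] at hn
  have := eq_zero_of_dot_of_det (c := deriv (deriv γ) s 0) (d := deriv (deriv γ) s 1) hn.symm
    (by simp at h0; linarith) (by simpa [curvature] using hk)
  ext i
  fin_cases i
  · exact this.1
  · exact this.2

theorem turning_sub_of_forall_curvature_eq_zero {γ : ℝ → Plane} {V : Finset ℝ}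
    (hk : ∀ s ∉ V, curvature γ s = 0) (x y : ℝ) :
    turning γ V x - turning γ V y = (∑ p ∈ V with p < x, exteriorAngle γ p)
      - ∑ p ∈ V with p < y, exteriorAngle γ p := by
  have h0 : ∀ a, ∫ u in (0 : ℝ)..a, curvature γ u = 0 := fun a =>
    intervalIntegral.integral_zero_ae (by
      filter_upwards [compl_mem_ae_iff.2 (V.finite_toSet.measure_zero volume)] with u hu _
      exact hk u (by simpa using hu))
  simp [turning, h0]

/-- A zero argument means a vanishing determinant and a nonnegative inner product. By Lagrange's
identity the inner product of the two unit vectors has square 1, hence equals 1. -/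
theorem eq_of_exteriorAngle_eq_zero {γ : ℝ → Plane} {p : ℝ} {a b : Plane}
    (ha : tangentLeft γ p = a) (hb : tangentRight γ p = b)
    (hna : ‖a‖ = 1) (hnb : ‖b‖ = 1) (h : exteriorAngle γ p = 0) : a = b := by
  rw [exteriorAngle, ha, hb, Complex.arg_eq_zero_iff] at h
  obtain ⟨h1, h2⟩ := h
  simp only at h1 h2
  have ea := norm_sq_plane a
  have eb := norm_sq_plane b
  rw [hna, one_pow] at ea
  rw [hnb, one_pow] at eb
  have hsq : (a 0 * b 0 + a 1 * b 1) ^ 2 = 1 := by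
    linear_combination (-(b 0 ^ 2) - b 1 ^ 2) * ea - eb - (a 1 * b 0 - a 0 * b 1) * h2
  have h3 : a 0 * b 0 + a 1 * b 1 = 1 := by nlinarith
  have h4 : (a 0 - b 0) ^ 2 + (a 1 - b 1) ^ 2 = 0 := by linear_combination -ea - eb - 2 * h3
  have h5 : a 0 - b 0 = 0 := by nlinarith [sq_nonneg (a 0 - b 0), sq_nonneg (a 1 - b 1)]
  have h6 : a 1 - b 1 = 0 := by nlinarith [sq_nonneg (a 0 - b 0), sq_nonneg (a 1 - b 1)]
  ext i
  fin_cases i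
  · simpa [sub_eq_zero] using h5
  · simpa [sub_eq_zero] using h6

theorem eventually_notMem_finset (V : Finset ℝ) (p : ℝ) : ∀ᶠ x in 𝓝[≠] p, x ∉ V := by
  have : ∀ᶠ x in 𝓝[≠] p, x ∈ ((V.erase p : Finset ℝ) : Set ℝ)ᶜ :=
    mem_nhdsWithin_of_mem_nhds ((isOpen_compl_finset _).mem_nhds (by simp))
  filter_upwards [this, self_mem_nhdsWithin] with x hx hxp hV
  exact hx (by simpa using ⟨hV, hxp⟩)

/-- A constant turning angle leaves no curvature and no corner, so the tangent extends continuously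
across the vertices with zero derivative elsewhere. Constancy is assumed only almost everywhere,
since this is what a vanishing variance provides. -/
theorem straight_of_turning_const {γ : ℝ → Plane} {V : Finset ℝ} (h : IsAdmissible γ V)
    {c : ℝ} (hc : ∀ᵐ x, turning γ V x = c) : StraightOn γ Set.univ := by
  have hO := isOpen_compl_finset V
  -- the curvature vanishes
  have hk : ∀ s ∉ V, curvature γ s = 0 := by
    intro s hs
    have hsO : (V : Set ℝ)ᶜ ∈ 𝓝 s := hO.mem_nhds (by simpa using hs)
    have hcont : ∀ x ∉ V, ContinuousAt (turning γ V) x := by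
      intro x hx
      refine ContinuousAt.add ?_ (intervalIntegral.continuous_primitive
        (fun a b => h.curvature_integrable.intervalIntegrable) 0).continuousAt
      simp only [Finset.sum_filter]
      refine tendsto_finsetSum _ fun p hp => ?_
      rcases lt_or_gt_of_ne (show p ≠ x from fun e => hx (e ▸ hp)) with hlt | hlt
      · refine tendsto_const_nhds.congr' ?_
        filter_upwards [lt_mem_nhds hlt] with y hy
        simp [hlt, hy]
      · refine tendsto_const_nhds.congr' ?_
        filter_upwards [gt_mem_nhds hlt] with y hy
        simp [not_lt.2 hlt.le, not_lt.2 hy.le]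
    -- A set of full measure is dense and the turning is continuous away from the vertices, so the
    -- almost everywhere value is attained there.
    have hall : ∀ x ∉ V, turning γ V x = c := by
      intro x hx
      have hd : Dense {y | turning γ V y = c} := Measure.dense_of_ae hc
      have : ∃ᶠ y in 𝓝 x, turning γ V y = c := mem_closure_iff_frequently.1 (hd x)
      by_contra hne
      exact this ((hcont x hx).eventually_ne hne)
    have hder : HasDerivAt (fun x => ∫ u in (0 : ℝ)..x, curvature γ u) (curvature γ s) s :=
      intervalIntegral.integral_hasDerivAt_right
        h.curvature_integrable.intervalIntegrable
        (h.continuousOn_curvature.stronglyMeasurableAtFilter hO s (by simpa using hs))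
        (h.continuousOn_curvature.continuousAt hsO)
    have hev : (fun x => ∫ u in (0 : ℝ)..x, curvature γ u) =ᶠ[𝓝 s]
        fun _ => c - ∑ p ∈ V with p < s, exteriorAngle γ p := by
      have hf : ∀ᶠ x in 𝓝 s, ∀ p ∈ V, (p < x ↔ p < s) := by
        refine (Finset.eventually_all V).2 fun p hp => ?_
        rcases lt_or_gt_of_ne (show p ≠ s from fun e => hs (e ▸ hp)) with hlt | hlt
        · filter_upwards [lt_mem_nhds hlt] with y hy
          simp [hlt, hy]
        · filter_upwards [gt_mem_nhds hlt] with y hy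
          simp [not_lt.2 hlt.le, not_lt.2 hy.le]
      filter_upwards [hf, hsO] with x hx hxV
      have := hall x (by simpa using hxV)
      rw [turning, Finset.filter_congr hx] at this
      linarith
    exact (hev.hasDerivAt_iff.1 hder).unique (hasDerivAt_const _ _)
  have hd2 : ∀ s ∉ V, deriv (deriv γ) s = 0 := fun s hs => h.deriv_deriv_eq_zero hs (hk s hs)
  -- there are no corners
  have hang : ∀ p ∈ V, exteriorAngle γ p = 0 := by
    intro p hp
    have hfr : ∀ {U : Set ℝ}, IsOpen U → U.Nonempty → ∃ x ∈ U, turning γ V x = c := by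
      intro U hU hne
      obtain ⟨x, hx, hxc⟩ := (Measure.dense_of_ae hc).exists_mem_open hU hne
      exact ⟨x, hxc, hx⟩
    have hr : ∃ b, p < b ∧ ∀ x ∈ Set.Ioo p b, x ∉ V := by
      have := (eventually_notMem_finset V p).filter_mono
        (nhdsWithin_mono p (fun x (hx : p < x) => hx.ne'))
      obtain ⟨b, hb, hsub⟩ := (mem_nhdsGT_iff_exists_Ioo_subset).1 this
      exact ⟨b, hb, hsub⟩
    have hl : ∃ a, a < p ∧ ∀ x ∈ Set.Ioo a p, x ∉ V := by
      have := (eventually_notMem_finset V p).filter_mono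
        (nhdsWithin_mono p (fun x (hx : x < p) => hx.ne))
      obtain ⟨b, hb, hsub⟩ := (mem_nhdsLT_iff_exists_Ioo_subset).1 this
      exact ⟨b, hb, hsub⟩
    obtain ⟨b, hb, hbV⟩ := hr
    obtain ⟨a, ha, haV⟩ := hl
    obtain ⟨x, hx, hxc⟩ := hfr isOpen_Ioo (Set.nonempty_Ioo.2 hb)
    obtain ⟨y, hy, hyc⟩ := hfr isOpen_Ioo (Set.nonempty_Ioo.2 ha)
    have e := turning_sub_of_forall_curvature_eq_zero hk x y
    rw [hxc, hyc, sub_self] at e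
    -- The only vertex between y and x is p, so the cumulative sums of angles differ by the angle at
    -- p alone.
    have : (V.filter fun q => q < x) = insert p (V.filter fun q => q < y) := by
      ext q
      simp only [Finset.mem_filter, Finset.mem_insert]
      constructor
      · rintro ⟨hq, hqx⟩
        by_cases hqp : q = p
        · exact Or.inl hqp
        · refine Or.inr ⟨hq, ?_⟩
          rcases lt_or_gt_of_ne hqp with h' | h'
          · by_contra hqy
            rcases (not_lt.1 hqy).eq_or_lt with h'' | h''
            · exact haV y hy (h'' ▸ hq)
            · exact haV q ⟨hy.1.trans h'', h'⟩ hq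
          · exact absurd hq (hbV q ⟨h', hqx.trans hx.2⟩)
      · rintro (rfl | ⟨hq, hqy⟩)
        · exact ⟨hp, hx.1⟩
        · exact ⟨hq, hqy.trans (hy.2.trans hx.1)⟩
    rw [this, Finset.sum_insert (by simp [hy.2.le])] at e
    linarith
  -- the tangent extends to a continuous function
  have htan : ∀ p ∈ V, ∃ t, Tendsto (deriv γ) (𝓝[≠] p) (𝓝 t) := by
    intro p hp
    obtain ⟨⟨t, ht⟩, ⟨t', ht'⟩⟩ := h.tangents p hp
    have hn : ∀ {l : Filter ℝ} {τ : Plane} [l.NeBot], l ≤ 𝓝[≠] p → Tendsto (deriv γ) l (𝓝 τ) →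
        ‖τ‖ = 1 := by
      intro l τ _ hl hτ
      refine tendsto_nhds_unique hτ.norm (tendsto_const_nhds.congr' ?_)
      filter_upwards [(eventually_notMem_finset V p).filter_mono hl] with x hx
      exact (h.unit_speed x hx).symm
    have hg : 𝓝[>] p ≤ 𝓝[≠] p := nhdsWithin_mono p (fun x (hx : p < x) => hx.ne')
    have hl : 𝓝[<] p ≤ 𝓝[≠] p := nhdsWithin_mono p (fun x (hx : x < p) => hx.ne)
    have : t' = t := eq_of_exteriorAngle_eq_zero ht'.limUnder_eq ht.limUnder_eq (hn hl ht')
      (hn hg ht) (hang p hp)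
    subst this
    refine ⟨t', ?_⟩
    rw [← Set.Iio_union_Ioi, nhdsWithin_union]
    exact ht'.sup ht
  choose! τ hτ using htan
  classical
  -- At a vertex the derivative of γ may not exist, so its junk value is replaced by the common
  -- one-sided limit.
  set v : ℝ → Plane := fun s => if s ∈ V then τ s else deriv γ s with hv
  have hvV : ∀ s ∉ V, v =ᶠ[𝓝 s] deriv γ := by
    intro s hs
    filter_upwards [hO.mem_nhds (by simpa using hs)] with x hx
    have : x ∉ V := by simpa using hx
    simp [hv, this]
  have hder : ∀ s ∉ V, HasDerivAt v 0 s := fun s hs =>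
    (hvV s hs).hasDerivAt_iff.2 (hd2 s hs ▸ h.hasDerivAt_deriv hs)
  have hvc : Continuous v := by
    refine continuous_iff_continuousAt.2 fun s => ?_
    by_cases hs : s ∈ V
    · rw [continuousAt_iff_punctured_nhds]
      simp only [hv, hs, if_true]
      refine (hτ s hs).congr' ?_
      filter_upwards [eventually_notMem_finset V s] with x hx
      simp [hx]
    · exact (hder s hs).continuousAt
  have hconst : ∀ s, v s = v 0 := by
    intro s
    have := MeasureTheory.integral_eq_of_hasDerivAt_off_countable (f := v) (f' := fun _ => 0)
      (a := 0) (b := s) (s := (V : Set ℝ)) V.countable_toSet hvc.continuousOn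
      (fun x hx => hder x (by simpa using hx.2)) (by simp)
    simp at this
    exact (sub_eq_zero.1 this.symm)
  refine ⟨γ 0, v 0, fun s _ => ?_⟩
  have := MeasureTheory.integral_eq_of_hasDerivAt_off_countable (f := γ) (f' := fun _ => v 0)
      (a := 0) (b := s) (s := (V : Set ℝ)) V.countable_toSet h.continuous.continuousOn
      (fun x hx => by
        have hxV : x ∉ V := by simpa using hx.2
        rw [← hconst x, (hvV x hxV).eq_of_nhds]
        exact h.hasDerivAt hxV) (by simp)
  simp only [intervalIntegral.integral_const, sub_zero] at this
  rw [this]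
  abel

theorem not_bending_ae_const {γ : ℝ → Plane} {V : Finset ℝ} (h : IsAdmissible γ V)
    (hb : ¬ StraightOn γ Set.univ) (c : ℝ) : ¬ ∀ᵐ u, bending γ V u 0 = c := by
  intro hc
  refine hb (straight_of_turning_const (c := turning γ V 0 - c) h ?_)
  filter_upwards [hc] with u hu
  rw [bending_eq_turning h] at hu
  linarith

end LeakyWire
end

noncomputable section

namespace LeakyWire

/-! ### Macdonald functions -/

/-- The Macdonald function `K₁`. -/
def macdonaldK1 (x : ℝ) : ℝ :=
  ∫ t in Set.Ioi (0 : ℝ), Real.cosh t * Real.exp (-x * Real.cosh t)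

theorem integrableOn_sinh_mul_exp_cosh {x : ℝ} (hx : 0 < x) :
    IntegrableOn (fun t => Real.sinh t * Real.exp (-x * Real.cosh t)) (Set.Ioi 0) ∧
    ∫ t in Set.Ioi (0 : ℝ), Real.sinh t * Real.exp (-x * Real.cosh t) = x⁻¹ * Real.exp (-x) := by
  have hd : ∀ t ∈ Set.Ici (0 : ℝ), HasDerivAt (fun t => -x⁻¹ * Real.exp (-x * Real.cosh t))
      (Real.sinh t * Real.exp (-x * Real.cosh t)) t := by
    intro t _
    have := (((Real.hasDerivAt_cosh t).const_mul (-x)).exp).const_mul (-x⁻¹)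
    refine this.congr_deriv ?_
    field_simp
  have hpos : ∀ t ∈ Set.Ioi (0 : ℝ), 0 ≤ Real.sinh t * Real.exp (-x * Real.cosh t) := fun t ht =>
    mul_nonneg (Real.sinh_nonneg_iff.2 (le_of_lt ht)) (Real.exp_pos _).le
  have hcosh : Tendsto Real.cosh atTop atTop := by
    refine tendsto_atTop_mono' _ ?_ (tendsto_id (α := ℝ))
    filter_upwards [eventually_ge_atTop 0] with t ht
    exact (Real.self_le_sinh_iff.2 ht).trans (Real.sinh_lt_cosh t).le
  have hlim : Tendsto (fun t => -x⁻¹ * Real.exp (-x * Real.cosh t)) atTop (𝓝 0) := by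
    have : Tendsto (fun t => -x * Real.cosh t) atTop atBot :=
      hcosh.const_mul_atTop_of_neg (by linarith)
    simpa using (Real.tendsto_exp_atBot.comp this).const_mul (-x⁻¹)
  refine ⟨integrableOn_Ioi_deriv_of_nonneg' hd hpos hlim, ?_⟩
  rw [integral_Ioi_of_hasDerivAt_of_nonneg' hd hpos hlim]
  simp

theorem integrableOn_exp_neg_mul_exp_cosh {x : ℝ} (hx : 0 ≤ x) :
    IntegrableOn (fun t => Real.exp (-t) * Real.exp (-x * Real.cosh t)) (Set.Ioi 0) ∧
    ∫ t in Set.Ioi (0 : ℝ), Real.exp (-t) * Real.exp (-x * Real.cosh t) ≤ Real.exp (-x) := by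
  have h1 : IntegrableOn (fun t : ℝ => Real.exp (-t) * Real.exp (-x)) (Set.Ioi 0) :=
    (integrableOn_exp_neg_Ioi 0).mul_const _
  have hle : ∀ t : ℝ, Real.exp (-t) * Real.exp (-x * Real.cosh t)
      ≤ Real.exp (-t) * Real.exp (-x) := fun t => by
    refine mul_le_mul_of_nonneg_left (Real.exp_le_exp.2 ?_) (Real.exp_pos _).le
    nlinarith [Real.one_le_cosh t]
  have h2 : IntegrableOn (fun t => Real.exp (-t) * Real.exp (-x * Real.cosh t)) (Set.Ioi 0) := by
    refine h1.mono' (by fun_prop) (Eventually.of_forall fun t => ?_)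
    rw [Real.norm_of_nonneg (by positivity)]
    exact hle t
  refine ⟨h2, (integral_mono h2 h1 hle).trans ?_⟩
  rw [integral_mul_const, integral_exp_neg_Ioi_zero, one_mul]

theorem integrableOn_cosh_mul_exp {x : ℝ} (hx : 0 < x) :
    IntegrableOn (fun t => Real.cosh t * Real.exp (-x * Real.cosh t)) (Set.Ioi 0) := by
  refine ((integrableOn_sinh_mul_exp_cosh hx).1.add
    (integrableOn_exp_neg_mul_exp_cosh hx.le).1).congr (Eventually.of_forall fun t => ?_)
  simp only [Pi.add_apply]
  rw [← add_mul, ← Real.cosh_sub_sinh t]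
  ring

/-- Split cosh t = sinh t + e^{-t}. The first part is an exact derivative and integrates to
e^{-x}/x; the second is at most e^{-x}. -/
theorem macdonaldK1_le {x : ℝ} (hx : 0 < x) : macdonaldK1 x ≤ (x⁻¹ + 1) * Real.exp (-x) := by
  have h1 := integrableOn_sinh_mul_exp_cosh hx
  have h2 := integrableOn_exp_neg_mul_exp_cosh hx.le
  have : macdonaldK1 x = (∫ t in Set.Ioi (0 : ℝ), Real.sinh t * Real.exp (-x * Real.cosh t))
      + ∫ t in Set.Ioi (0 : ℝ), Real.exp (-t) * Real.exp (-x * Real.cosh t) := by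
    rw [← integral_add h1.1 h2.1, macdonaldK1]
    congr 1
    funext t
    rw [← add_mul, ← Real.cosh_sub_sinh t]
    ring
  rw [this, h1.2]
  linarith [h2.2]

theorem integrableOn_exp_cosh {x : ℝ} (hx : 0 < x) :
    IntegrableOn (fun t => Real.exp (-x * Real.cosh t)) (Set.Ioi 0) := by
  refine (integrableOn_cosh_mul_exp hx).mono' (by fun_prop) (Eventually.of_forall fun t => ?_)
  rw [Real.norm_of_nonneg (by positivity)]
  exact le_mul_of_one_le_left (Real.exp_pos _).le (Real.one_le_cosh t)

theorem macdonaldK1_pos {x : ℝ} (hx : 0 < x) : 0 < macdonaldK1 x := by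
  rw [macdonaldK1, setIntegral_pos_iff_support_of_nonneg_ae
    (Eventually.of_forall fun t => mul_nonneg (Real.cosh_pos t).le (Real.exp_pos _).le)
    (integrableOn_cosh_mul_exp hx)]
  have : (Function.support fun t => Real.cosh t * Real.exp (-x * Real.cosh t)) = Set.univ := by
    ext t
    simp [(Real.cosh_pos t).ne']
  rw [this]
  simp

theorem macdonaldK0_nonneg (x : ℝ) : 0 ≤ macdonaldK0 x :=
  integral_nonneg fun _ => (Real.exp_pos _).le

theorem macdonaldK1_anti {x y : ℝ} (hx : 0 < x) (hxy : x ≤ y) : macdonaldK1 y ≤ macdonaldK1 x := by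
  refine integral_mono (integrableOn_cosh_mul_exp (hx.trans_le hxy)) (integrableOn_cosh_mul_exp hx)
    fun t => ?_
  refine mul_le_mul_of_nonneg_left (Real.exp_le_exp.2 ?_) (Real.cosh_pos t).le
  nlinarith [Real.cosh_pos t]

theorem macdonaldK0_anti {x y : ℝ} (hx : 0 < x) (hxy : x ≤ y) : macdonaldK0 y ≤ macdonaldK0 x := by
  refine integral_mono (integrableOn_exp_cosh (hx.trans_le hxy)) (integrableOn_exp_cosh hx)
    fun t => Real.exp_le_exp.2 ?_
  nlinarith [Real.cosh_pos t]

theorem hasDerivAt_macdonaldK0 {x : ℝ} (hx : 0 < x) :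
    HasDerivAt macdonaldK0 (-macdonaldK1 x) x := by
  have key := hasDerivAt_integral_of_dominated_loc_of_deriv_le
    (μ := volume.restrict (Set.Ioi (0 : ℝ))) (x₀ := x) (s := Set.Ioi (x / 2))
    (F := fun x t => Real.exp (-x * Real.cosh t))
    (F' := fun x t => -(Real.cosh t * Real.exp (-x * Real.cosh t)))
    -- On the half-line beyond x/2 the derivative is dominated by its modulus at x/2.
    (bound := fun t => Real.cosh t * Real.exp (-(x / 2) * Real.cosh t))
    (Ioi_mem_nhds (by linarith)) (Eventually.of_forall fun y => by fun_prop)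
    (integrableOn_exp_cosh hx) (by fun_prop)
    (Eventually.of_forall fun t y hy => by
      rw [norm_neg, Real.norm_of_nonneg (mul_nonneg (Real.cosh_pos t).le (Real.exp_pos _).le)]
      refine mul_le_mul_of_nonneg_left (Real.exp_le_exp.2 ?_) (Real.cosh_pos t).le
      have : x / 2 < y := hy
      nlinarith [Real.cosh_pos t])
    (integrableOn_cosh_mul_exp (by linarith))
    (Eventually.of_forall fun t y _ => by
      have := (((hasDerivAt_id y).neg).mul_const (Real.cosh t)).exp
      refine this.congr_deriv ?_
      simp
      ring)
  have h2 := key.2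
  rw [integral_neg] at h2
  exact h2

theorem measurable_macdonaldK0 : Measurable macdonaldK0 := by
  have : StronglyMeasurable fun p : ℝ × ℝ => Real.exp (-p.1 * Real.cosh p.2) :=
    (by fun_prop : Continuous fun p : ℝ × ℝ => Real.exp (-p.1 * Real.cosh p.2)).stronglyMeasurable
  exact this.integral_prod_right.measurable

theorem macdonaldK0_sub_le {x y : ℝ} (hx : 0 < x) (hxy : x ≤ y) :
    macdonaldK0 x - macdonaldK0 y ≤ (y - x) * macdonaldK1 x := by
  have := (convex_Icc x y).norm_image_sub_le_of_norm_hasDerivWithin_le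
    (f := macdonaldK0) (f' := fun z => -macdonaldK1 z) (C := macdonaldK1 x) (x := y) (y := x)
    (fun z hz => (hasDerivAt_macdonaldK0 (hx.trans_le hz.1)).hasDerivWithinAt)
    (fun z hz => by
      rw [norm_neg, Real.norm_of_nonneg (macdonaldK1_pos (hx.trans_le hz.1)).le]
      exact macdonaldK1_anti hx hz.1) (Set.right_mem_Icc.2 hxy) (Set.left_mem_Icc.2 hxy)
  rw [Real.norm_eq_abs, Real.norm_eq_abs, abs_sub_comm x y, abs_of_nonneg (sub_nonneg.2 hxy)] at this
  exact (le_abs_self _).trans (this.trans_eq (mul_comm _ _))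

/-- Half of the exponential pays for the linear factor. The case of large y uses e^{y/2} ≥ (1 +
y/4)² ≥ y - 1. -/
theorem abs_one_sub_mul_exp_le {y : ℝ} (hy : 0 ≤ y) : |1 - y| * Real.exp (-y) ≤ Real.exp (-(y / 2)) := by
  have h1 : |1 - y| ≤ Real.exp (y / 2) := by
    have e1 := Real.add_one_le_exp (y / 4)
    have e2 : Real.exp (y / 2) = Real.exp (y / 4) ^ 2 := by
      rw [← Real.exp_nat_mul]; congr 1; push_cast; ring
    have e3 := Real.add_one_le_exp (y / 2)
    rw [abs_le]
    constructor
    · rw [e2]; nlinarith [sq_nonneg (1 - y / 4)]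
    · linarith
  calc |1 - y| * Real.exp (-y) ≤ Real.exp (y / 2) * Real.exp (-y) :=
        mul_le_mul_of_nonneg_right h1 (Real.exp_pos _).le
    _ = Real.exp (-(y / 2)) := by rw [← Real.exp_add]; congr 1; ring

/-- The mean value inequality is applied twice, in κ and in the distance, to the mixed second
derivative of exp(-κ t c). -/
theorem abs_exp_mixed_sub_le {c κ₀ κ κ' r L : ℝ} (hc : 0 < c) (hκ₀ : 0 < κ₀) (hκ : κ₀ ≤ κ)
    (hκ' : κ₀ ≤ κ') (hr : 0 < r) (hrL : r ≤ L) :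
    |(Real.exp (-(κ * r) * c) - Real.exp (-(κ * L) * c))
      - (Real.exp (-(κ' * r) * c) - Real.exp (-(κ' * L) * c))|
      ≤ |κ - κ'| * (L - r) * (c * Real.exp (-(κ₀ * r / 2) * c)) := by
  have hinner : ∀ k, κ₀ ≤ k → ‖L * c * Real.exp (-(k * L) * c) - r * c * Real.exp (-(k * r) * c)‖
      ≤ (c * Real.exp (-(κ₀ * r / 2) * c)) * ‖L - r‖ := by
    intro k hk
    have hk0 : 0 < k := hκ₀.trans_le hk
    refine (convex_Icc r L).norm_image_sub_le_of_norm_hasDerivWithin_le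
      (f := fun t => t * c * Real.exp (-(k * t) * c))
      (f' := fun t => c * ((1 - k * t * c) * Real.exp (-(k * t * c)))) (x := r) (y := L)
      (fun t _ => ?_) (fun t ht => ?_) (Set.left_mem_Icc.2 hrL) (Set.right_mem_Icc.2 hrL)
    · refine HasDerivAt.hasDerivWithinAt ?_
      have h1 := ((hasDerivAt_id t).mul_const c).mul
        ((((hasDerivAt_id t).const_mul k).neg).mul_const c).exp
      refine h1.congr_deriv ?_
      simp only [id, Pi.neg_apply]
      rw [show -(k * t * c) = -(k * t) * c by ring]
      ring
    · have ht0 : 0 < t := hr.trans_le ht.1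
      rw [norm_mul, norm_mul, Real.norm_of_nonneg hc.le, Real.norm_eq_abs (1 - _),
        Real.norm_of_nonneg (Real.exp_pos _).le]
      refine mul_le_mul_of_nonneg_left ((abs_one_sub_mul_exp_le (by positivity)).trans ?_) hc.le
      refine Real.exp_le_exp.2 ?_
      have : κ₀ * r ≤ k * t := mul_le_mul hk ht.1 hr.le hk0.le
      nlinarith
  have := (convex_Ici κ₀).norm_image_sub_le_of_norm_hasDerivWithin_le
    (f := fun k => Real.exp (-(k * r) * c) - Real.exp (-(k * L) * c))
    (f' := fun k => L * c * Real.exp (-(k * L) * c) - r * c * Real.exp (-(k * r) * c))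
    (x := κ') (y := κ) (C := (c * Real.exp (-(κ₀ * r / 2) * c)) * ‖L - r‖)
    (fun k _ => by
      refine HasDerivAt.hasDerivWithinAt ?_
      have h1 := ((((hasDerivAt_id k).mul_const r).neg).mul_const c).exp
      have h2 := ((((hasDerivAt_id k).mul_const L).neg).mul_const c).exp
      refine (h1.sub h2).congr_deriv ?_
      simp only [id, Pi.neg_apply]
      ring) (fun k hk => hinner k hk) hκ' hκ
  rw [Real.norm_eq_abs, Real.norm_eq_abs, Real.norm_eq_abs, abs_of_nonneg (sub_nonneg.2 hrL)] at this
  refine this.trans_eq ?_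
  ring

/-- Obtained by integrating `abs_exp_mixed_sub_le` with c = cosh t. The product of two small factors
makes the perturbation kernel Lipschitz in κ without losing its factor β². -/
theorem abs_macdonaldK0_mixed_sub_le {κ₀ κ κ' r L : ℝ} (hκ₀ : 0 < κ₀) (hκ : κ₀ ≤ κ)
    (hκ' : κ₀ ≤ κ') (hr : 0 < r) (hrL : r ≤ L) :
    |(macdonaldK0 (κ * r) - macdonaldK0 (κ * L)) - (macdonaldK0 (κ' * r) - macdonaldK0 (κ' * L))|
      ≤ |κ - κ'| * (L - r) * macdonaldK1 (κ₀ * r / 2) := by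
  have hL : 0 < L := hr.trans_le hrL
  have k1 : 0 < κ := hκ₀.trans_le hκ
  have k2 : 0 < κ' := hκ₀.trans_le hκ'
  have i1 := integrableOn_exp_cosh (mul_pos k1 hr)
  have i2 := integrableOn_exp_cosh (mul_pos k1 hL)
  have i3 := integrableOn_exp_cosh (mul_pos k2 hr)
  have i4 := integrableOn_exp_cosh (mul_pos k2 hL)
  simp only [macdonaldK0, macdonaldK1]
  rw [← integral_sub i1 i2, ← integral_sub i3 i4, ← integral_const_mul]
  rw [← integral_sub (by exact i1.sub i2) (by exact i3.sub i4)]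
  refine (Real.norm_eq_abs _).symm.trans_le (norm_integral_le_of_norm_le ?_ ?_)
  · exact (integrableOn_cosh_mul_exp (by positivity)).const_mul _
  · exact Eventually.of_forall fun t => abs_exp_mixed_sub_le (Real.cosh_pos t) hκ₀ hκ hκ' hr hrL

theorem integrable_comp_abs {f : ℝ → ℝ} (hf : IntegrableOn f (Set.Ioi 0)) :
    Integrable fun x => f |x| := by
  have h1 : IntegrableOn (fun x => f |x|) (Set.Ioi 0) :=
    hf.congr_fun (fun x hx => by rw [abs_of_pos hx]) measurableSet_Ioi
  have h2 : IntegrableOn (fun x => f |x|) (Set.Iic 0) := by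
    rw [← Measure.map_neg_eq_self (volume : Measure ℝ)]
    let m : MeasurableEmbedding fun x : ℝ => -x := (Homeomorph.neg ℝ).measurableEmbedding
    rw [m.integrableOn_map_iff]
    simp_rw [Function.comp_def, abs_neg, Set.neg_preimage, Set.neg_Iic, neg_zero]
    exact Iff.mpr integrableOn_Ici_iff_integrableOn_Ioi h1
  rw [← integrableOn_univ, ← Set.Iic_union_Ioi (a := (0 : ℝ))]
  exact h2.union h1

/-- `K₀(κ |·|)` is integrable on the line. -/
theorem integrable_macdonaldK0_abs {κ : ℝ} (hκ : 0 < κ) :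
    Integrable fun x : ℝ => macdonaldK0 (κ * |x|) := by
  refine integrable_comp_abs (f := fun x => macdonaldK0 (κ * x)) ?_
  have hm : AEStronglyMeasurable (fun p : ℝ × ℝ => Real.exp (-(κ * p.1) * Real.cosh p.2))
      ((volume.restrict (Set.Ioi (0 : ℝ))).prod (volume.restrict (Set.Ioi (0 : ℝ)))) := by
    fun_prop
  -- By Tonelli: integrating over the distance first leaves 1/(κ cosh t), which is at most
  -- 2e^{-t}/κ.
  have hint : Integrable (fun p : ℝ × ℝ => Real.exp (-(κ * p.1) * Real.cosh p.2))
      ((volume.restrict (Set.Ioi (0 : ℝ))).prod (volume.restrict (Set.Ioi (0 : ℝ)))) := by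
    rw [integrable_prod_iff' hm]
    have e : ∀ t : ℝ, (fun x : ℝ => Real.exp (-(κ * x) * Real.cosh t))
        = fun x => Real.exp (-(κ * Real.cosh t) * x) := fun t => by
      funext x; congr 1; ring
    constructor
    · refine Eventually.of_forall fun t => ?_
      simp only [e]
      exact exp_neg_integrableOn_Ioi 0 (mul_pos hκ (Real.cosh_pos t))
    · have : ∀ t : ℝ, ∫ x in Set.Ioi (0 : ℝ), ‖Real.exp (-(κ * x) * Real.cosh t)‖
          = (κ * Real.cosh t)⁻¹ := by
        intro t
        simp only [Real.norm_eq_abs, Real.abs_exp]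
        rw [e, integral_exp_mul_Ioi (by nlinarith [mul_pos hκ (Real.cosh_pos t)])]
        rw [mul_zero, Real.exp_zero, div_neg, neg_div, neg_neg, one_div]
      simp only [this]
      have h2 : IntegrableOn (fun t : ℝ => (2 * κ⁻¹) * Real.exp (-t)) (Set.Ioi 0) :=
        (integrableOn_exp_neg_Ioi 0).const_mul _
      have hcm : Continuous fun t => (κ * Real.cosh t)⁻¹ :=
        (continuous_const.mul Real.continuous_cosh).inv₀
          fun t => (mul_pos hκ (Real.cosh_pos t)).ne'
      refine h2.mono' hcm.aestronglyMeasurable (Eventually.of_forall fun t => ?_)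
      rw [Real.norm_of_nonneg (inv_nonneg.2 (mul_pos hκ (Real.cosh_pos t)).le), mul_inv,
        mul_comm 2, mul_assoc]
      refine mul_le_mul_of_nonneg_left ?_ (inv_nonneg.2 hκ.le)
      rw [Real.cosh_eq, Real.exp_neg, inv_le_comm₀ (by positivity) (by positivity)]
      rw [mul_inv, inv_inv]
      linarith [inv_pos.2 (Real.exp_pos t)]
  exact hint.integral_prod_left

end LeakyWire
end

noncomputable section

namespace LeakyWire

/-! ### The Green function as a superposition of heat kernels -/

/-- The Green function of `-Δ + κ²` in the plane, as a function of the distance. -/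
def green (κ r : ℝ) : ℝ := (2 * Real.pi)⁻¹ * macdonaldK0 (κ * r)

/-- Substitute t = r e^τ/(2κ). Then κ²t + r²/(4t) = κ r cosh τ and dt/t = dτ, and the even integrand
over the whole line counts the integral defining K₀ twice. -/
theorem heat_substitution {κ r : ℝ} (hκ : 0 < κ) (hr : 0 < r) :
    IntegrableOn (fun t => Real.exp (-κ ^ 2 * t) * ((4 * Real.pi * t)⁻¹
      * Real.exp (-r ^ 2 / (4 * t)))) (Set.Ioi 0) ∧
    ∫ t in Set.Ioi (0 : ℝ), Real.exp (-κ ^ 2 * t) * ((4 * Real.pi * t)⁻¹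
      * Real.exp (-r ^ 2 / (4 * t))) = green κ r := by
  set g : ℝ → ℝ := fun t => Real.exp (-κ ^ 2 * t) * ((4 * Real.pi * t)⁻¹
      * Real.exp (-r ^ 2 / (4 * t))) with hg
  set f : ℝ → ℝ := fun τ => r / (2 * κ) * Real.exp τ with hf
  have hq : 0 < r / (2 * κ) := by positivity
  have himg : f '' Set.univ = Set.Ioi 0 := by
    ext t
    simp only [Set.image_univ, Set.mem_range, Set.mem_Ioi, hf]
    constructor
    · rintro ⟨τ, rfl⟩
      positivity
    · intro ht
      refine ⟨Real.log (t / (r / (2 * κ))), ?_⟩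
      rw [Real.exp_log (by positivity)]
      field_simp
  have hd : ∀ τ ∈ Set.univ, HasDerivWithinAt f (f τ) Set.univ τ := fun τ _ =>
    ((Real.hasDerivAt_exp τ).const_mul _).hasDerivWithinAt
  have hinj : Set.InjOn f Set.univ := fun a _ b _ hab => by
    simpa [hf, hκ.ne', hr.ne'] using hab
  have hfg : (fun τ => |f τ| • g (f τ))
      = fun τ => (4 * Real.pi)⁻¹ * Real.exp (-(κ * r) * Real.cosh |τ|) := by
    funext τ
    have hfp : 0 < f τ := by positivity
    rw [abs_of_pos hfp, Real.cosh_abs, smul_eq_mul, hg]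
    simp only
    have hmul : ∀ x a b : ℝ, x ≠ 0 →
        x * (a * ((4 * Real.pi * x)⁻¹ * b)) = (4 * Real.pi)⁻¹ * (a * b) := by
      intro x a b hx
      have := Real.pi_pos
      field_simp
    rw [hmul _ _ _ hfp.ne', ← Real.exp_add]
    congr 2
    rw [Real.cosh_eq]
    simp only [hf]
    have := Real.exp_pos τ
    rw [Real.exp_neg]
    field_simp
    ring
  have hpos : 0 < κ * r := by positivity
  have hint : Integrable fun τ : ℝ => Real.exp (-(κ * r) * Real.cosh |τ|) :=
    integrable_comp_abs (f := fun τ => Real.exp (-(κ * r) * Real.cosh τ))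
      (integrableOn_exp_cosh hpos)
  constructor
  · rw [← himg, integrableOn_image_iff_integrableOn_abs_deriv_smul MeasurableSet.univ hd hinj, hfg,
      integrableOn_univ]
    exact hint.const_mul _
  · rw [← himg, integral_image_eq_integral_abs_deriv_smul MeasurableSet.univ hd hinj, hfg,
      setIntegral_univ, integral_const_mul,
      integral_comp_abs (f := fun τ => Real.exp (-(κ * r) * Real.cosh τ)), green, macdonaldK0]
    rw [← mul_assoc]
    congr 1
    have := Real.pi_pos
    field_simp
    norm_num

theorem green_nonneg (κ r : ℝ) : 0 ≤ green κ r :=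
  mul_nonneg (inv_nonneg.2 (by positivity)) (macdonaldK0_nonneg _)

end LeakyWire
end

noncomputable section

namespace LeakyWire

set_option linter.unusedSectionVars false

/-! ### Gaussian averages of Fourier transforms of measures on curves -/

section CurveFourier

variable {E : Type*} [NormedAddCommGroup E] [InnerProductSpace ℝ E] [FiniteDimensional ℝ E]
  [MeasurableSpace E] [BorelSpace E]

/-- The Fourier transform of the density `u` on the curve `γ`. -/
def curveFourier (γ : ℝ → E) (u : ℝ → ℂ) (ξ : E) : ℂ :=
  ∫ s, Complex.exp (-(2 * Real.pi * inner ℝ ξ (γ s) : ℝ) * Complex.I) * u s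

/-- The heat kernel at time `t`, as a function of the distance. -/
def heatKernel (d : ℕ) (t r : ℝ) : ℝ :=
  (4 * Real.pi * t)⁻¹ ^ ((d : ℝ) / 2) * Real.exp (-r ^ 2 / (4 * t))

theorem measurable_heatKernel (d : ℕ) :
    Measurable fun p : ℝ × ℝ => heatKernel d p.1 p.2 := by
  unfold heatKernel
  fun_prop

theorem heatKernel_nonneg {d : ℕ} {t : ℝ} (ht : 0 < t) (r : ℝ) : 0 ≤ heatKernel d t r := by
  unfold heatKernel
  have := Real.pi_pos
  positivity

theorem norm_exp_real_mul_I_mul (x : ℝ) (z : ℂ) : ‖Complex.exp (-(x : ℝ) * Complex.I) * z‖ = ‖z‖ := by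
  rw [norm_mul, ← Complex.ofReal_neg, Complex.norm_exp_ofReal_mul_I, one_mul]

theorem integral_exp_mul_char (t : ℝ) (ht : 0 < t) (x : E) :
    ∫ ξ : E, (Real.exp (-(4 * Real.pi ^ 2 * t) * ‖ξ‖ ^ 2) : ℂ)
      * Complex.exp ((2 * Real.pi * inner ℝ x ξ : ℝ) * Complex.I)
      = (heatKernel (Module.finrank ℝ E) t ‖x‖ : ℝ) := by
  have hpi := Real.pi_pos
  have hb : 0 < ((4 * Real.pi ^ 2 * t : ℝ) : ℂ).re := by
    rw [Complex.ofReal_re]; positivity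
  have := GaussianFourier.integral_cexp_neg_mul_sq_norm_add hb (2 * Real.pi * Complex.I) x
  calc _ = ∫ v : E, Complex.exp (-((4 * Real.pi ^ 2 * t : ℝ) : ℂ) * ‖v‖ ^ 2
        + 2 * Real.pi * Complex.I * inner ℝ x v) := by
        refine integral_congr_ae (Eventually.of_forall fun v => ?_)
        simp only
        rw [Complex.ofReal_exp, ← Complex.exp_add]
        congr 1
        push_cast
        ring
    _ = _ := by
        rw [this, heatKernel, Complex.ofReal_mul (_ ^ _), Complex.ofReal_exp,
          Complex.ofReal_cpow (by positivity)]
        congr 2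
        · push_cast
          field_simp
        · push_cast
          rfl
        · push_cast
          rw [show (2 * (Real.pi : ℂ) * Complex.I) ^ 2 = -(4 * Real.pi ^ 2) by
            rw [mul_pow, Complex.I_sq]; ring]
          have h1 : (Real.pi : ℂ) ≠ 0 := by exact_mod_cast hpi.ne'
          have h2 : (t : ℂ) ≠ 0 := by exact_mod_cast ht.ne'
          field_simp

theorem integrable_exp_neg_mul_norm_sq {b : ℝ} (hb : 0 < b) :
    Integrable fun ξ : E => Real.exp (-b * ‖ξ‖ ^ 2) := by
  have := (GaussianFourier.integrable_cexp_neg_mul_sq_norm_add (V := E) (b := b)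
    (by simpa using hb) 0 0).norm
  refine this.congr (Eventually.of_forall fun v => ?_)
  simp only [Complex.norm_exp]
  congr 1
  simp [← Complex.ofReal_pow]

variable {γ : ℝ → E} {u v : ℝ → ℂ}

theorem measurable_char (hγ : Measurable γ) :
    Measurable fun p : E × ℝ =>
      Complex.exp (-(2 * Real.pi * inner ℝ p.1 (γ p.2) : ℝ) * Complex.I) := by
  have h1 : Measurable fun p : E × ℝ => inner ℝ p.1 (γ p.2) :=
    measurable_fst.inner (hγ.comp measurable_snd)
  fun_prop

theorem integrable_char_mul (hγ : Measurable γ) (hu : Integrable u) (ξ : E) :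
    Integrable fun s => Complex.exp (-(2 * Real.pi * inner ℝ ξ (γ s) : ℝ) * Complex.I) * u s := by
  refine hu.norm.mono' (((measurable_char hγ).comp measurable_prodMk_left).aestronglyMeasurable.mul
    hu.aestronglyMeasurable) (Eventually.of_forall fun s => ?_)
  rw [norm_exp_real_mul_I_mul]

theorem aestronglyMeasurable_curveFourier (hγ : Measurable γ) (hu : Integrable u) :
    AEStronglyMeasurable (curveFourier γ u) := by
  have : AEStronglyMeasurable (fun p : E × ℝ =>
      Complex.exp (-(2 * Real.pi * inner ℝ p.1 (γ p.2) : ℝ) * Complex.I) * u p.2)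
      ((volume : Measure E).prod (volume : Measure ℝ)) :=
    (measurable_char hγ).aestronglyMeasurable.mul
      hu.aestronglyMeasurable.comp_snd
  exact this.integral_prod_right'

theorem norm_curveFourier_le (γ : ℝ → E) (u : ℝ → ℂ) (ξ : E) :
    ‖curveFourier γ u ξ‖ ≤ ∫ s, ‖u s‖ := by
  refine (norm_integral_le_integral_norm _).trans_eq ?_
  simp only [norm_exp_real_mul_I_mul]

theorem conj_curveFourier_mul (γ : ℝ → E) (u v : ℝ → ℂ) (ξ : E) :
    starRingEnd ℂ (curveFourier γ v ξ) * curveFourier γ u ξ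
      = ∫ p : ℝ × ℝ, Complex.exp ((2 * Real.pi * inner ℝ (γ p.1 - γ p.2) ξ : ℝ) * Complex.I)
        * (starRingEnd ℂ (v p.1) * u p.2) := by
  rw [curveFourier, ← integral_conj, curveFourier, ← integral_prod_mul, ← Measure.volume_eq_prod]
  refine integral_congr_ae (Eventually.of_forall fun p => ?_)
  simp only [map_mul, ← Complex.exp_conj, map_neg, Complex.conj_ofReal, Complex.conj_I]
  rw [mul_mul_mul_comm, ← Complex.exp_add]
  congr 2
  rw [inner_sub_left, real_inner_comm ξ, real_inner_comm ξ]
  push_cast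
  ring

/-- Plain Fubini, available because the multiplier g is integrable. It covers each Gaussian and
later the one-dimensional resolvent, but not the symbols of the Green function. -/
theorem integral_mul_conj_curveFourier_mul (hγ : Measurable γ) (hu : Integrable u)
    (hv : Integrable v) {g : E → ℂ} (hg : Integrable g) :
    ∫ ξ : E, g ξ * (starRingEnd ℂ (curveFourier γ v ξ) * curveFourier γ u ξ)
      = ∫ p : ℝ × ℝ, (∫ ξ : E, g ξ *
          Complex.exp ((2 * Real.pi * inner ℝ (γ p.1 - γ p.2) ξ : ℝ) * Complex.I))
        * (starRingEnd ℂ (v p.1) * u p.2) := by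
  have hvu : Integrable fun p : ℝ × ℝ => starRingEnd ℂ (v p.1) * u p.2 :=
    Integrable.mul_prod (Complex.conjLIE.toContinuousLinearEquiv.toContinuousLinearMap.integrable_comp hv) hu
  have hm : Measurable fun q : E × (ℝ × ℝ) =>
      Complex.exp ((2 * Real.pi * inner ℝ (γ q.2.1 - γ q.2.2) q.1 : ℝ) * Complex.I) := by
    have h1 : Measurable fun q : E × (ℝ × ℝ) => inner ℝ (γ q.2.1 - γ q.2.2) q.1 :=
      ((hγ.comp measurable_snd.fst).sub (hγ.comp measurable_snd.snd)).inner measurable_fst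
    fun_prop
  have hint : Integrable (Function.uncurry fun (ξ : E) (p : ℝ × ℝ) => g ξ *
      (Complex.exp ((2 * Real.pi * inner ℝ (γ p.1 - γ p.2) ξ : ℝ) * Complex.I)
        * (starRingEnd ℂ (v p.1) * u p.2))) ((volume : Measure E).prod volume) := by
    have h0 := Integrable.mul_prod hg hvu
    refine h0.norm.mono' ?_ (Eventually.of_forall fun q => ?_)
    · exact (hg.aestronglyMeasurable.comp_fst).mul (hm.aestronglyMeasurable.mul
        (hvu.aestronglyMeasurable.comp_snd))
    · simp only [Function.uncurry]
      rw [norm_mul, norm_mul (Complex.exp _), Complex.norm_exp_ofReal_mul_I, one_mul, ← norm_mul]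
  calc _ = ∫ ξ : E, ∫ p : ℝ × ℝ, g ξ *
      (Complex.exp ((2 * Real.pi * inner ℝ (γ p.1 - γ p.2) ξ : ℝ) * Complex.I)
        * (starRingEnd ℂ (v p.1) * u p.2)) := by
        refine integral_congr_ae (Eventually.of_forall fun ξ => ?_)
        simp only
        rw [conj_curveFourier_mul, integral_const_mul]
    _ = _ := by
        rw [integral_integral_swap hint]
        refine integral_congr_ae (Eventually.of_forall fun p => ?_)
        simp only [← mul_assoc]
        rw [integral_mul_const, integral_mul_const]

theorem integral_gaussian_conj_curveFourier_mul (hγ : Measurable γ) (hu : Integrable u)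
    (hv : Integrable v) {t : ℝ} (ht : 0 < t) :
    ∫ ξ : E, (Real.exp (-(4 * Real.pi ^ 2 * t) * ‖ξ‖ ^ 2) : ℂ)
        * (starRingEnd ℂ (curveFourier γ v ξ) * curveFourier γ u ξ)
      = ∫ p : ℝ × ℝ, (heatKernel (Module.finrank ℝ E) t ‖γ p.1 - γ p.2‖ : ℂ)
        * (starRingEnd ℂ (v p.1) * u p.2) := by
  have hpi := Real.pi_pos
  have hg : Integrable fun ξ : E => (Real.exp (-(4 * Real.pi ^ 2 * t) * ‖ξ‖ ^ 2) : ℂ) :=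
    (integrable_exp_neg_mul_norm_sq (by positivity)).ofReal
  rw [integral_mul_conj_curveFourier_mul hγ hu hv hg]
  simp only [integral_exp_mul_char t ht]

/-! ### Superpositions of Gaussians and of heat kernels. -/

/-- A superposition, with weight `ρ`, of Gaussians on the Fourier side with total symbol `m`,
corresponding to the superposition `k` of heat kernels. -/
structure IsHeatSuperposition (E : Type*) [NormedAddCommGroup E] [InnerProductSpace ℝ E]
    (ρ : ℝ → ℝ) (m : E → ℝ) (k : ℝ → ℝ) : Prop where
  measurable : Measurable ρ
  nonneg : ∀ t, 0 < t → 0 ≤ ρ t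
  symbol : ∀ ξ : E, IntegrableOn (fun t => ρ t * Real.exp (-(4 * Real.pi ^ 2 * t) * ‖ξ‖ ^ 2))
      (Set.Ioi 0) ∧
    ∫ t in Set.Ioi (0 : ℝ), ρ t * Real.exp (-(4 * Real.pi ^ 2 * t) * ‖ξ‖ ^ 2) = m ξ
  kernel : ∀ r, 0 < r → IntegrableOn (fun t => ρ t * heatKernel (Module.finrank ℝ E) t r)
      (Set.Ioi 0) ∧
    ∫ t in Set.Ioi (0 : ℝ), ρ t * heatKernel (Module.finrank ℝ E) t r = k r

variable {ρ : ℝ → ℝ} {m : E → ℝ} {k : ℝ → ℝ}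

theorem ae_ne_prod : ∀ᵐ p : ℝ × ℝ, p.1 ≠ p.2 := by
  have : MeasurableSet {p : ℝ × ℝ | p.1 ≠ p.2} :=
    (measurableSet_eq_fun measurable_fst measurable_snd).compl
  rw [Measure.volume_eq_prod, Measure.ae_prod_iff_ae_ae this]
  exact Eventually.of_forall fun x => by
    filter_upwards [Measure.ae_ne volume x] with y hy using hy.symm

theorem IsHeatSuperposition.lintegral_symbol (h : IsHeatSuperposition E ρ m k) (ξ : E) :
    ∫⁻ t in Set.Ioi (0 : ℝ), ENNReal.ofReal (ρ t * Real.exp (-(4 * Real.pi ^ 2 * t) * ‖ξ‖ ^ 2))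
      = ENNReal.ofReal (m ξ) := by
  rw [← (h.symbol ξ).2, ofReal_integral_eq_lintegral_ofReal (h.symbol ξ).1]
  exact (ae_restrict_iff' measurableSet_Ioi).2 (Eventually.of_forall fun t ht =>
    mul_nonneg (h.nonneg t ht) (Real.exp_pos _).le)

theorem IsHeatSuperposition.lintegral_kernel (h : IsHeatSuperposition E ρ m k) {r : ℝ}
    (hr : 0 < r) :
    ∫⁻ t in Set.Ioi (0 : ℝ), ENNReal.ofReal (ρ t * heatKernel (Module.finrank ℝ E) t r)
      = ENNReal.ofReal (k r) := by
  rw [← (h.kernel r hr).2, ofReal_integral_eq_lintegral_ofReal (h.kernel r hr).1]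
  exact (ae_restrict_iff' measurableSet_Ioi).2 (Eventually.of_forall fun t ht =>
    mul_nonneg (h.nonneg t ht) (heatKernel_nonneg ht _))

theorem measurable_heat_curve (hρ : Measurable ρ) (hγ : Measurable γ) (d : ℕ) :
    Measurable fun q : ℝ × (ℝ × ℝ) => ρ q.1 * heatKernel d q.1 ‖γ q.2.1 - γ q.2.2‖ := by
  have h1 : Measurable fun q : ℝ × (ℝ × ℝ) => ‖γ q.2.1 - γ q.2.2‖ :=
    ((hγ.comp measurable_snd.fst).sub (hγ.comp measurable_snd.snd)).norm
  exact (hρ.comp measurable_fst).mul ((measurable_heatKernel d).comp (measurable_fst.prodMk h1))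

/-- Tonelli in the parameter t. The kernel formula is only available at positive distance, which is
why the curve must be injective and the null diagonal is discarded. -/
theorem IsHeatSuperposition.lintegral_heat_curve (h : IsHeatSuperposition E ρ m k)
    (hγ : Measurable γ) (hinj : ∀ s s', s ≠ s' → γ s ≠ γ s') (hu : Integrable u)
    (hv : Integrable v) :
    ∫⁻ t in Set.Ioi (0 : ℝ), ∫⁻ p : ℝ × ℝ, ENNReal.ofReal (ρ t *
        heatKernel (Module.finrank ℝ E) t ‖γ p.1 - γ p.2‖) * ‖starRingEnd ℂ (v p.1) * u p.2‖ₑ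
      = ∫⁻ p : ℝ × ℝ, ENNReal.ofReal (k ‖γ p.1 - γ p.2‖) * ‖starRingEnd ℂ (v p.1) * u p.2‖ₑ := by
  have hvu : Integrable fun p : ℝ × ℝ => starRingEnd ℂ (v p.1) * u p.2 :=
    Integrable.mul_prod (Complex.conjLIE.toContinuousLinearEquiv.toContinuousLinearMap.integrable_comp hv) hu
  rw [lintegral_lintegral_swap]
  · refine lintegral_congr_ae ?_
    filter_upwards [ae_ne_prod] with p hp
    rw [lintegral_mul_const'' _ (by
      exact ((measurable_heat_curve h.measurable hγ _).comp
        measurable_prodMk_right).ennreal_ofReal.aemeasurable),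
      h.lintegral_kernel (norm_pos_iff.2 (sub_ne_zero.2 (hinj _ _ hp)))]
  · exact (measurable_heat_curve h.measurable hγ _).ennreal_ofReal.aemeasurable.mul
      hvu.aestronglyMeasurable.comp_snd.enorm

theorem IsHeatSuperposition.aemeasurable_gauss (h : IsHeatSuperposition E ρ m k) :
    Measurable fun q : E × ℝ => ρ q.2 * Real.exp (-(4 * Real.pi ^ 2 * q.2) * ‖q.1‖ ^ 2) := by
  have := h.measurable
  fun_prop

/-- All Gaussians have nonnegative weight, so Tonelli applies on the Fourier side, and at each fixed
t the Gaussian identity bounds the integral by its counterpart on the curve. -/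
theorem IsHeatSuperposition.lintegral_symbol_lt_top (h : IsHeatSuperposition E ρ m k)
    (hγ : Measurable γ) (hinj : ∀ s s', s ≠ s' → γ s ≠ γ s') (hu : Integrable u)
    (hfin : ∫⁻ p : ℝ × ℝ, ENNReal.ofReal (k ‖γ p.1 - γ p.2‖)
      * ‖starRingEnd ℂ (u p.1) * u p.2‖ₑ < ⊤) :
    ∫⁻ ξ, ENNReal.ofReal (m ξ) * ‖curveFourier γ u ξ‖ₑ ^ 2 < ⊤ := by
  refine lt_of_le_of_lt ?_ hfin
  have hmeas := aestronglyMeasurable_curveFourier (E := E) hγ hu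
  have e1 : ∀ ξ, ENNReal.ofReal (m ξ) * ‖curveFourier γ u ξ‖ₑ ^ 2
      = ∫⁻ t in Set.Ioi (0 : ℝ), ENNReal.ofReal (ρ t *
        Real.exp (-(4 * Real.pi ^ 2 * t) * ‖ξ‖ ^ 2)) * ‖curveFourier γ u ξ‖ₑ ^ 2 := by
    intro ξ
    rw [lintegral_mul_const'' _ (by
      exact (h.aemeasurable_gauss.comp measurable_prodMk_left).ennreal_ofReal.aemeasurable),
      h.lintegral_symbol]
  simp only [e1]
  rw [lintegral_lintegral_swap, ← h.lintegral_heat_curve hγ hinj hu hu]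
  · refine setLIntegral_mono' measurableSet_Ioi fun t ht => ?_
    have ht0 : 0 < t := ht
    have hpi := Real.pi_pos
    have e2 : ∀ ξ : E, ENNReal.ofReal (ρ t * Real.exp (-(4 * Real.pi ^ 2 * t) * ‖ξ‖ ^ 2))
        * ‖curveFourier γ u ξ‖ₑ ^ 2 = ENNReal.ofReal (ρ t) *
          ENNReal.ofReal (Real.exp (-(4 * Real.pi ^ 2 * t) * ‖ξ‖ ^ 2)
            * ‖curveFourier γ u ξ‖ ^ 2) := by
      intro ξ
      rw [ENNReal.ofReal_mul (h.nonneg t ht), ENNReal.ofReal_mul (Real.exp_pos _).le, mul_assoc,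
        ← ofReal_norm, ENNReal.ofReal_pow (norm_nonneg _)]
    have e3 : ∀ p : ℝ × ℝ, ENNReal.ofReal (ρ t *
        heatKernel (Module.finrank ℝ E) t ‖γ p.1 - γ p.2‖) * ‖starRingEnd ℂ (u p.1) * u p.2‖ₑ
        = ENNReal.ofReal (ρ t) * ‖(heatKernel (Module.finrank ℝ E) t ‖γ p.1 - γ p.2‖ : ℂ)
          * (starRingEnd ℂ (u p.1) * u p.2)‖ₑ := by
      intro p
      rw [ENNReal.ofReal_mul (h.nonneg t ht), mul_assoc, enorm_mul (_ : ℂ) (_ * _),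
        ← ofReal_norm (Complex.ofReal _), Complex.norm_real, Real.norm_of_nonneg (heatKernel_nonneg ht0 _)]
    simp only [e2, e3]
    rw [lintegral_const_mul' _ _ ENNReal.ofReal_ne_top, lintegral_const_mul' _ _ ENNReal.ofReal_ne_top]
    gcongr
    have hint : Integrable fun ξ : E => Real.exp (-(4 * Real.pi ^ 2 * t) * ‖ξ‖ ^ 2)
        * ‖curveFourier γ u ξ‖ ^ 2 := by
      refine (integrable_exp_neg_mul_norm_sq (by positivity)).mul_bdd
        (c := (∫ s, ‖u s‖) ^ 2) (hmeas.norm.pow 2) (Eventually.of_forall fun ξ => ?_)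
      rw [norm_pow, norm_norm]
      exact pow_le_pow_left₀ (norm_nonneg _) (norm_curveFourier_le γ u ξ) 2
    rw [← ofReal_integral_eq_lintegral_ofReal hint (Eventually.of_forall fun ξ => by positivity)]
    refine le_trans (le_of_eq ?_) (enorm_integral_le_lintegral_enorm _)
    rw [← integral_gaussian_conj_curveFourier_mul hγ hu hu ht0]
    have e4 : ∀ ξ : E, (Real.exp (-(4 * Real.pi ^ 2 * t) * ‖ξ‖ ^ 2) : ℂ)
        * (starRingEnd ℂ (curveFourier γ u ξ) * curveFourier γ u ξ)
        = ((Real.exp (-(4 * Real.pi ^ 2 * t) * ‖ξ‖ ^ 2) * ‖curveFourier γ u ξ‖ ^ 2 : ℝ) : ℂ) := by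
      intro ξ
      rw [Complex.conj_mul', Complex.ofReal_mul]
      simp
    simp only [e4]
    rw [integral_complex_ofReal, ← ofReal_norm, Complex.norm_real,
      Real.norm_of_nonneg (integral_nonneg fun ξ => by positivity)]
  · exact h.aemeasurable_gauss.ennreal_ofReal.aemeasurable.mul (hmeas.comp_fst.enorm.pow_const 2)

/-- The symbols used below are not integrable, so the Fourier variable and the curve parameters
cannot be interchanged directly. The identity holds for each Gaussian and is integrated over t;
finite energies justify Fubini on both sides. -/
theorem IsHeatSuperposition.integral_symbol (h : IsHeatSuperposition E ρ m k)
    (hγ : Measurable γ) (hinj : ∀ s s', s ≠ s' → γ s ≠ γ s') (hu : Integrable u)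
    (hv : Integrable v)
    (huu : ∫⁻ p : ℝ × ℝ, ENNReal.ofReal (k ‖γ p.1 - γ p.2‖)
      * ‖starRingEnd ℂ (u p.1) * u p.2‖ₑ < ⊤)
    (hvv : ∫⁻ p : ℝ × ℝ, ENNReal.ofReal (k ‖γ p.1 - γ p.2‖)
      * ‖starRingEnd ℂ (v p.1) * v p.2‖ₑ < ⊤)
    (hvu : ∫⁻ p : ℝ × ℝ, ENNReal.ofReal (k ‖γ p.1 - γ p.2‖)
      * ‖starRingEnd ℂ (v p.1) * u p.2‖ₑ < ⊤) :
    ∫ ξ, (m ξ : ℂ) * (starRingEnd ℂ (curveFourier γ v ξ) * curveFourier γ u ξ)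
      = ∫ p : ℝ × ℝ, (k ‖γ p.1 - γ p.2‖ : ℂ) * (starRingEnd ℂ (v p.1) * u p.2) := by
  have hmu := aestronglyMeasurable_curveFourier (E := E) hγ hu
  have hmv := aestronglyMeasurable_curveFourier (E := E) hγ hv
  have hvui : Integrable fun p : ℝ × ℝ => starRingEnd ℂ (v p.1) * u p.2 :=
    Integrable.mul_prod (Complex.conjLIE.toContinuousLinearEquiv.toContinuousLinearMap.integrable_comp hv) hu
  have hmvu : AEStronglyMeasurable fun ξ =>
      starRingEnd ℂ (curveFourier γ v ξ) * curveFourier γ u ξ :=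
    (Complex.continuous_conj.comp_aestronglyMeasurable hmv).mul hmu
  -- the integrand on the Fourier side
  have hF : Integrable (Function.uncurry fun (ξ : E) (t : ℝ) =>
      ((ρ t * Real.exp (-(4 * Real.pi ^ 2 * t) * ‖ξ‖ ^ 2) : ℝ) : ℂ)
        * (starRingEnd ℂ (curveFourier γ v ξ) * curveFourier γ u ξ))
      ((volume : Measure E).prod (volume.restrict (Set.Ioi (0 : ℝ)))) := by
    have hmeas : AEStronglyMeasurable (Function.uncurry fun (ξ : E) (t : ℝ) =>
      ((ρ t * Real.exp (-(4 * Real.pi ^ 2 * t) * ‖ξ‖ ^ 2) : ℝ) : ℂ)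
        * (starRingEnd ℂ (curveFourier γ v ξ) * curveFourier γ u ξ))
      ((volume : Measure E).prod (volume.restrict (Set.Ioi (0 : ℝ)))) :=
      (Complex.measurable_ofReal.comp h.aemeasurable_gauss).aestronglyMeasurable.mul
        hmvu.comp_fst
    refine ⟨hmeas, ?_⟩
    rw [HasFiniteIntegral, lintegral_prod _ hmeas.enorm]
    -- The inequality xy ≤ x² + y² reduces the mixed term to the two diagonal energies.
    have hle : ∀ ξ : E, ∫⁻ t in Set.Ioi (0 : ℝ), ‖((ρ t *
        Real.exp (-(4 * Real.pi ^ 2 * t) * ‖ξ‖ ^ 2) : ℝ) : ℂ)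
        * (starRingEnd ℂ (curveFourier γ v ξ) * curveFourier γ u ξ)‖ₑ
        ≤ ENNReal.ofReal (m ξ) * ‖curveFourier γ v ξ‖ₑ ^ 2
          + ENNReal.ofReal (m ξ) * ‖curveFourier γ u ξ‖ₑ ^ 2 := by
      intro ξ
      simp only [enorm_mul]
      rw [lintegral_mul_const'' _ (by
        exact (Complex.measurable_ofReal.comp (h.aemeasurable_gauss.comp
          measurable_prodMk_left)).enorm.aemeasurable), ← mul_add]
      refine mul_le_mul' (le_of_eq ?_) ?_
      · rw [← h.lintegral_symbol ξ]
        refine setLIntegral_congr_fun measurableSet_Ioi fun t ht => ?_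
        rw [← ofReal_norm, Complex.norm_real,
          Real.norm_of_nonneg (mul_nonneg (h.nonneg t ht) (Real.exp_pos _).le)]
      · rw [← ofReal_norm, RCLike.norm_conj, ← ofReal_norm (curveFourier γ u ξ),
          ← ENNReal.ofReal_mul (norm_nonneg _), ← ofReal_norm (curveFourier γ v ξ),
          ← ENNReal.ofReal_pow (norm_nonneg _), ← ENNReal.ofReal_pow (norm_nonneg _),
          ← ENNReal.ofReal_add (by positivity) (by positivity)]
        refine ENNReal.ofReal_le_ofReal ?_
        nlinarith [sq_nonneg (‖curveFourier γ v ξ‖ - ‖curveFourier γ u ξ‖),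
          norm_nonneg (curveFourier γ v ξ), norm_nonneg (curveFourier γ u ξ)]
    refine lt_of_le_of_lt (lintegral_mono hle) ?_
    have hmm : Measurable m := by
      have : m = fun ξ => ∫ t in Set.Ioi (0 : ℝ),
          ρ t * Real.exp (-(4 * Real.pi ^ 2 * t) * ‖ξ‖ ^ 2) := funext fun ξ => (h.symbol ξ).2.symm
      rw [this]
      exact h.aemeasurable_gauss.stronglyMeasurable.integral_prod_right.measurable
    rw [lintegral_add_left' (by
      exact hmm.ennreal_ofReal.aemeasurable.mul (hmv.enorm.pow_const 2))]
    exact ENNReal.add_lt_top.2 ⟨h.lintegral_symbol_lt_top hγ hinj hv hvv,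
      h.lintegral_symbol_lt_top hγ hinj hu huu⟩
  -- the integrand on the curve
  have hG : Integrable (Function.uncurry fun (t : ℝ) (p : ℝ × ℝ) =>
      ((ρ t * heatKernel (Module.finrank ℝ E) t ‖γ p.1 - γ p.2‖ : ℝ) : ℂ)
        * (starRingEnd ℂ (v p.1) * u p.2))
      ((volume.restrict (Set.Ioi (0 : ℝ))).prod (volume : Measure (ℝ × ℝ))) := by
    have hmeas : AEStronglyMeasurable (Function.uncurry fun (t : ℝ) (p : ℝ × ℝ) =>
      ((ρ t * heatKernel (Module.finrank ℝ E) t ‖γ p.1 - γ p.2‖ : ℝ) : ℂ)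
        * (starRingEnd ℂ (v p.1) * u p.2))
      ((volume.restrict (Set.Ioi (0 : ℝ))).prod (volume : Measure (ℝ × ℝ))) :=
      (Complex.measurable_ofReal.comp
        (measurable_heat_curve h.measurable hγ _)).aestronglyMeasurable.mul
        hvui.aestronglyMeasurable.comp_snd
    refine ⟨hmeas, ?_⟩
    rw [HasFiniteIntegral, lintegral_prod _ hmeas.enorm]
    refine lt_of_le_of_lt (le_of_eq ?_) hvu
    rw [← h.lintegral_heat_curve hγ hinj hu hv]
    refine setLIntegral_congr_fun measurableSet_Ioi fun t ht => ?_
    refine lintegral_congr fun p => ?_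
    simp only [Function.uncurry]
    rw [enorm_mul, ← ofReal_norm (_ : ℂ), Complex.norm_real,
      Real.norm_of_nonneg (mul_nonneg (h.nonneg t ht) (heatKernel_nonneg ht _))]
  calc _ = ∫ ξ : E, ∫ t in Set.Ioi (0 : ℝ), ((ρ t *
        Real.exp (-(4 * Real.pi ^ 2 * t) * ‖ξ‖ ^ 2) : ℝ) : ℂ)
        * (starRingEnd ℂ (curveFourier γ v ξ) * curveFourier γ u ξ) := by
        refine integral_congr_ae (Eventually.of_forall fun ξ => ?_)
        simp only
        rw [integral_mul_const, integral_complex_ofReal, (h.symbol ξ).2]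
    _ = ∫ t in Set.Ioi (0 : ℝ), ∫ p : ℝ × ℝ,
        ((ρ t * heatKernel (Module.finrank ℝ E) t ‖γ p.1 - γ p.2‖ : ℝ) : ℂ)
        * (starRingEnd ℂ (v p.1) * u p.2) := by
        rw [integral_integral_swap hF]
        refine setIntegral_congr_fun measurableSet_Ioi fun t ht => ?_
        simp only [Complex.ofReal_mul (ρ t), mul_assoc (ρ t : ℂ)]
        rw [integral_const_mul, integral_const_mul,
          integral_gaussian_conj_curveFourier_mul hγ hu hv ht]
    _ = _ := by
        rw [integral_integral_swap hG]
        refine integral_congr_ae ?_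
        filter_upwards [ae_ne_prod] with p hp
        rw [integral_mul_const, integral_complex_ofReal,
          (h.kernel _ (norm_pos_iff.2 (sub_ne_zero.2 (hinj _ _ hp)))).2]

end CurveFourier

end LeakyWire
end

noncomputable section

namespace LeakyWire

/-! ### The Green function in the plane and its restriction to a line -/

theorem exp_neg_mul_mul_exp (κ t x : ℝ) :
    Real.exp (-κ ^ 2 * t) * Real.exp (-(4 * Real.pi ^ 2 * t) * x ^ 2)
      = Real.exp (-(4 * Real.pi ^ 2 * x ^ 2 + κ ^ 2) * t) := by
  rw [← Real.exp_add]
  congr 1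
  ring

theorem symbol_pos {κ : ℝ} (hκ : 0 < κ) (x : ℝ) : 0 < 4 * Real.pi ^ 2 * x ^ 2 + κ ^ 2 := by
  positivity

/-- This is the Laplace transform formula for the resolvent in terms of the heat semigroup. -/
theorem isHeatSuperposition_plane {κ : ℝ} (hκ : 0 < κ) :
    IsHeatSuperposition Plane (fun t => Real.exp (-κ ^ 2 * t))
      (fun ξ => (4 * Real.pi ^ 2 * ‖ξ‖ ^ 2 + κ ^ 2)⁻¹) (green κ) where
  measurable := by fun_prop
  nonneg t _ := (Real.exp_pos _).le
  symbol ξ := by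
    simp only [exp_neg_mul_mul_exp]
    have hp := symbol_pos hκ ‖ξ‖
    refine ⟨exp_neg_integrableOn_Ioi 0 hp, ?_⟩
    rw [integral_exp_mul_Ioi (by linarith)]
    rw [mul_zero, Real.exp_zero, div_neg, neg_div, neg_neg, one_div]
  kernel r hr := by
    have := heat_substitution hκ hr
    have e : ∀ t, heatKernel (Module.finrank ℝ Plane) t r
        = (4 * Real.pi * t)⁻¹ * Real.exp (-r ^ 2 / (4 * t)) := by
      intro t
      simp [heatKernel]
    simp only [e]
    exact this

/-- The factor (4πt)^{-1/2} turns the one-dimensional heat kernel into the planar one, so the same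
Green function appears. On the Fourier side it produces a Gamma integral with Γ(1/2) = √π. -/
theorem isHeatSuperposition_line {κ : ℝ} (hκ : 0 < κ) :
    IsHeatSuperposition ℝ (fun t => (4 * Real.pi * t)⁻¹ ^ ((1 : ℝ) / 2) * Real.exp (-κ ^ 2 * t))
      (fun ξ => (2 * √(4 * Real.pi ^ 2 * ‖ξ‖ ^ 2 + κ ^ 2))⁻¹) (green κ) where
  measurable := by fun_prop
  nonneg t ht := by
    have := Real.pi_pos
    positivity
  symbol ξ := by
    have hpi := Real.pi_pos
    have hp := symbol_pos hκ ‖ξ‖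
    have e : ∀ t ∈ Set.Ioi (0 : ℝ), (4 * Real.pi * t)⁻¹ ^ ((1 : ℝ) / 2) * Real.exp (-κ ^ 2 * t)
          * Real.exp (-(4 * Real.pi ^ 2 * t) * ‖ξ‖ ^ 2)
        = (4 * Real.pi)⁻¹ ^ ((1 : ℝ) / 2) * (t ^ ((1 / 2 : ℝ) - 1)
          * Real.exp (-((4 * Real.pi ^ 2 * ‖ξ‖ ^ 2 + κ ^ 2) * t))) := by
      intro t ht
      have ht0 : (0 : ℝ) < t := ht
      rw [mul_assoc, exp_neg_mul_mul_exp, mul_inv, Real.mul_rpow (by positivity) (by positivity),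
        Real.inv_rpow ht0.le, ← Real.rpow_neg ht0.le, mul_assoc,
        neg_mul, show ((1 / 2 : ℝ) - 1) = -(1 / 2) by norm_num]
    have hint : IntegrableOn (fun t : ℝ => t ^ ((1 / 2 : ℝ) - 1)
          * Real.exp (-((4 * Real.pi ^ 2 * ‖ξ‖ ^ 2 + κ ^ 2) * t))) (Set.Ioi 0) := by
      have := integrableOn_rpow_mul_exp_neg_mul_rpow (p := 1) (s := (1 / 2 : ℝ) - 1) (by norm_num)
        (by norm_num) hp
      simp only [Real.rpow_one, neg_mul] at this
      exact this
    refine ⟨IntegrableOn.congr_fun (by exact hint.const_mul _) (fun t ht => (e t ht).symm) measurableSet_Ioi, ?_⟩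
    rw [setIntegral_congr_fun measurableSet_Ioi e, integral_const_mul,
      Real.integral_rpow_mul_exp_neg_mul_Ioi (by norm_num) hp, Real.Gamma_one_half_eq,
      ← Real.sqrt_eq_rpow, ← Real.sqrt_eq_rpow, mul_left_comm, ← Real.sqrt_mul (by positivity), one_div,
      Real.sqrt_inv, mul_comm, show (4 * Real.pi)⁻¹ * Real.pi = (2⁻¹) ^ 2 by field_simp; norm_num,
      Real.sqrt_sq (by norm_num), mul_inv]
  kernel r hr := by
    have := heat_substitution hκ hr
    have hpi := Real.pi_pos
    have e : ∀ t ∈ Set.Ioi (0 : ℝ), (4 * Real.pi * t)⁻¹ ^ ((1 : ℝ) / 2) * Real.exp (-κ ^ 2 * t)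
        * heatKernel (Module.finrank ℝ ℝ) t r
        = Real.exp (-κ ^ 2 * t) * ((4 * Real.pi * t)⁻¹ * Real.exp (-r ^ 2 / (4 * t))) := by
      intro t ht
      have ht0 : (0 : ℝ) < t := ht
      have h2 : (4 * Real.pi * t)⁻¹ ^ ((1 : ℝ) / 2) * (4 * Real.pi * t)⁻¹ ^ ((1 : ℝ) / 2)
          = (4 * Real.pi * t)⁻¹ := by
        rw [← Real.rpow_add (by positivity)]
        norm_num
      rw [heatKernel, Module.finrank_self, Nat.cast_one]
      nth_rewrite 3 [← h2]
      ring
    refine ⟨this.1.congr_fun (fun t ht => (e t ht).symm) measurableSet_Ioi, ?_⟩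
    rw [setIntegral_congr_fun measurableSet_Ioi e, this.2]

theorem green_anti {κ r r' : ℝ} (hκ : 0 < κ) (hr : 0 < r) (h : r ≤ r') :
    green κ r' ≤ green κ r :=
  mul_le_mul_of_nonneg_left (macdonaldK0_anti (by positivity) (by gcongr))
    (inv_nonneg.2 (by positivity))

theorem integrable_green_abs {κ : ℝ} (hκ : 0 < κ) : Integrable fun x : ℝ => green κ |x| :=
  (integrable_macdonaldK0_abs hκ).const_mul _

theorem measurable_green (κ : ℝ) : Measurable (green κ) :=
  (measurable_macdonaldK0.comp (measurable_const_mul κ)).const_mul _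

/-- Since chords are at least half the arc length and the Green function decreases, the kernel is
dominated by an integrable convolution kernel. One density is taken in L¹ and the other in L^∞. -/
theorem lintegral_green_lt_top {E : Type*} [NormedAddCommGroup E] {κ : ℝ} (hκ : 0 < κ)
    {γ : ℝ → E} (hlow : ∀ s s', |s - s'| / 2 ≤ ‖γ s - γ s'‖)
    {u v : ℝ → ℂ} (hv : Integrable v) {C : ℝ} (hC : ∀ s, ‖u s‖ ≤ C) :
    ∫⁻ p : ℝ × ℝ, ENNReal.ofReal (green κ ‖γ p.1 - γ p.2‖)
      * ‖starRingEnd ℂ (v p.1) * u p.2‖ₑ < ⊤ := by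
  have hC0 : 0 ≤ C := (norm_nonneg _).trans (hC 0)
  have hg := integrable_green_abs (half_pos hκ)
  have hgm : Measurable fun p : ℝ × ℝ => ENNReal.ofReal (green (κ / 2) |p.1 - p.2|) :=
    ((measurable_green _).comp (by fun_prop)).ennreal_ofReal
  have hgm' : ∀ x : ℝ, Measurable fun y : ℝ => ENNReal.ofReal (green (κ / 2) |x - y|) := fun x =>
    ((measurable_green _).comp (by fun_prop)).ennreal_ofReal
  have hle : ∫⁻ p : ℝ × ℝ, ENNReal.ofReal (green κ ‖γ p.1 - γ p.2‖)
      * ‖starRingEnd ℂ (v p.1) * u p.2‖ₑ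
      ≤ ∫⁻ p : ℝ × ℝ, ENNReal.ofReal (green (κ / 2) |p.1 - p.2|) * (‖v p.1‖ₑ * ENNReal.ofReal C) := by
    refine lintegral_mono_ae ?_
    filter_upwards [ae_ne_prod] with p hp
    refine mul_le_mul' (ENNReal.ofReal_le_ofReal ?_) ?_
    · have hpos : 0 < |p.1 - p.2| / 2 := half_pos (abs_pos.2 (sub_ne_zero.2 hp))
      refine (green_anti hκ hpos (hlow _ _)).trans_eq ?_
      simp only [green]
      congr 2
      ring
    · rw [enorm_mul, ← ofReal_norm (starRingEnd ℂ (v p.1)), RCLike.norm_conj, ofReal_norm,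
        ← ofReal_norm (u p.2)]
      gcongr
      exact hC _
  refine lt_of_le_of_lt hle ?_
  rw [Measure.volume_eq_prod, lintegral_prod _ (by
    exact hgm.aemeasurable.mul (hv.aestronglyMeasurable.comp_fst.enorm.mul_const _))]
  have hin : ∀ x : ℝ, ∫⁻ y : ℝ, ENNReal.ofReal (green (κ / 2) |x - y|) * (‖v x‖ₑ * ENNReal.ofReal C)
      = (∫⁻ y : ℝ, ENNReal.ofReal (green (κ / 2) |y|)) * (‖v x‖ₑ * ENNReal.ofReal C) := by
    intro x
    rw [lintegral_mul_const _ (hgm' x),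
      lintegral_sub_left_eq_self (fun y => ENNReal.ofReal (green (κ / 2) |y|)) x]
  simp only [hin]
  have h1 : ∫⁻ y : ℝ, ENNReal.ofReal (green (κ / 2) |y|) < ⊤ := by
    refine lt_of_le_of_lt (lintegral_mono fun y => ?_) hg.2
    exact (Real.enorm_eq_ofReal (green_nonneg _ _)).ge
  rw [lintegral_const_mul' _ _ h1.ne, lintegral_mul_const' _ _ ENNReal.ofReal_ne_top]
  exact ENNReal.mul_lt_top h1 (ENNReal.mul_lt_top hv.2 ENNReal.ofReal_lt_top)

end LeakyWire
end

noncomputable section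

namespace LeakyWire

open scoped BoundedContinuousFunction FourierTransform SchwartzMap

/-! ### Multiplication operators and Fourier multipliers -/

/-- The complex Hilbert space `L²(X)`. -/
abbrev L2 (X : Type*) [MeasureSpace X] : Type _ := Lp ℂ 2 (volume : Measure X)

theorem inner_L2 {X : Type*} [MeasureSpace X] (f g : L2 X) : inner ℂ f g = ∫ x, starRingEnd ℂ (f x) * g x := by
  rw [L2.inner_def]
  refine integral_congr_ae (Eventually.of_forall fun x => ?_)
  simp [mul_comm]

section Multiplication

variable {X : Type*} [MeasureSpace X] [TopologicalSpace X] [OpensMeasurableSpace X]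

theorem memLp_bcf_mul (m : X →ᵇ ℂ) (f : L2 X) : MemLp (fun x => m x * f x) 2 volume :=
  (Lp.memLp f).of_le_mul (c := ‖m‖)
    (m.continuous.aestronglyMeasurable.mul (Lp.aestronglyMeasurable f))
    (Eventually.of_forall fun x => by
      rw [norm_mul]
      exact mul_le_mul_of_nonneg_right (m.norm_coe_le_norm x) (norm_nonneg _))

theorem norm_toLp_bcf_mul_le (m : X →ᵇ ℂ) (f : L2 X) :
    ‖(memLp_bcf_mul m f).toLp‖ ≤ ‖m‖ * ‖f‖ := by
  refine Lp.norm_le_mul_norm_of_ae_le_mul ?_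
  filter_upwards [(memLp_bcf_mul m f).coeFn_toLp] with x hx
  rw [hx, norm_mul]
  exact mul_le_mul_of_nonneg_right (m.norm_coe_le_norm x) (norm_nonneg _)

/-- Multiplication by a bounded continuous function on `L²(X)`. -/
def mulOp (m : X →ᵇ ℂ) : L2 X →L[ℂ] L2 X :=
  LinearMap.mkContinuous
    { toFun := fun f => (memLp_bcf_mul m f).toLp
      map_add' := fun f g => by
        refine Lp.ext ?_
        filter_upwards [(memLp_bcf_mul m (f + g)).coeFn_toLp, (memLp_bcf_mul m f).coeFn_toLp,
          (memLp_bcf_mul m g).coeFn_toLp, Lp.coeFn_add f g,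
          Lp.coeFn_add (memLp_bcf_mul m f).toLp (memLp_bcf_mul m g).toLp] with x h1 h2 h3 h4 h5
        rw [h1, h5, Pi.add_apply, h2, h3, h4, Pi.add_apply, mul_add]
      map_smul' := fun c f => by
        refine Lp.ext ?_
        filter_upwards [(memLp_bcf_mul m (c • f)).coeFn_toLp, (memLp_bcf_mul m f).coeFn_toLp,
          Lp.coeFn_smul c f, Lp.coeFn_smul c (memLp_bcf_mul m f).toLp] with x h1 h2 h3 h4
        rw [h1, RingHom.id_apply, h4, Pi.smul_apply, h2, h3, Pi.smul_apply, smul_eq_mul,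
          smul_eq_mul, mul_left_comm] }
    ‖m‖ fun f => norm_toLp_bcf_mul_le m f

theorem coeFn_mulOp (m : X →ᵇ ℂ) (f : L2 X) : mulOp m f =ᵐ[volume] fun x => m x * f x :=
  (memLp_bcf_mul m f).coeFn_toLp

theorem norm_mulOp_le (m : X →ᵇ ℂ) : ‖mulOp m‖ ≤ ‖m‖ :=
  LinearMap.mkContinuous_norm_le _ (norm_nonneg _) _

theorem mulOp_sub (m n : X →ᵇ ℂ) : mulOp (m - n) = mulOp m - mulOp n := by
  ext1 f
  change mulOp (m - n) f = mulOp m f - mulOp n f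
  refine Lp.ext ?_
  filter_upwards [coeFn_mulOp (m - n) f, coeFn_mulOp m f, coeFn_mulOp n f,
    Lp.coeFn_sub (mulOp m f) (mulOp n f)] with x h1 h2 h3 h4
  rw [h1, h4, Pi.sub_apply, h2, h3, BoundedContinuousFunction.sub_apply,
    sub_mul]

theorem mulOp_add (m n : X →ᵇ ℂ) : mulOp (m + n) = mulOp m + mulOp n := by
  ext1 f
  change mulOp (m + n) f = mulOp m f + mulOp n f
  refine Lp.ext ?_
  filter_upwards [coeFn_mulOp (m + n) f, coeFn_mulOp m f, coeFn_mulOp n f,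
    Lp.coeFn_add (mulOp m f) (mulOp n f)] with x h1 h2 h3 h4
  rw [h1, h4, Pi.add_apply, h2, h3, BoundedContinuousFunction.add_apply,
    add_mul]

theorem mulOp_smul (c : ℂ) (m : X →ᵇ ℂ) : mulOp (c • m) = c • mulOp m := by
  ext1 f
  change mulOp (c • m) f = c • mulOp m f
  refine Lp.ext ?_
  filter_upwards [coeFn_mulOp (c • m) f, coeFn_mulOp m f,
    Lp.coeFn_smul c (mulOp m f)] with x h1 h2 h4
  rw [h1, h4, Pi.smul_apply, h2, BoundedContinuousFunction.coe_smul, smul_mul_assoc]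

theorem mulOp_one : mulOp (1 : X →ᵇ ℂ) = 1 := by
  ext1 f
  refine Lp.ext ?_
  filter_upwards [coeFn_mulOp 1 f] with x h1
  rw [h1]
  simp

theorem mulOp_mul (m n : X →ᵇ ℂ) : mulOp (m * n) = mulOp m * mulOp n := by
  ext1 f
  change mulOp (m * n) f = mulOp m (mulOp n f)
  refine Lp.ext ?_
  filter_upwards [coeFn_mulOp (m * n) f, coeFn_mulOp n f, coeFn_mulOp m (mulOp n f)]
    with x h1 h2 h3
  rw [h1, h3, h2, BoundedContinuousFunction.mul_apply, mul_assoc]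

theorem inner_mulOp_left (m : X →ᵇ ℂ) (f g : L2 X) :
    inner ℂ (mulOp m f) g = inner ℂ f (mulOp (star m) g) := by
  rw [inner_L2, inner_L2]
  refine integral_congr_ae ?_
  filter_upwards [coeFn_mulOp m f, coeFn_mulOp (star m) g] with x h1 h2
  rw [h1, h2, BoundedContinuousFunction.star_apply, map_mul, RCLike.star_def]
  ring

end Multiplication

theorem inner_L2Line (f g : L2Line) : inner ℂ f g = ∫ x, starRingEnd ℂ (f x) * g x := inner_L2 f g

/-- The unitary Fourier transform on `L²(ℝ)`. -/
def fourierL2 : L2Line ≃ₗᵢ[ℂ] L2Line := Lp.fourierTransformₗᵢ ℝ ℂ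

/-- The Fourier multiplier with symbol `m`. -/
def fourierMul (m : ℝ →ᵇ ℂ) : L2Line →L[ℂ] L2Line :=
  (fourierL2.symm : L2Line →L[ℂ] L2Line) ∘L mulOp m ∘L (fourierL2 : L2Line →L[ℂ] L2Line)

theorem fourierMul_apply (m : ℝ →ᵇ ℂ) (f : L2Line) :
    fourierMul m f = fourierL2.symm (mulOp m (fourierL2 f)) := rfl

theorem fourierMul_sub (m n : ℝ →ᵇ ℂ) : fourierMul (m - n) = fourierMul m - fourierMul n := by
  ext1 f
  simp [fourierMul_apply, mulOp_sub]

theorem fourierMul_add (m n : ℝ →ᵇ ℂ) : fourierMul (m + n) = fourierMul m + fourierMul n := by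
  ext1 f
  simp [fourierMul_apply, mulOp_add]

theorem fourierMul_smul (c : ℂ) (m : ℝ →ᵇ ℂ) : fourierMul (c • m) = c • fourierMul m := by
  ext1 f
  simp [fourierMul_apply, mulOp_smul]

theorem fourierMul_one : fourierMul 1 = 1 := by
  ext1 f
  simp [fourierMul_apply, mulOp_one]

theorem fourierMul_mul (m n : ℝ →ᵇ ℂ) : fourierMul (m * n) = fourierMul m * fourierMul n := by
  ext1 f
  simp [fourierMul_apply, mulOp_mul]

theorem norm_fourierMul_le (m : ℝ →ᵇ ℂ) : ‖fourierMul m‖ ≤ ‖m‖ := by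
  refine ContinuousLinearMap.opNorm_le_bound _ (norm_nonneg _) fun f => ?_
  rw [fourierMul_apply, LinearIsometryEquiv.norm_map, ← fourierL2.norm_map f]
  exact ((mulOp m).le_opNorm _).trans
    (mul_le_mul_of_nonneg_right (norm_mulOp_le m) (norm_nonneg _))

theorem inner_fourierMul (m : ℝ →ᵇ ℂ) (f g : L2Line) :
    inner ℂ f (fourierMul m g) = inner ℂ (fourierL2 f) (mulOp m (fourierL2 g)) := by
  rw [← fourierL2.inner_map_map f, fourierMul_apply, LinearIsometryEquiv.apply_symm_apply]

theorem inner_fourierMul_left (m : ℝ →ᵇ ℂ) (f g : L2Line) :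
    inner ℂ (fourierMul m f) g = inner ℂ f (fourierMul (star m) g) := by
  rw [inner_fourierMul, ← inner_mulOp_left, ← fourierL2.inner_map_map, fourierMul_apply,
    LinearIsometryEquiv.apply_symm_apply]

/-! ### Schwartz functions as a dense subspace of L²(ℝ). -/

/-- The element of `L²(ℝ)` given by a Schwartz function. -/
def ofSchwartz (u : 𝓢(ℝ, ℂ)) : L2Line := u.toLp 2

theorem coeFn_ofSchwartz (u : 𝓢(ℝ, ℂ)) : ofSchwartz u =ᵐ[volume] u := u.coeFn_toLp 2

theorem denseRange_ofSchwartz : DenseRange ofSchwartz :=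
  SchwartzMap.denseRange_toLpCLM (F := ℂ) (p := 2) (μ := volume) ENNReal.ofNat_ne_top

theorem fourierL2_ofSchwartz (u : 𝓢(ℝ, ℂ)) : fourierL2 (ofSchwartz u) = ofSchwartz (𝓕 u) :=
  SchwartzMap.toLp_fourier_eq u

theorem curveFourier_id (u : 𝓢(ℝ, ℂ)) (p : ℝ) : curveFourier id u p = 𝓕 u p := by
  rw [SchwartzMap.fourier_coe, Real.fourier_eq', curveFourier]
  refine integral_congr_ae (Eventually.of_forall fun s => ?_)
  simp only [id, smul_eq_mul]
  congr 2
  push_cast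
  rw [real_inner_comm]
  ring

/-- The line is the curve `id`, so Fourier multipliers on it fall under the results on Fourier
transforms of curve densities. -/
theorem inner_fourierMul_ofSchwartz (m : ℝ →ᵇ ℂ) (u v : 𝓢(ℝ, ℂ)) :
    inner ℂ (ofSchwartz v) (fourierMul m (ofSchwartz u))
      = ∫ p, m p * (starRingEnd ℂ (curveFourier id v p) * curveFourier id u p) := by
  rw [inner_fourierMul, fourierL2_ofSchwartz, fourierL2_ofSchwartz, inner_L2Line]
  refine integral_congr_ae ?_
  filter_upwards [coeFn_ofSchwartz (𝓕 v), coeFn_ofSchwartz (𝓕 u),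
    coeFn_mulOp m (ofSchwartz (𝓕 u))] with p h1 h2 h3
  rw [h3, h1, h2, curveFourier_id, curveFourier_id]
  ring

theorem exists_bound_schwartz (u : 𝓢(ℝ, ℂ)) : ∃ C, ∀ s, ‖u s‖ ≤ C := by
  obtain ⟨C, hC⟩ := u.decay 0 0
  exact ⟨C, fun s => by simpa using hC.2 s⟩

theorem continuousLinearMap_ext_of_inner_ofSchwartz {S T : L2Line →L[ℂ] L2Line}
    (h : ∀ u v : 𝓢(ℝ, ℂ), inner ℂ (ofSchwartz v) (S (ofSchwartz u))
      = inner ℂ (ofSchwartz v) (T (ofSchwartz u))) : S = T := by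
  have h1 : ∀ u : 𝓢(ℝ, ℂ), S (ofSchwartz u) = T (ofSchwartz u) := fun u => by
    refine ext_inner_left ℂ fun v => ?_
    refine denseRange_ofSchwartz.induction_on v (isClosed_eq ?_ ?_) fun v => h u v
    · fun_prop
    · fun_prop
  ext1 f
  exact denseRange_ofSchwartz.induction_on f (isClosed_eq S.continuous T.continuous) h1

end LeakyWire
end

noncomputable section

namespace LeakyWire

open scoped BoundedContinuousFunction FourierTransform SchwartzMap

/-! ### Integral operators with decaying kernels -/

/-- The decaying weight `(1 + s²)⁻¹`. -/
def decay (s : ℝ) : ℝ := (1 + s ^ 2)⁻¹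

theorem decay_pos (s : ℝ) : 0 < decay s := inv_pos.2 (by positivity)

theorem decay_le_one (s : ℝ) : decay s ≤ 1 := inv_le_one_of_one_le₀ (by nlinarith [sq_nonneg s])

theorem continuous_decay : Continuous decay :=
  (by fun_prop : Continuous fun s : ℝ => 1 + s ^ 2).inv₀ fun s => by positivity

theorem integrable_decay : Integrable decay := integrable_inv_one_add_sq

theorem memLp_decay : MemLp (fun s => (decay s : ℂ)) 2 volume := by
  refine (memLp_two_iff_integrable_sq_norm ?_).2 (integrable_decay.mono' ?_ ?_)
  · exact (Complex.continuous_ofReal.comp continuous_decay).aestronglyMeasurable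
  · exact ((Complex.continuous_ofReal.comp continuous_decay).norm.pow 2).aestronglyMeasurable
  · refine Eventually.of_forall fun s => ?_
    rw [Complex.norm_real, norm_pow, norm_norm, Real.norm_of_nonneg (decay_pos s).le]
    nlinarith [decay_pos s, decay_le_one s]

/-- The weight `(1 + s²)⁻¹` as an element of `L²(ℝ)`. -/
def decayL2 : L2Line := memLp_decay.toLp

theorem coeFn_decayL2 : decayL2 =ᵐ[volume] fun s => (decay s : ℂ) := memLp_decay.coeFn_toLp

/-- The pointwise absolute value in `L²(ℝ)`. -/
def absL2 (u : L2Line) : L2Line := ((Lp.memLp u).norm.ofReal (K := ℂ)).toLp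

theorem coeFn_absL2 (u : L2Line) : absL2 u =ᵐ[volume] fun s => (‖u s‖ : ℂ) :=
  ((Lp.memLp u).norm.ofReal (K := ℂ)).coeFn_toLp

theorem norm_absL2 (u : L2Line) : ‖absL2 u‖ = ‖u‖ := by
  refine le_antisymm (Lp.norm_le_norm_of_ae_le ?_) (Lp.norm_le_norm_of_ae_le ?_)
  all_goals
    filter_upwards [coeFn_absL2 u] with s hs
    rw [hs, Complex.norm_real, norm_norm]

theorem integrable_decay_mul_norm (u : L2Line) : Integrable fun s => decay s * ‖u s‖ := by
  have h := (memLp_decay.integrable_mul (Lp.memLp u)).norm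
  refine h.congr (Eventually.of_forall fun s => ?_)
  simp only [Pi.mul_apply, norm_mul, Complex.norm_real]
  rw [Real.norm_of_nonneg (decay_pos s).le]

theorem integral_decay_mul_norm_le (u : L2Line) :
    ∫ s, decay s * ‖u s‖ ≤ ‖decayL2‖ * ‖u‖ := by
  have h : inner ℂ decayL2 (absL2 u) = ((∫ s, decay s * ‖u s‖ : ℝ) : ℂ) := by
    rw [inner_L2Line, ← integral_complex_ofReal]
    refine integral_congr_ae ?_
    filter_upwards [coeFn_decayL2, coeFn_absL2 u] with s h1 h2
    rw [h1, h2, Complex.conj_ofReal, Complex.ofReal_mul]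
  have h2 := norm_inner_le_norm (𝕜 := ℂ) decayL2 (absL2 u)
  rw [h, Complex.norm_real, norm_absL2] at h2
  exact (le_abs_self _).trans h2

/-- The kernel `K` is measurable and bounded by `C (1 + s²)⁻¹ (1 + s'²)⁻¹`. -/
structure KernelBound (K : ℝ × ℝ → ℝ) (C : ℝ) : Prop where
  measurable : Measurable K
  bound : ∀ p, |K p| ≤ C * (decay p.1 * decay p.2)

theorem KernelBound.nonneg {K : ℝ × ℝ → ℝ} {C : ℝ} (hK : KernelBound K C) : 0 ≤ C := by
  have := (abs_nonneg _).trans (hK.bound (0, 0))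
  simpa [decay] using this

theorem KernelBound.sub {K K' : ℝ × ℝ → ℝ} {C C' : ℝ} (hK : KernelBound K C)
    (hK' : KernelBound K' C') : KernelBound (K - K') (C + C') :=
  ⟨hK.measurable.sub hK'.measurable, fun p => by
    rw [add_mul]
    exact (abs_sub _ _).trans (add_le_add (hK.bound p) (hK'.bound p))⟩

theorem KernelBound.integrable {K : ℝ × ℝ → ℝ} {C : ℝ} (hK : KernelBound K C) (u v : L2Line) :
    Integrable fun p : ℝ × ℝ => (K p : ℂ) * (starRingEnd ℂ (v p.1) * u p.2) := by
  have h0 : Integrable fun p : ℝ × ℝ => C * ((decay p.1 * ‖v p.1‖) * (decay p.2 * ‖u p.2‖)) :=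
    (Integrable.mul_prod (integrable_decay_mul_norm v) (integrable_decay_mul_norm u)).const_mul C
  refine h0.mono' ?_ (Eventually.of_forall fun p => ?_)
  · refine (Complex.measurable_ofReal.comp hK.measurable).aestronglyMeasurable.mul
      (AEStronglyMeasurable.mul ?_ ?_)
    · exact Complex.continuous_conj.comp_aestronglyMeasurable
        (Lp.aestronglyMeasurable v).comp_fst
    · exact (Lp.aestronglyMeasurable u).comp_snd
  · rw [norm_mul, norm_mul, Complex.norm_real, RCLike.norm_conj, Real.norm_eq_abs]
    calc |K p| * (‖v p.1‖ * ‖u p.2‖) ≤ C * (decay p.1 * decay p.2) * (‖v p.1‖ * ‖u p.2‖) :=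
          mul_le_mul_of_nonneg_right (hK.bound p) (by positivity)
      _ = _ := by ring

/-- The sesquilinear form with kernel `K`. -/
def kernelForm (K : ℝ × ℝ → ℝ) (v u : L2Line) : ℂ :=
  ∫ p : ℝ × ℝ, (K p : ℂ) * (starRingEnd ℂ (v p.1) * u p.2)

theorem KernelBound.norm_kernelForm_le {K : ℝ × ℝ → ℝ} {C : ℝ} (hK : KernelBound K C)
    (v u : L2Line) : ‖kernelForm K v u‖ ≤ C * ‖decayL2‖ ^ 2 * ‖v‖ * ‖u‖ := by
  have h0 : Integrable fun p : ℝ × ℝ => C * ((decay p.1 * ‖v p.1‖) * (decay p.2 * ‖u p.2‖)) :=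
    (Integrable.mul_prod (integrable_decay_mul_norm v) (integrable_decay_mul_norm u)).const_mul C
  have h1 : ‖kernelForm K v u‖
      ≤ ∫ p : ℝ × ℝ, C * ((decay p.1 * ‖v p.1‖) * (decay p.2 * ‖u p.2‖)) := by
    refine norm_integral_le_of_norm_le h0 (Eventually.of_forall fun p => ?_)
    rw [norm_mul, norm_mul, Complex.norm_real, RCLike.norm_conj, Real.norm_eq_abs]
    calc |K p| * (‖v p.1‖ * ‖u p.2‖) ≤ C * (decay p.1 * decay p.2) * (‖v p.1‖ * ‖u p.2‖) :=
          mul_le_mul_of_nonneg_right (hK.bound p) (by positivity)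
      _ = _ := by ring
  refine h1.trans ?_
  rw [integral_const_mul, Measure.volume_eq_prod, integral_prod_mul
    (fun s => decay s * ‖v s‖) (fun s => decay s * ‖u s‖)]
  have hv := integral_decay_mul_norm_le v
  have hu := integral_decay_mul_norm_le u
  have hu0 : 0 ≤ ∫ s, decay s * ‖u s‖ :=
    integral_nonneg fun s => mul_nonneg (decay_pos s).le (norm_nonneg _)
  calc C * ((∫ s, decay s * ‖v s‖) * ∫ s, decay s * ‖u s‖)
      ≤ C * ((‖decayL2‖ * ‖v‖) * (‖decayL2‖ * ‖u‖)) :=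
        mul_le_mul_of_nonneg_left (mul_le_mul hv hu hu0 (by positivity)) hK.nonneg
    _ = _ := by ring

theorem ae_fst {P : ℝ → Prop} (h : ∀ᵐ s, P s) : ∀ᵐ p : ℝ × ℝ, P p.1 :=
  Measure.quasiMeasurePreserving_fst.ae h

theorem ae_snd {P : ℝ → Prop} (h : ∀ᵐ s, P s) : ∀ᵐ p : ℝ × ℝ, P p.2 :=
  Measure.quasiMeasurePreserving_snd.ae h

/-- Riesz representation of a bounded sesquilinear form; boundedness is Cauchy–Schwarz against the
square integrable weight `decay`. -/
theorem KernelBound.exists_op {K : ℝ × ℝ → ℝ} {C : ℝ} (hK : KernelBound K C) :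
    ∃ T : L2Line →L[ℂ] L2Line, ∀ v u, inner ℂ v (T u) = kernelForm K v u := by
  let B₀ : L2Line →ₗ⋆[ℂ] L2Line →ₗ[ℂ] ℂ := LinearMap.mk₂'ₛₗ (starRingEnd ℂ) (RingHom.id ℂ)
    (kernelForm K)
    (fun v v' u => by
      rw [kernelForm, kernelForm, kernelForm, ← integral_add (hK.integrable u v)
        (hK.integrable u v')]
      refine integral_congr_ae ?_
      filter_upwards [ae_fst (Lp.coeFn_add v v')] with p hp
      rw [hp, Pi.add_apply, map_add]
      ring)
    (fun c v u => by
      rw [kernelForm, kernelForm, smul_eq_mul, ← integral_const_mul]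
      refine integral_congr_ae ?_
      filter_upwards [ae_fst (Lp.coeFn_smul c v)] with p hp
      rw [hp, Pi.smul_apply, smul_eq_mul, map_mul]
      ring)
    (fun v u u' => by
      rw [kernelForm, kernelForm, kernelForm, ← integral_add (hK.integrable u v)
        (hK.integrable u' v)]
      refine integral_congr_ae ?_
      filter_upwards [ae_snd (Lp.coeFn_add u u')] with p hp
      rw [hp, Pi.add_apply]
      ring)
    (fun c v u => by
      rw [kernelForm, kernelForm, RingHom.id_apply, smul_eq_mul, ← integral_const_mul]
      refine integral_congr_ae ?_
      filter_upwards [ae_snd (Lp.coeFn_smul c u)] with p hp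
      rw [hp, Pi.smul_apply, smul_eq_mul]
      ring)
  let B : L2Line →L⋆[ℂ] L2Line →L[ℂ] ℂ := LinearMap.mkContinuous₂ B₀ (C * ‖decayL2‖ ^ 2)
    fun v u => hK.norm_kernelForm_le v u
  -- `continuousLinearMapOfBilin` places its operator in the left slot of the inner product; the
  -- adjoint moves it to the right.
  refine ⟨ContinuousLinearMap.adjoint (InnerProductSpace.continuousLinearMapOfBilin B),
    fun v u => ?_⟩
  rw [ContinuousLinearMap.adjoint_inner_right, InnerProductSpace.continuousLinearMapOfBilin_apply]
  rfl

open Classical in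
/-- The integral operator with kernel `K`. -/
def kernelOp (K : ℝ × ℝ → ℝ) : L2Line →L[ℂ] L2Line :=
  -- The bound chosen is immaterial, because the form determines the operator; kernels without such
  -- a bound get the value 0.
  if h : ∃ C, KernelBound K C then h.choose_spec.exists_op.choose else 0

theorem KernelBound.inner_kernelOp {K : ℝ × ℝ → ℝ} {C : ℝ} (hK : KernelBound K C)
    (v u : L2Line) : inner ℂ v (kernelOp K u) = kernelForm K v u := by
  have h : ∃ C, KernelBound K C := ⟨C, hK⟩
  rw [kernelOp, dif_pos h]
  exact h.choose_spec.exists_op.choose_spec v u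

theorem opNorm_le_of_inner {T : L2Line →L[ℂ] L2Line} {c : ℝ} (hc : 0 ≤ c)
    (h : ∀ v u, ‖inner ℂ v (T u)‖ ≤ c * ‖v‖ * ‖u‖) : ‖T‖ ≤ c := by
  refine T.opNorm_le_bound hc fun u => ?_
  have := h (T u) u
  rw [inner_self_eq_norm_sq_to_K] at this
  have h2 : ‖T u‖ ^ 2 ≤ c * ‖T u‖ * ‖u‖ := by simpa using this
  rcases (norm_nonneg (T u)).eq_or_lt with h0 | h0
  · rw [← h0]; positivity
  · nlinarith

theorem KernelBound.norm_kernelOp_le {K : ℝ × ℝ → ℝ} {C : ℝ} (hK : KernelBound K C) :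
    ‖kernelOp K‖ ≤ C * ‖decayL2‖ ^ 2 := by
  refine opNorm_le_of_inner (mul_nonneg hK.nonneg (by positivity)) fun v u => ?_
  rw [hK.inner_kernelOp]
  exact hK.norm_kernelForm_le v u

theorem KernelBound.kernelOp_sub {K K' : ℝ × ℝ → ℝ} {C C' : ℝ} (hK : KernelBound K C)
    (hK' : KernelBound K' C') : kernelOp (K - K') = kernelOp K - kernelOp K' := by
  refine ContinuousLinearMap.ext fun u => ext_inner_left ℂ fun v => ?_
  change inner ℂ v (kernelOp (K - K') u) = inner ℂ v (kernelOp K u - kernelOp K' u)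
  rw [inner_sub_right, (hK.sub hK').inner_kernelOp, hK.inner_kernelOp, hK'.inner_kernelOp,
    kernelForm, kernelForm, kernelForm, ← integral_sub (hK.integrable u v) (hK'.integrable u v)]
  refine integral_congr_ae (Eventually.of_forall fun p => ?_)
  simp only [Pi.sub_apply, Complex.ofReal_sub, sub_mul]

theorem KernelBound.norm_kernelOp_sub_le {K K' : ℝ × ℝ → ℝ} {C C' C'' : ℝ}
    (hK : KernelBound K C) (hK' : KernelBound K' C')
    (h : ∀ p, |K p - K' p| ≤ C'' * (decay p.1 * decay p.2)) :
    ‖kernelOp K - kernelOp K'‖ ≤ C'' * ‖decayL2‖ ^ 2 := by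
  rw [← hK.kernelOp_sub hK']
  exact KernelBound.norm_kernelOp_le ⟨hK.measurable.sub hK'.measurable, h⟩

theorem KernelBound.inner_kernelOp_left {K : ℝ × ℝ → ℝ} {C : ℝ} (hK : KernelBound K C)
    (hs : ∀ p, K p.swap = K p) (v u : L2Line) :
    inner ℂ (kernelOp K v) u = inner ℂ v (kernelOp K u) := by
  rw [← inner_conj_symm, hK.inner_kernelOp, hK.inner_kernelOp, kernelForm, kernelForm,
    ← integral_conj, Measure.volume_eq_prod, ← integral_prod_swap]
  refine integral_congr_ae (Eventually.of_forall fun p => ?_)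
  simp only [map_mul, Complex.conj_ofReal, Complex.conj_conj, hs, Prod.fst_swap, Prod.snd_swap]
  ring

theorem KernelBound.inner_kernelOp_ofSchwartz {K : ℝ × ℝ → ℝ} {C : ℝ} (hK : KernelBound K C)
    (v u : 𝓢(ℝ, ℂ)) : inner ℂ (ofSchwartz v) (kernelOp K (ofSchwartz u))
      = ∫ p : ℝ × ℝ, (K p : ℂ) * (starRingEnd ℂ (v p.1) * u p.2) := by
  rw [hK.inner_kernelOp, kernelForm]
  refine integral_congr_ae ?_
  filter_upwards [ae_fst (coeFn_ofSchwartz v), ae_snd (coeFn_ofSchwartz u)] with p h1 h2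
  rw [h1, h2]

end LeakyWire
end

noncomputable section

namespace LeakyWire

open scoped BoundedContinuousFunction FourierTransform SchwartzMap

/-! ### The Birman–Schwinger operator of the straight line -/

/-- The symbol `2πp ↦ √(p² + κ²)`. -/
def freq (κ p : ℝ) : ℝ := √(4 * Real.pi ^ 2 * p ^ 2 + κ ^ 2)

theorem continuous_freq (κ : ℝ) : Continuous (freq κ) := by
  unfold freq
  fun_prop

theorem le_freq {κ : ℝ} (p : ℝ) : κ ≤ freq κ p :=
  Real.le_sqrt_of_sq_le (by nlinarith [sq_nonneg (Real.pi * p)])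

theorem freq_sq (κ p : ℝ) : freq κ p ^ 2 = 4 * Real.pi ^ 2 * p ^ 2 + κ ^ 2 :=
  Real.sq_sqrt (by positivity)

theorem freq_pos {κ : ℝ} (hκ : 0 < κ) (p : ℝ) : 0 < freq κ p := hκ.trans_le (le_freq p)

/-- The squares of the two frequencies differ by κ² - κ'², and their sum is at least κ + κ'. -/
theorem abs_freq_sub_le {κ κ' : ℝ} (hκ : 0 < κ) (hκ' : 0 < κ') (p : ℝ) :
    |freq κ p - freq κ' p| ≤ |κ - κ'| := by
  have h1 := freq_sq κ p
  have h2 := freq_sq κ' p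
  have h3 := le_freq (κ := κ) p
  have h4 := le_freq (κ := κ') p
  have h5 : (freq κ p - freq κ' p) * (freq κ p + freq κ' p) = (κ - κ') * (κ + κ') := by
    linear_combination h1 - h2
  have h6 : |freq κ p - freq κ' p| * (freq κ p + freq κ' p) = |κ - κ'| * (κ + κ') := by
    rw [← abs_of_pos (show 0 < freq κ p + freq κ' p by linarith), ← abs_mul, h5, abs_mul,
      abs_of_pos (show 0 < κ + κ' by linarith)]
  by_contra hcon
  nlinarith [abs_nonneg (κ - κ')]

/-- The symbol of the Birman–Schwinger operator of the line. -/
def lineSymbol {κ : ℝ} (hκ : 0 < κ) : ℝ →ᵇ ℂ :=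
  BoundedContinuousFunction.ofNormedAddCommGroup (fun p => ((2 * freq κ p)⁻¹ : ℝ))
    (Complex.continuous_ofReal.comp ((continuous_const.mul (continuous_freq κ)).inv₀
      fun p => (mul_pos two_pos (freq_pos hκ p)).ne')) ((2 * κ)⁻¹) fun p => by
    rw [Complex.norm_real, Real.norm_of_nonneg (inv_nonneg.2 (mul_pos two_pos (freq_pos hκ p)).le)]
    have := le_freq (κ := κ) p
    gcongr

/-- The symbol of the resolvent of the Laplacian on the line. -/
def resolventSymbol {δ : ℝ} (hδ : 0 < δ) : ℝ →ᵇ ℂ :=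
  BoundedContinuousFunction.ofNormedAddCommGroup
    (fun p => ((4 * Real.pi ^ 2 * p ^ 2 + δ ^ 2)⁻¹ : ℝ))
    (Complex.continuous_ofReal.comp ((by fun_prop : Continuous fun p : ℝ =>
      4 * Real.pi ^ 2 * p ^ 2 + δ ^ 2).inv₀ fun p => (symbol_pos hδ p).ne')) ((δ ^ 2)⁻¹) fun p => by
    rw [Complex.norm_real, Real.norm_of_nonneg (inv_nonneg.2 (symbol_pos hδ p).le)]
    have : 0 ≤ 4 * Real.pi ^ 2 * p ^ 2 := by positivity
    gcongr
    linarith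

/-- The symbol of the regular part of the inverse of `1 - α R`. -/
def regularSymbol {α κ : ℝ} (hα : 0 < α) (hκ : 0 < κ) : ℝ →ᵇ ℂ :=
  BoundedContinuousFunction.ofNormedAddCommGroup
    (fun p => (1 + α / 2 / (freq κ p + α / 2) : ℝ))
    (Complex.continuous_ofReal.comp (continuous_const.add (continuous_const.div
      ((continuous_freq κ).add continuous_const) fun p => by
        have := freq_pos hκ p
        positivity))) 2 fun p => by
    have := freq_pos hκ p
    rw [Complex.norm_real, Real.norm_of_nonneg (by positivity)]
    have : α / 2 / (freq κ p + α / 2) ≤ 1 := (div_le_one (by positivity)).2 (by linarith)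
    linarith

theorem lineSymbol_apply {κ : ℝ} (hκ : 0 < κ) (p : ℝ) :
    lineSymbol hκ p = ((2 * freq κ p)⁻¹ : ℝ) := rfl

theorem resolventSymbol_apply {δ : ℝ} (hδ : 0 < δ) (p : ℝ) :
    resolventSymbol hδ p = ((4 * Real.pi ^ 2 * p ^ 2 + δ ^ 2)⁻¹ : ℝ) := rfl

theorem regularSymbol_apply {α κ : ℝ} (hα : 0 < α) (hκ : 0 < κ) (p : ℝ) :
    regularSymbol hα hκ p = (1 + α / 2 / (freq κ p + α / 2) : ℝ) := rfl

theorem norm_regularSymbol_le {α κ : ℝ} (hα : 0 < α) (hκ : 0 < κ) : ‖regularSymbol hα hκ‖ ≤ 2 :=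
  BoundedContinuousFunction.norm_ofNormedAddCommGroup_le _ (by positivity) _

theorem star_regularSymbol {α κ : ℝ} (hα : 0 < α) (hκ : 0 < κ) :
    star (regularSymbol hα hκ) = regularSymbol hα hκ := by
  ext p
  rw [BoundedContinuousFunction.star_apply, regularSymbol_apply, RCLike.star_def,
    Complex.conj_ofReal]

theorem norm_regularSymbol_sub_le {α κ κ' : ℝ} (hα : 0 < α) (hκ : 0 < κ) (hκ' : 0 < κ') :
    ‖regularSymbol hα hκ - regularSymbol hα hκ'‖ ≤ 2 / α * |κ - κ'| := by
  refine (BoundedContinuousFunction.norm_le (by positivity)).2 fun p => ?_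
  have h1 := freq_pos hκ p
  have h2 := freq_pos hκ' p
  rw [BoundedContinuousFunction.sub_apply, regularSymbol_apply, regularSymbol_apply,
    ← Complex.ofReal_sub, Complex.norm_real, Real.norm_eq_abs]
  have e : 1 + α / 2 / (freq κ p + α / 2) - (1 + α / 2 / (freq κ' p + α / 2))
      = (α / 2) * (freq κ' p - freq κ p) / ((freq κ p + α / 2) * (freq κ' p + α / 2)) := by
    field_simp
    ring
  rw [e, abs_div, abs_mul, abs_of_pos (by positivity : 0 < α / 2), abs_sub_comm,
    abs_of_pos (by positivity : 0 < (freq κ p + α / 2) * (freq κ' p + α / 2)),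
    div_le_iff₀ (by positivity)]
  have h3 := abs_freq_sub_le hκ hκ' p
  have h4 : α / 2 * (α / 2) ≤ (freq κ p + α / 2) * (freq κ' p + α / 2) := by
    gcongr <;> linarith
  calc α / 2 * |freq κ p - freq κ' p| ≤ α / 2 * |κ - κ'| := by gcongr
    _ = 2 / α * |κ - κ'| * (α / 2 * (α / 2)) := by field_simp
    _ ≤ _ := by gcongr

/-- With f = `freq κ p`, the inverse of 1 - α/(2f) is 1 + (α/2)/(f - α/2). Partial fractions give
(α/2)/(f - α/2) = (α/2)/(f + α/2) + (α²/2)/(f² - α²/4), and f² - α²/4 = 4π²p² + δ². The singularity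
at δ = 0 is thus exactly that of the free resolvent on the line. -/
theorem inverse_symbol {α δ κ : ℝ} (hα : 0 < α) (hδ : 0 < δ) (hκ : 0 < κ)
    (h : κ ^ 2 = α ^ 2 / 4 + δ ^ 2) :
    (1 - (α : ℂ) • lineSymbol hκ)
      * (regularSymbol hα hκ + ((α ^ 2 / 2 : ℝ) : ℂ) • resolventSymbol hδ) = 1 := by
  ext p
  simp only [BoundedContinuousFunction.mul_apply, BoundedContinuousFunction.sub_apply,
    BoundedContinuousFunction.add_apply, BoundedContinuousFunction.coe_smul,
    BoundedContinuousFunction.coe_one, Pi.one_apply, lineSymbol_apply, regularSymbol_apply,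
    resolventSymbol_apply, smul_eq_mul]
  have hf := freq_pos hκ p
  have hs := freq_sq κ p
  have hr := symbol_pos hδ p
  have hfac : 4 * Real.pi ^ 2 * p ^ 2 + δ ^ 2 = (freq κ p - α / 2) * (freq κ p + α / 2) := by
    linear_combination -hs - h
  have hm : freq κ p - α / 2 ≠ 0 := by
    intro h0
    rw [hfac, h0, zero_mul] at hr
    exact lt_irrefl _ hr
  have hp : freq κ p + α / 2 ≠ 0 := by positivity
  rw [hfac]
  have : (1 - α * (2 * freq κ p)⁻¹) * (1 + α / 2 / (freq κ p + α / 2)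
      + α ^ 2 / 2 * ((freq κ p - α / 2) * (freq κ p + α / 2))⁻¹) = 1 := by
    have key : ∀ a m : ℝ, m ≠ 0 → m + a ≠ 0 → m + 2 * a ≠ 0 →
        (1 - 2 * a * (2 * (m + a))⁻¹) * (1 + a / (m + 2 * a) + 2 * a ^ 2 * (m * (m + 2 * a))⁻¹)
          = 1 := by
      intro a m h1 h2 h3
      field_simp
      ring
    convert key (α / 2) (freq κ p - α / 2) hm (by linarith) (by
      rw [show freq κ p - α / 2 + 2 * (α / 2) = freq κ p + α / 2 by ring]; exact hp) using 2
    · ring_nf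
    · rw [show freq κ p - α / 2 + 2 * (α / 2) = freq κ p + α / 2 by ring]
      ring
  exact_mod_cast this

/-- The Birman–Schwinger operator of the straight line. -/
def lineOp {κ : ℝ} (hκ : 0 < κ) : L2Line →L[ℂ] L2Line := fourierMul (lineSymbol hκ)

/-- The inverse of `1 - α lineOp`. -/
def lineInv {α δ κ : ℝ} (hα : 0 < α) (hδ : 0 < δ) (hκ : 0 < κ) : L2Line →L[ℂ] L2Line :=
  fourierMul (regularSymbol hα hκ + ((α ^ 2 / 2 : ℝ) : ℂ) • resolventSymbol hδ)

theorem lineOp_mul_lineInv {α δ κ : ℝ} (hα : 0 < α) (hδ : 0 < δ) (hκ : 0 < κ)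
    (h : κ ^ 2 = α ^ 2 / 4 + δ ^ 2) : (1 - (α : ℂ) • lineOp hκ) * lineInv hα hδ hκ = 1 := by
  rw [lineOp, lineInv, ← fourierMul_smul, ← fourierMul_one, ← fourierMul_sub, ← fourierMul_mul,
    inverse_symbol hα hδ hκ h]

theorem lineInv_mul_lineOp {α δ κ : ℝ} (hα : 0 < α) (hδ : 0 < δ) (hκ : 0 < κ)
    (h : κ ^ 2 = α ^ 2 / 4 + δ ^ 2) : lineInv hα hδ hκ * (1 - (α : ℂ) • lineOp hκ) = 1 := by
  rw [lineOp, lineInv, ← fourierMul_smul, ← fourierMul_one, ← fourierMul_sub, ← fourierMul_mul,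
    mul_comm, inverse_symbol hα hδ hκ h]

theorem inner_lineOp_ofSchwartz {κ : ℝ} (hκ : 0 < κ) (v u : 𝓢(ℝ, ℂ)) :
    inner ℂ (ofSchwartz v) (lineOp hκ (ofSchwartz u))
      = ∫ p : ℝ × ℝ, (green κ |p.1 - p.2| : ℂ) * (starRingEnd ℂ (v p.1) * u p.2) := by
  obtain ⟨Cu, hCu⟩ := exists_bound_schwartz u
  obtain ⟨Cv, hCv⟩ := exists_bound_schwartz v
  have hlow : ∀ s s' : ℝ, |s - s'| / 2 ≤ ‖id s - id s'‖ := fun s s' => by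
    rw [id, id, Real.norm_eq_abs]
    linarith [abs_nonneg (s - s')]
  have := (isHeatSuperposition_line hκ).integral_symbol (γ := id) measurable_id
    (fun s s' h => h) u.integrable v.integrable
    (lintegral_green_lt_top hκ hlow u.integrable hCu)
    (lintegral_green_lt_top hκ hlow v.integrable hCv)
    (lintegral_green_lt_top hκ hlow v.integrable hCu)
  rw [lineOp, inner_fourierMul_ofSchwartz]
  simp only [id, Real.norm_eq_abs, sq_abs] at this
  exact this

/-! ### The resolvent of the Laplacian on the line -/

theorem integrable_resolventSymbol {δ : ℝ} (hδ : 0 < δ) :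
    Integrable fun p : ℝ => ((4 * Real.pi ^ 2 * p ^ 2 + δ ^ 2)⁻¹ : ℝ) := by
  have hpi := Real.pi_pos
  have h := (integrable_inv_one_add_sq.comp_mul_left' (R := 2 * Real.pi / δ) (by positivity)).const_mul
    ((δ ^ 2)⁻¹)
  refine h.congr (Eventually.of_forall fun p => ?_)
  simp only
  rw [← mul_inv]
  congr 1
  field_simp
  ring

theorem integrable_exp_neg_abs {δ : ℝ} (hδ : 0 < δ) : Integrable fun x : ℝ => Real.exp (-δ * |x|) :=
  integrable_comp_abs (f := fun x => Real.exp (-δ * x)) (exp_neg_integrableOn_Ioi 0 hδ)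

theorem fourier_exp_neg_abs {δ : ℝ} (hδ : 0 < δ) (p : ℝ) :
    𝓕 (fun x : ℝ => (Real.exp (-δ * |x|) : ℂ)) p
      = ((2 * δ * (4 * Real.pi ^ 2 * p ^ 2 + δ ^ 2)⁻¹ : ℝ) : ℂ) := by
  rw [Real.fourier_eq']
  set a : ℂ := (δ : ℂ) - 2 * Real.pi * p * Complex.I with ha
  set b : ℂ := -(δ : ℂ) - 2 * Real.pi * p * Complex.I with hb
  have hare : a.re = δ := by simp [ha]
  have hbre : b.re = -δ := by simp [hb]
  have e1 : ∀ x ∈ Set.Iic (0 : ℝ), Complex.exp ((-2 * Real.pi * inner ℝ x p : ℝ) * Complex.I)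
      • (Real.exp (-δ * |x|) : ℂ) = Complex.exp (a * x) := by
    intro x hx
    rw [abs_of_nonpos hx, smul_eq_mul, Complex.ofReal_exp, ← Complex.exp_add]
    congr 1
    simp [ha]
    ring
  have e2 : ∀ x ∈ Set.Ioi (0 : ℝ), Complex.exp ((-2 * Real.pi * inner ℝ x p : ℝ) * Complex.I)
      • (Real.exp (-δ * |x|) : ℂ) = Complex.exp (b * x) := by
    intro x hx
    rw [abs_of_pos hx, smul_eq_mul, Complex.ofReal_exp, ← Complex.exp_add]
    congr 1
    simp [hb]
    ring
  have i1 := (integrableOn_exp_mul_complex_Iic (a := a) (by rw [hare]; exact hδ) 0).congr_fun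
    (fun x hx => (e1 x hx).symm) measurableSet_Iic
  have i2 := (integrableOn_exp_mul_complex_Ioi (a := b) (by rw [hbre]; linarith) 0).congr_fun
    (fun x hx => (e2 x hx).symm) measurableSet_Ioi
  rw [← intervalIntegral.integral_Iic_add_Ioi i1 i2, setIntegral_congr_fun measurableSet_Iic e1,
    setIntegral_congr_fun measurableSet_Ioi e2,
    integral_exp_mul_complex_Iic (by rw [hare]; exact hδ),
    integral_exp_mul_complex_Ioi (by rw [hbre]; linarith)]
  have ha0 : a ≠ 0 := fun h => by rw [h] at hare; simp at hare; linarith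
  have hb0 : b ≠ 0 := fun h => by rw [h] at hbre; simp at hbre; linarith
  have hab : a * b = -((4 * Real.pi ^ 2 * p ^ 2 + δ ^ 2 : ℝ) : ℂ) := by
    rw [ha, hb]
    push_cast
    ring_nf
    rw [Complex.I_sq]
    ring
  have hs : ((4 * Real.pi ^ 2 * p ^ 2 + δ ^ 2 : ℝ) : ℂ) ≠ 0 := by
    exact_mod_cast (symbol_pos hδ p).ne'
  have hsub : b - a = -(2 * δ) := by rw [ha, hb]; ring
  rw [Complex.ofReal_zero, mul_zero, mul_zero, Complex.exp_zero, neg_div, ← sub_eq_add_neg,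
    div_sub_div _ _ ha0 hb0, hab, one_mul, mul_one, hsub, neg_div_neg_eq, Complex.ofReal_mul,
    Complex.ofReal_inv, div_eq_mul_inv]
  push_cast
  rfl

/-- Fourier inversion applied to the transform of e^{-δ|x|}. -/
theorem integral_resolventSymbol_mul_char {δ : ℝ} (hδ : 0 < δ) (x : ℝ) :
    ∫ p : ℝ, resolventSymbol hδ p * Complex.exp ((2 * Real.pi * inner ℝ x p : ℝ) * Complex.I)
      = ((2 * δ)⁻¹ * Real.exp (-δ * |x|) : ℝ) := by
  have hc : Continuous fun x : ℝ => (Real.exp (-δ * |x|) : ℂ) := by fun_prop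
  have hF : 𝓕 (fun x : ℝ => (Real.exp (-δ * |x|) : ℂ))
      = fun p => ((2 * δ * (4 * Real.pi ^ 2 * p ^ 2 + δ ^ 2)⁻¹ : ℝ) : ℂ) :=
    funext fun p => fourier_exp_neg_abs hδ p
  have hinv := hc.fourierInv_fourier_eq (integrable_exp_neg_abs hδ).ofReal (by
    rw [hF]; exact ((integrable_resolventSymbol hδ).const_mul _).ofReal)
  have hx := congrFun hinv x
  rw [hF, Real.fourierInv_eq'] at hx
  rw [Complex.ofReal_mul, ← hx, ← integral_const_mul]
  refine integral_congr_ae (Eventually.of_forall fun p => ?_)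
  simp only [resolventSymbol_apply, smul_eq_mul]
  rw [real_inner_comm x p]
  have : (δ : ℂ) ≠ 0 := by exact_mod_cast hδ.ne'
  push_cast
  field_simp

theorem inner_resolvent_ofSchwartz {δ : ℝ} (hδ : 0 < δ) (v u : 𝓢(ℝ, ℂ)) :
    inner ℂ (ofSchwartz v) (fourierMul (resolventSymbol hδ) (ofSchwartz u))
      = ∫ p : ℝ × ℝ, (((2 * δ)⁻¹ * Real.exp (-δ * |p.1 - p.2|) : ℝ) : ℂ)
        * (starRingEnd ℂ (v p.1) * u p.2) := by
  rw [inner_fourierMul_ofSchwartz, integral_mul_conj_curveFourier_mul measurable_id u.integrable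
    v.integrable (by exact (integrable_resolventSymbol hδ).ofReal)]
  simp only [integral_resolventSymbol_mul_char hδ, id]

end LeakyWire
end

noncomputable section

namespace LeakyWire

open scoped BoundedContinuousFunction FourierTransform SchwartzMap

/-! ### The weighted inverse -/

/-- The weight `(1 + s²)⁻²`. -/
def weight (s : ℝ) : ℝ := decay s ^ 2

theorem continuous_weight : Continuous weight := continuous_decay.pow 2

theorem weight_pos (s : ℝ) : 0 < weight s := pow_pos (decay_pos s) 2

theorem weight_le_decay (s : ℝ) : weight s ≤ decay s := by
  unfold weight
  nlinarith [decay_pos s, decay_le_one s]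

/-- The weight as a bounded continuous function. -/
def weightBCF : ℝ →ᵇ ℂ :=
  BoundedContinuousFunction.ofNormedAddCommGroup (fun s => (weight s : ℂ))
    (Complex.continuous_ofReal.comp continuous_weight) 1 fun s => by
    rw [Complex.norm_real, Real.norm_of_nonneg (weight_pos s).le]
    exact (weight_le_decay s).trans (decay_le_one s)

theorem weightBCF_apply (s : ℝ) : weightBCF s = (weight s : ℂ) := rfl

/-- Multiplication by the weight. -/
def weightOp : L2Line →L[ℂ] L2Line := mulOp weightBCF

theorem norm_weightOp_le : ‖weightOp‖ ≤ 1 :=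
  (norm_mulOp_le _).trans (BoundedContinuousFunction.norm_ofNormedAddCommGroup_le _ zero_le_one _)

theorem coeFn_weightOp (f : L2Line) : weightOp f =ᵐ[volume] fun s => (weight s : ℂ) * f s :=
  coeFn_mulOp _ f

theorem inner_weightOp_left (f g : L2Line) :
    inner ℂ (weightOp f) g = inner ℂ f (weightOp g) := by
  have : star weightBCF = weightBCF := by
    ext s
    rw [BoundedContinuousFunction.star_apply, weightBCF_apply, RCLike.star_def, Complex.conj_ofReal]
  rw [weightOp, inner_mulOp_left, this]

/-- The weight as an element of `L²(ℝ)`. -/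
def weightL2 : L2Line := mulOp
  (BoundedContinuousFunction.ofNormedAddCommGroup (fun s => (decay s : ℂ))
    (Complex.continuous_ofReal.comp continuous_decay) 1 fun s => by
    rw [Complex.norm_real, Real.norm_of_nonneg (decay_pos s).le]
    exact decay_le_one s) decayL2

theorem coeFn_weightL2 : weightL2 =ᵐ[volume] fun s => (weight s : ℂ) := by
  filter_upwards [coeFn_mulOp (BoundedContinuousFunction.ofNormedAddCommGroup
    (fun s => (decay s : ℂ)) (Complex.continuous_ofReal.comp continuous_decay) 1 fun s => by
    rw [Complex.norm_real, Real.norm_of_nonneg (decay_pos s).le]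
    exact decay_le_one s) decayL2, coeFn_decayL2] with s h1 h2
  rw [weightL2, h1, h2, weight]
  simp [sq]

theorem hasTemperateGrowth_weight : weight.HasTemperateGrowth := by
  have := Function.hasTemperateGrowth_one_add_norm_sq_rpow ℝ (-2)
  have e : weight = fun s : ℝ => (1 + ‖s‖ ^ 2) ^ (-2 : ℝ) := by
    funext s
    rw [weight, decay, Real.norm_eq_abs, sq_abs, Real.rpow_neg (by positivity), inv_pow]
    norm_cast
  rw [e]
  exact this

/-- Multiplication of a Schwartz function by the weight. -/
def weightSchwartz (u : 𝓢(ℝ, ℂ)) : 𝓢(ℝ, ℂ) := SchwartzMap.smulLeftCLM ℂ weight u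

theorem weightSchwartz_apply (u : 𝓢(ℝ, ℂ)) (s : ℝ) : weightSchwartz u s = weight s * u s := by
  rw [weightSchwartz, SchwartzMap.smulLeftCLM_apply_apply hasTemperateGrowth_weight,
    Complex.real_smul]

theorem weightOp_ofSchwartz (u : 𝓢(ℝ, ℂ)) :
    weightOp (ofSchwartz u) = ofSchwartz (weightSchwartz u) := by
  refine Lp.ext ?_
  filter_upwards [coeFn_weightOp (ofSchwartz u), coeFn_ofSchwartz u,
    coeFn_ofSchwartz (weightSchwartz u)] with s h1 h2 h3
  rw [h1, h2, h3, weightSchwartz_apply]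

/-- One factor `decay` per variable absorbs quadratic growth in the distance. As `weight` is the
square of `decay`, another factor per variable remains for `KernelBound`. -/
theorem sq_sub_mul_decay_le (s s' : ℝ) : (s - s') ^ 2 * (decay s * decay s') ≤ 2 := by
  rw [decay, decay, ← mul_inv, ← div_eq_mul_inv, div_le_iff₀ (by positivity)]
  nlinarith [sq_nonneg (s + s'), sq_nonneg (s * s')]

theorem abs_sub_mul_decay_le (s s' : ℝ) : |s - s'| * (decay s * decay s') ≤ 2 := by
  have h1 := sq_sub_mul_decay_le s s'
  have h2 : 0 < decay s * decay s' := mul_pos (decay_pos s) (decay_pos s')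
  have h3 : decay s * decay s' ≤ 1 := mul_le_one₀ (decay_le_one s) (decay_pos s').le (decay_le_one s')
  rw [← sq_abs] at h1
  nlinarith [sq_nonneg (|s - s'| - 1), abs_nonneg (s - s')]

/-! ### Estimates for the regular part of the resolvent kernel. -/

/-- The regular part `(exp (-δ L) - 1) / (2 δ)` of the resolvent kernel, extended to `δ = 0`. -/
def regKernel (δ L : ℝ) : ℝ := -(1 / 2) * ∫ x in (0 : ℝ)..1, L * Real.exp (-δ * L * x)

theorem regKernel_eq {δ : ℝ} (hδ : 0 < δ) (L : ℝ) :
    regKernel δ L = (2 * δ)⁻¹ * Real.exp (-δ * L) - (2 * δ)⁻¹ := by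
  rcases eq_or_ne L 0 with rfl | hL
  · simp [regKernel]
  · rw [regKernel, intervalIntegral.integral_const_mul,
      intervalIntegral.integral_comp_mul_left (fun y => Real.exp y)
        (mul_ne_zero (neg_ne_zero.2 hδ.ne') hL), integral_exp]
    simp only [smul_eq_mul, mul_one, mul_zero, Real.exp_zero]
    field_simp

theorem continuous_regKernel (δ : ℝ) : Continuous (regKernel δ) := by
  refine continuous_const.mul ?_
  exact intervalIntegral.continuous_parametric_intervalIntegral_of_continuous' (by fun_prop) 0 1

theorem abs_regKernel_le {δ L : ℝ} (hδ : 0 ≤ δ) (hL : 0 ≤ L) : |regKernel δ L| ≤ L / 2 := by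
  have := intervalIntegral.norm_integral_le_of_norm_le_const (a := 0) (b := 1) (C := L)
    (f := fun x => L * Real.exp (-δ * L * x)) fun x hx => by
      rw [Set.uIoc_of_le zero_le_one] at hx
      rw [Real.norm_of_nonneg (by positivity)]
      refine mul_le_of_le_one_right hL (Real.exp_le_one_iff.2 ?_)
      have : 0 ≤ δ * L * x := mul_nonneg (by positivity) hx.1.le
      linarith
  rw [Real.norm_eq_abs, sub_zero, abs_one, mul_one] at this
  rw [regKernel, abs_mul, abs_neg, abs_of_pos (by norm_num : (0 : ℝ) < 1 / 2)]
  linarith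

theorem abs_exp_neg_sub_le {a b : ℝ} (ha : 0 ≤ a) (hb : 0 ≤ b) :
    |Real.exp (-a) - Real.exp (-b)| ≤ |a - b| := by
  have := (convex_Ici (0 : ℝ)).norm_image_sub_le_of_norm_hasDerivWithin_le
    (f := fun x => Real.exp (-x)) (f' := fun x => -Real.exp (-x)) (C := 1) (x := b) (y := a)
    (fun x _ => by
      have := (hasDerivAt_neg x).exp
      exact (this.congr_deriv (by ring)).hasDerivWithinAt)
    (fun x hx => by
      rw [norm_neg, Real.norm_of_nonneg (Real.exp_pos _).le]
      exact Real.exp_le_one_iff.2 (by simpa using hx)) hb ha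
  simpa using this

theorem abs_regKernel_sub_le {δ δ' L : ℝ} (hδ : 0 ≤ δ) (hδ' : 0 ≤ δ') (hL : 0 ≤ L) :
    |regKernel δ L - regKernel δ' L| ≤ |δ - δ'| * L ^ 2 / 2 := by
  have hi : ∀ d : ℝ, IntervalIntegrable (fun x => L * Real.exp (-d * L * x)) volume 0 1 := fun d =>
    (by fun_prop : Continuous fun x => L * Real.exp (-d * L * x)).intervalIntegrable 0 1
  have := intervalIntegral.norm_integral_le_of_norm_le_const (a := 0) (b := 1)
    (C := |δ - δ'| * L ^ 2)
    (f := fun x => L * Real.exp (-δ * L * x) - L * Real.exp (-δ' * L * x)) fun x hx => by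
      rw [Set.uIoc_of_le zero_le_one] at hx
      have h1 := abs_exp_neg_sub_le (a := δ * L * x) (b := δ' * L * x)
        (mul_nonneg (by positivity) hx.1.le) (mul_nonneg (by positivity) hx.1.le)
      rw [← mul_sub, norm_mul, Real.norm_of_nonneg hL, Real.norm_eq_abs]
      have h2 : |δ * L * x - δ' * L * x| ≤ |δ - δ'| * L := by
        rw [← sub_mul, ← sub_mul, abs_mul, abs_mul, abs_of_nonneg hL, abs_of_pos hx.1]
        exact mul_le_of_le_one_right (by positivity) hx.2
      have h3 := h1.trans h2
      simp only [neg_mul]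
      calc _ ≤ L * (|δ - δ'| * L) := mul_le_mul_of_nonneg_left h3 hL
        _ = _ := by ring
  rw [intervalIntegral.integral_sub (hi δ) (hi δ'), Real.norm_eq_abs, sub_zero, abs_one, mul_one] at this
  rw [regKernel, regKernel, ← mul_sub, abs_mul, abs_neg, abs_of_pos (by norm_num : (0 : ℝ) < 1 / 2)]
  linarith

/-- The kernel of the regular part of the weighted resolvent. -/
def weightedReg (δ : ℝ) (p : ℝ × ℝ) : ℝ :=
  weight p.1 * weight p.2 * regKernel δ |p.1 - p.2|

theorem kernelBound_weightedReg {δ : ℝ} (hδ : 0 ≤ δ) : KernelBound (weightedReg δ) 1 where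
  measurable := by
    have h1 := continuous_weight
    have h2 := continuous_regKernel δ
    unfold weightedReg
    exact (by fun_prop : Continuous fun p : ℝ × ℝ =>
      weight p.1 * weight p.2 * regKernel δ |p.1 - p.2|).measurable
  bound p := by
    have h1 := abs_regKernel_le hδ (abs_nonneg (p.1 - p.2))
    have h2 := abs_sub_mul_decay_le p.1 p.2
    have d1 := decay_pos p.1
    have d2 := decay_pos p.2
    rw [weightedReg, abs_mul, abs_of_pos (mul_pos (weight_pos _) (weight_pos _)), weight, weight]
    calc decay p.1 ^ 2 * decay p.2 ^ 2 * |regKernel δ (|p.1 - p.2|)|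
        ≤ decay p.1 ^ 2 * decay p.2 ^ 2 * (|p.1 - p.2| / 2) := by gcongr
      _ = (|p.1 - p.2| * (decay p.1 * decay p.2)) / 2 * (decay p.1 * decay p.2) := by ring
      _ ≤ 2 / 2 * (decay p.1 * decay p.2) := by gcongr
      _ = _ := by ring

theorem abs_weightedReg_sub_le {δ δ' : ℝ} (hδ : 0 ≤ δ) (hδ' : 0 ≤ δ') (p : ℝ × ℝ) :
    |weightedReg δ p - weightedReg δ' p| ≤ |δ - δ'| * (decay p.1 * decay p.2) := by
  have h1 := abs_regKernel_sub_le hδ hδ' (abs_nonneg (p.1 - p.2))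
  have h2 := sq_sub_mul_decay_le p.1 p.2
  have d1 := decay_pos p.1
  have d2 := decay_pos p.2
  rw [weightedReg, weightedReg, ← mul_sub, abs_mul,
    abs_of_pos (mul_pos (weight_pos _) (weight_pos _)), weight, weight]
  rw [sq_abs] at h1
  calc decay p.1 ^ 2 * decay p.2 ^ 2 * |regKernel δ (|p.1 - p.2|) - regKernel δ' (|p.1 - p.2|)|
      ≤ decay p.1 ^ 2 * decay p.2 ^ 2 * (|δ - δ'| * (p.1 - p.2) ^ 2 / 2) := by gcongr
    _ = |δ - δ'| * ((p.1 - p.2) ^ 2 * (decay p.1 * decay p.2)) / 2 * (decay p.1 * decay p.2) := by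
        ring
    _ ≤ |δ - δ'| * 2 / 2 * (decay p.1 * decay p.2) := by gcongr
    _ = _ := by ring

theorem weightedReg_swap (δ : ℝ) (p : ℝ × ℝ) : weightedReg δ p.swap = weightedReg δ p := by
  simp only [weightedReg, Prod.fst_swap, Prod.snd_swap]
  rw [abs_sub_comm]
  ring

theorem inner_weightL2_ofSchwartz (u : 𝓢(ℝ, ℂ)) :
    inner ℂ weightL2 (ofSchwartz u) = ∫ s, weightSchwartz u s := by
  rw [inner_L2Line]
  refine integral_congr_ae ?_
  filter_upwards [coeFn_weightL2, coeFn_ofSchwartz u] with s h1 h2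
  rw [h1, h2, Complex.conj_ofReal, weightSchwartz_apply]

/-- The kernel e^{-δL}/(2δ) is the constant 1/(2δ) plus `regKernel`, and a constant kernel between
two weights is a rank one operator. -/
theorem weighted_resolvent {δ : ℝ} (hδ : 0 < δ) (f : L2Line) :
    weightOp (fourierMul (resolventSymbol hδ) (weightOp f))
      = (((2 * δ)⁻¹ : ℝ) : ℂ) • (inner ℂ weightL2 f • weightL2) + kernelOp (weightedReg δ) f := by
  have hKB := kernelBound_weightedReg hδ.le
  suffices h : weightOp ∘L fourierMul (resolventSymbol hδ) ∘L weightOp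
      = (((2 * δ)⁻¹ : ℝ) : ℂ) • ((innerSL ℂ weightL2).smulRight weightL2)
        + kernelOp (weightedReg δ) by
    have := congrArg (fun T : L2Line →L[ℂ] L2Line => T f) h
    simpa using this
  refine continuousLinearMap_ext_of_inner_ofSchwartz fun u v => ?_
  change inner ℂ (ofSchwartz v) (weightOp (fourierMul (resolventSymbol hδ) (weightOp (ofSchwartz u))))
    = inner ℂ (ofSchwartz v) ((((2 * δ)⁻¹ : ℝ) : ℂ) • (inner ℂ weightL2 (ofSchwartz u) • weightL2)
      + kernelOp (weightedReg δ) (ofSchwartz u))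
  rw [← inner_weightOp_left, weightOp_ofSchwartz, weightOp_ofSchwartz,
    inner_resolvent_ofSchwartz, inner_add_right, hKB.inner_kernelOp_ofSchwartz, inner_smul_right,
    inner_smul_right, ← inner_conj_symm (ofSchwartz v), inner_weightL2_ofSchwartz,
    inner_weightL2_ofSchwartz, mul_comm (∫ s, weightSchwartz u s), ← integral_conj,
    ← integral_prod_mul, ← Measure.volume_eq_prod, ← integral_const_mul]
  have hi1 : Integrable fun p : ℝ × ℝ => (((2 * δ)⁻¹ : ℝ) : ℂ) *
      (starRingEnd ℂ (weightSchwartz v p.1) * weightSchwartz u p.2) :=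
    (Integrable.mul_prod
      (Complex.conjLIE.toContinuousLinearEquiv.toContinuousLinearMap.integrable_comp
        (weightSchwartz v).integrable) (weightSchwartz u).integrable).const_mul _
  have hi2 : Integrable fun p : ℝ × ℝ => (weightedReg δ p : ℂ) *
      (starRingEnd ℂ (v p.1) * u p.2) := by
    refine (hKB.integrable (ofSchwartz u) (ofSchwartz v)).congr ?_
    filter_upwards [ae_fst (coeFn_ofSchwartz v), ae_snd (coeFn_ofSchwartz u)] with p h1 h2
    rw [h1, h2]
  rw [← integral_add hi1 hi2]
  refine integral_congr_ae (Eventually.of_forall fun p => ?_)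
  simp only [weightedReg, regKernel_eq hδ, weightSchwartz_apply, map_mul, Complex.conj_ofReal]
  push_cast
  ring

/-! ### The regular part of the weighted inverse -/

/-- The spectral parameter `√(α² / 4 + δ²)`. -/
def kap (α δ : ℝ) : ℝ := √(α ^ 2 / 4 + δ ^ 2)

theorem kap_sq (α δ : ℝ) : kap α δ ^ 2 = α ^ 2 / 4 + δ ^ 2 := Real.sq_sqrt (by positivity)

theorem half_le_kap (α δ : ℝ) : α / 2 ≤ kap α δ :=
  Real.le_sqrt_of_sq_le (by nlinarith [sq_nonneg δ])

theorem kap_pos {α : ℝ} (hα : 0 < α) (δ : ℝ) : 0 < kap α δ :=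
  (half_pos hα).trans_le (half_le_kap α δ)

theorem abs_kap_sub_le {α δ δ' : ℝ} (hα : 0 < α) (hδ : 0 ≤ δ) (hδ' : 0 ≤ δ') :
    |kap α δ - kap α δ'| ≤ |δ - δ'| := by
  have h1 := kap_sq α δ
  have h2 := kap_sq α δ'
  have h3 : δ ≤ kap α δ := Real.le_sqrt_of_sq_le (by nlinarith [sq_nonneg α])
  have h4 : δ' ≤ kap α δ' := Real.le_sqrt_of_sq_le (by nlinarith [sq_nonneg α])
  have p1 := kap_pos hα δ
  have p2 := kap_pos hα δ'
  have h6 : |kap α δ - kap α δ'| * (kap α δ + kap α δ') = |δ - δ'| * (δ + δ') := by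
    rw [← abs_of_pos (add_pos p1 p2), ← abs_mul,
      ← abs_of_nonneg (add_nonneg hδ hδ'), ← abs_mul]
    congr 1
    linear_combination h1 - h2
  by_contra hcon
  nlinarith [abs_nonneg (δ - δ')]

/-- The regular part of the weighted inverse of `1 - α lineOp`. -/
def regOp {α : ℝ} (hα : 0 < α) (δ : ℝ) : L2Line →L[ℂ] L2Line :=
  weightOp * fourierMul (regularSymbol hα (kap_pos hα δ)) * weightOp
    + ((α ^ 2 / 2 : ℝ) : ℂ) • kernelOp (weightedReg δ)

theorem regOp_apply {α : ℝ} (hα : 0 < α) (δ : ℝ) (f : L2Line) :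
    regOp hα δ f = weightOp (fourierMul (regularSymbol hα (kap_pos hα δ)) (weightOp f))
      + ((α ^ 2 / 2 : ℝ) : ℂ) • kernelOp (weightedReg δ) f := rfl

/-- All that diverges as δ → 0 is of rank one, with coefficient α²/2 times 1/(2δ). The remainder
`regOp` also makes sense at δ = 0, so the later scalar equation extends to the closed half-line. -/
theorem weighted_lineInv {α δ : ℝ} (hα : 0 < α) (hδ : 0 < δ) (f : L2Line) :
    weightOp (lineInv hα hδ (kap_pos hα δ) (weightOp f))
      = ((α ^ 2 / (4 * δ) : ℝ) : ℂ) • (inner ℂ weightL2 f • weightL2) + regOp hα δ f := by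
  have e : lineInv hα hδ (kap_pos hα δ) (weightOp f)
      = fourierMul (regularSymbol hα (kap_pos hα δ)) (weightOp f)
        + ((α ^ 2 / 2 : ℝ) : ℂ) • fourierMul (resolventSymbol hδ) (weightOp f) := by
    rw [lineInv, fourierMul_add, fourierMul_smul]
    rfl
  rw [e, map_add, map_smul, weighted_resolvent, regOp_apply, smul_add, smul_smul, ← add_assoc,
    add_comm (weightOp _), add_assoc]
  congr 2
  rw [← Complex.ofReal_mul]
  congr 1
  field_simp
  norm_num

theorem inner_regOp_left {α δ : ℝ} (hα : 0 < α) (hδ : 0 ≤ δ) (f g : L2Line) :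
    inner ℂ (regOp hα δ f) g = inner ℂ f (regOp hα δ g) := by
  rw [regOp_apply, regOp_apply, inner_add_left, inner_add_right, inner_weightOp_left,
    inner_fourierMul_left, inner_weightOp_left, star_regularSymbol, inner_smul_left,
    inner_smul_right, (kernelBound_weightedReg hδ).inner_kernelOp_left (weightedReg_swap δ),
    Complex.conj_ofReal]

theorem norm_regOp_le {α δ : ℝ} (hα : 0 < α) (hδ : 0 ≤ δ) :
    ‖regOp hα δ‖ ≤ 2 + α ^ 2 / 2 * ‖decayL2‖ ^ 2 := by
  refine (norm_add_le _ _).trans (add_le_add ?_ ?_)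
  · calc _ ≤ ‖weightOp‖ * ‖fourierMul (regularSymbol hα (kap_pos hα δ))‖ * ‖weightOp‖ :=
          (norm_mul_le _ _).trans (mul_le_mul_of_nonneg_right (norm_mul_le _ _) (norm_nonneg _))
      _ ≤ 1 * 2 * 1 := by
          have := norm_weightOp_le
          have := (norm_fourierMul_le _).trans (norm_regularSymbol_le hα (kap_pos hα δ))
          gcongr
      _ = 2 := by norm_num
  · rw [norm_smul, Complex.norm_real, Real.norm_of_nonneg (by positivity)]
    have := (kernelBound_weightedReg hδ).norm_kernelOp_le
    rw [one_mul] at this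
    gcongr

theorem norm_regOp_sub_le {α δ δ' : ℝ} (hα : 0 < α) (hδ : 0 ≤ δ) (hδ' : 0 ≤ δ') :
    ‖regOp hα δ - regOp hα δ'‖ ≤ (2 / α + α ^ 2 / 2 * ‖decayL2‖ ^ 2) * |δ - δ'| := by
  have e : regOp hα δ - regOp hα δ' = weightOp * (fourierMul (regularSymbol hα (kap_pos hα δ)
      - regularSymbol hα (kap_pos hα δ'))) * weightOp
      + ((α ^ 2 / 2 : ℝ) : ℂ) • (kernelOp (weightedReg δ) - kernelOp (weightedReg δ')) := by
    rw [regOp, regOp, fourierMul_sub, mul_sub, sub_mul, smul_sub]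
    abel
  rw [e, add_mul]
  refine (norm_add_le _ _).trans (add_le_add ?_ ?_)
  · calc _ ≤ ‖weightOp‖ * ‖fourierMul (regularSymbol hα (kap_pos hα δ)
          - regularSymbol hα (kap_pos hα δ'))‖ * ‖weightOp‖ :=
          (norm_mul_le _ _).trans (mul_le_mul_of_nonneg_right (norm_mul_le _ _) (norm_nonneg _))
      _ ≤ 1 * (2 / α * |δ - δ'|) * 1 := by
          have := norm_weightOp_le
          have h1 := (norm_fourierMul_le _).trans
            (norm_regularSymbol_sub_le hα (kap_pos hα δ) (kap_pos hα δ'))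
          have h2 := abs_kap_sub_le hα hδ hδ'
          have h3 : 2 / α * |kap α δ - kap α δ'| ≤ 2 / α * |δ - δ'| := by gcongr
          have h4 := h1.trans h3
          gcongr
      _ = _ := by ring
  · rw [norm_smul, Complex.norm_real, Real.norm_of_nonneg (by positivity), mul_assoc]
    have := (kernelBound_weightedReg hδ).norm_kernelOp_sub_le (kernelBound_weightedReg hδ')
      (abs_weightedReg_sub_le hδ hδ')
    rw [mul_comm (|δ - δ'|)] at this
    gcongr

end LeakyWire
end

noncomputable section

namespace LeakyWire

/-! ### Weakly bent curves -/

/-- A bounded angle function that is constant outside `[-S, S]`. -/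
structure IsProfile (Φ : ℝ → ℝ) (M S : ℝ) : Prop where
  measurable : Measurable Φ
  bound : ∀ u, |Φ u| ≤ M
  pos : 0 < S
  right : ∀ u, S ≤ u → Φ u = Φ S
  left : ∀ u, u ≤ -S → Φ u = Φ (-S)

/-- The curve with tangent angle `β Φ`. -/
def profileCurve (Φ : ℝ → ℝ) (β s : ℝ) : Plane :=
  !₂[∫ u in (0 : ℝ)..s, Real.cos (β * Φ u), ∫ u in (0 : ℝ)..s, Real.sin (β * Φ u)]

/-- The distance of two points of the curve with tangent angle `β Φ`. -/
def chord (Φ : ℝ → ℝ) (β s s' : ℝ) : ℝ := ‖profileCurve Φ β s - profileCurve Φ β s'‖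

section Chord

variable {Φ : ℝ → ℝ} {M S : ℝ}

theorem intervalIntegrable_of_bounded {f : ℝ → ℝ} (hf : Measurable f) {C : ℝ}
    (h : ∀ u, |f u| ≤ C) (a b : ℝ) : IntervalIntegrable f volume a b := by
  rw [intervalIntegrable_iff]
  exact Measure.integrableOn_of_bounded (M := C) (by simp) hf.aestronglyMeasurable
    (Eventually.of_forall h)

theorem intervalIntegrable_cos (hΦ : Measurable Φ) (β a b : ℝ) :
    IntervalIntegrable (fun u => Real.cos (β * Φ u)) volume a b :=
  intervalIntegrable_of_bounded (Real.measurable_cos.comp (hΦ.const_mul β))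
    (fun _ => Real.abs_cos_le_one _) a b

theorem intervalIntegrable_sin (hΦ : Measurable Φ) (β a b : ℝ) :
    IntervalIntegrable (fun u => Real.sin (β * Φ u)) volume a b :=
  intervalIntegrable_of_bounded (Real.measurable_sin.comp (hΦ.const_mul β))
    (fun _ => Real.abs_sin_le_one _) a b

theorem continuous_profileCurve (hΦ : Measurable Φ) (β : ℝ) : Continuous (profileCurve Φ β) := by
  have h1 := intervalIntegral.continuous_primitive (fun a b => intervalIntegrable_cos hΦ β a b) 0
  have h2 := intervalIntegral.continuous_primitive (fun a b => intervalIntegrable_sin hΦ β a b) 0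
  refine (PiLp.continuous_toLp 2 _).comp (continuous_pi fun i => ?_)
  fin_cases i
  · exact h1
  · exact h2

theorem profileCurve_sub_apply_zero (hΦ : Measurable Φ) (β s s' : ℝ) :
    (profileCurve Φ β s - profileCurve Φ β s') 0 = ∫ u in s'..s, Real.cos (β * Φ u) := by
  rw [← intervalIntegral.integral_interval_sub_left (intervalIntegrable_cos hΦ β 0 s)
    (intervalIntegrable_cos hΦ β 0 s')]
  rfl

theorem profileCurve_sub_apply_one (hΦ : Measurable Φ) (β s s' : ℝ) :
    (profileCurve Φ β s - profileCurve Φ β s') 1 = ∫ u in s'..s, Real.sin (β * Φ u) := by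
  rw [← intervalIntegral.integral_interval_sub_left (intervalIntegrable_sin hΦ β 0 s)
    (intervalIntegrable_sin hΦ β 0 s')]
  rfl

theorem chord_sq (hΦ : Measurable Φ) (β s s' : ℝ) :
    chord Φ β s s' ^ 2 = (∫ u in s'..s, Real.cos (β * Φ u)) ^ 2
      + (∫ u in s'..s, Real.sin (β * Φ u)) ^ 2 := by
  rw [chord, norm_sq_plane, profileCurve_sub_apply_zero hΦ, profileCurve_sub_apply_one hΦ]

theorem chord_nonneg (Φ : ℝ → ℝ) (β s s' : ℝ) : 0 ≤ chord Φ β s s' := norm_nonneg _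

theorem chord_comm (Φ : ℝ → ℝ) (β s s' : ℝ) : chord Φ β s s' = chord Φ β s' s := norm_sub_rev _ _

theorem chord_self (Φ : ℝ → ℝ) (β s : ℝ) : chord Φ β s s = 0 := by simp [chord]

theorem continuous_chord (hΦ : Measurable Φ) (β : ℝ) :
    Continuous fun p : ℝ × ℝ => chord Φ β p.1 p.2 := by
  have := continuous_profileCurve hΦ β
  unfold chord
  fun_prop

/-- Seen in the complex plane, the chord is the modulus of the integral of the unit vectors e^{iβΦ}.
-/
theorem chord_le (hΦ : Measurable Φ) (β s s' : ℝ) : chord Φ β s s' ≤ |s - s'| := by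
  have e : ((∫ u in s'..s, Real.cos (β * Φ u) : ℝ) : ℂ)
      + ((∫ u in s'..s, Real.sin (β * Φ u) : ℝ) : ℂ) * Complex.I
      = ∫ u in s'..s, Complex.exp ((β * Φ u : ℝ) * Complex.I) := by
    rw [← intervalIntegral.integral_ofReal, ← intervalIntegral.integral_ofReal,
      ← intervalIntegral.integral_mul_const, ← intervalIntegral.integral_add]
    · refine intervalIntegral.integral_congr fun u _ => ?_
      rw [Complex.exp_mul_I]
      push_cast
      rfl
    · exact ⟨(intervalIntegrable_cos hΦ β s' s).1.ofReal, (intervalIntegrable_cos hΦ β s' s).2.ofReal⟩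
    · exact IntervalIntegrable.mul_const ⟨(intervalIntegrable_sin hΦ β s' s).1.ofReal,
        (intervalIntegrable_sin hΦ β s' s).2.ofReal⟩ _
  have h2 : ‖∫ u in s'..s, Complex.exp ((β * Φ u : ℝ) * Complex.I)‖ ≤ 1 * |s - s'| :=
    intervalIntegral.norm_integral_le_of_norm_le_const fun u _ =>
      (Complex.norm_exp_ofReal_mul_I _).le
  rw [one_mul, ← e] at h2
  have h3 : chord Φ β s s' ^ 2 ≤ |s - s'| ^ 2 := by
    rw [chord_sq hΦ]
    calc _ = ‖((∫ u in s'..s, Real.cos (β * Φ u) : ℝ) : ℂ)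
      + ((∫ u in s'..s, Real.sin (β * Φ u) : ℝ) : ℂ) * Complex.I‖ ^ 2 := by
          rw [Complex.sq_norm, Complex.normSq_apply]
          simp
          ring
      _ ≤ _ := by gcongr
  exact le_of_sq_le_sq h3 (abs_nonneg _)

theorem abs_apply_le_norm (x : Plane) (i : Fin 2) : |x i| ≤ ‖x‖ := by
  simpa using PiLp.norm_apply_le x i

/-- From cos x ≥ 1 - x²/2: a weakly bent curve keeps advancing in the first coordinate. -/
theorem le_profileCurve_sub (h : IsProfile Φ M S) (β : ℝ) {s s' : ℝ} (hs : s' ≤ s) :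
    (1 - β ^ 2 * M ^ 2 / 2) * (s - s') ≤ (profileCurve Φ β s - profileCurve Φ β s') 0 := by
  rw [profileCurve_sub_apply_zero h.measurable]
  have := intervalIntegral.integral_mono_on (f := fun _ => 1 - β ^ 2 * M ^ 2 / 2)
    (g := fun u => Real.cos (β * Φ u)) hs (by simp) (intervalIntegrable_cos h.measurable β s' s)
    (fun u _ => by
      have h1 := Real.one_sub_sq_div_two_le_cos (x := β * Φ u)
      have h2 : Φ u ^ 2 ≤ M ^ 2 := sq_le_sq' (abs_le.1 (h.bound u)).1 (abs_le.1 (h.bound u)).2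
      nlinarith [mul_le_mul_of_nonneg_left h2 (sq_nonneg β)])
  rw [intervalIntegral.integral_const, smul_eq_mul] at this
  linarith

theorem le_chord (h : IsProfile Φ M S) (β s s' : ℝ) :
    (1 - β ^ 2 * M ^ 2 / 2) * |s - s'| ≤ chord Φ β s s' := by
  have key : ∀ {s s' : ℝ}, s' ≤ s → (1 - β ^ 2 * M ^ 2 / 2) * |s - s'| ≤ chord Φ β s s' := by
    intro s s' hs
    rw [abs_of_nonneg (sub_nonneg.2 hs)]
    exact (le_profileCurve_sub h β hs).trans ((le_abs_self _).trans (abs_apply_le_norm _ 0))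
  rcases le_total s' s with hs | hs
  · exact key hs
  · rw [abs_sub_comm, chord_comm]
    exact key hs

theorem half_le_chord (h : IsProfile Φ M S) {β : ℝ} (hβ : β ^ 2 * M ^ 2 ≤ 1) (s s' : ℝ) :
    |s - s'| / 2 ≤ chord Φ β s s' := by
  refine le_trans ?_ (le_chord h β s s')
  nlinarith [abs_nonneg (s - s')]

theorem chord_eq_of_const (hΦ : Measurable Φ) (β : ℝ) {s s' c : ℝ} (hs : s' ≤ s)
    (hc : ∀ u ∈ Set.Icc s' s, Φ u = c) : chord Φ β s s' = |s - s'| := by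
  have h1 : ∫ u in s'..s, Real.cos (β * Φ u) = (s - s') * Real.cos (β * c) := by
    rw [intervalIntegral.integral_congr (g := fun _ => Real.cos (β * c))]
    · simp
    · intro u hu
      rw [Set.uIcc_of_le hs] at hu
      simp only [hc u hu]
  have h2 : ∫ u in s'..s, Real.sin (β * Φ u) = (s - s') * Real.sin (β * c) := by
    rw [intervalIntegral.integral_congr (g := fun _ => Real.sin (β * c))]
    · simp
    · intro u hu
      rw [Set.uIcc_of_le hs] at hu
      simp only [hc u hu]
  have h3 : chord Φ β s s' ^ 2 = |s - s'| ^ 2 := by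
    rw [chord_sq hΦ, h1, h2, sq_abs, mul_pow, mul_pow, ← mul_add, Real.cos_sq_add_sin_sq, mul_one]
  exact (sq_eq_sq₀ (chord_nonneg _ _ _ _) (abs_nonneg _)).1 h3

/-- Either both points lie on one straight end, where chord and arc agree, or neither end contains
both and |s| + |s'| is controlled by the distance. Decay in |s - s'| thereby becomes decay in each
variable. -/
theorem chord_eq_or (h : IsProfile Φ M S) (β s s' : ℝ) :
    chord Φ β s s' = |s - s'| ∨ |s| + |s'| - 4 * S ≤ |s - s'| := by
  have hS := h.pos
  have key : ∀ {s s' : ℝ}, s' ≤ s →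
      (chord Φ β s s' = |s - s'| ∨ |s| + |s'| - 4 * S ≤ |s - s'|) := by
    intro s s' hs
    by_cases h1 : S ≤ s'
    · exact Or.inl (chord_eq_of_const h.measurable β hs fun u hu => h.right u (h1.trans hu.1))
    by_cases h2 : s ≤ -S
    · exact Or.inl (chord_eq_of_const h.measurable β hs fun u hu => h.left u (hu.2.trans h2))
    · refine Or.inr ?_
      push Not at h1 h2
      rw [abs_of_nonneg (sub_nonneg.2 hs)]
      rcases abs_cases s with ⟨e1, _⟩ | ⟨e1, _⟩ <;> rcases abs_cases s' with ⟨e2, _⟩ | ⟨e2, _⟩ <;>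
        rw [e1, e2] <;> linarith
  rcases le_total s' s with hs | hs
  · exact key hs
  · rw [abs_sub_comm, chord_comm, add_comm |s|]
    exact key hs

end Chord

/-! ### The perturbation kernel -/

/-- The difference of the Birman–Schwinger kernels of the bent curve and of the line. -/
def bentKernel (Φ : ℝ → ℝ) (β κ : ℝ) (p : ℝ × ℝ) : ℝ :=
  green κ (chord Φ β p.1 p.2) - green κ |p.1 - p.2|

theorem one_add_mul_exp_neg_le (y : ℝ) :
    (1 + y) * Real.exp (-y) ≤ 2 * Real.exp (-(y / 2)) := by
  have h1 := Real.add_one_le_exp (y / 2)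
  have h2 : Real.exp (-(y / 2)) = Real.exp (y / 2) * Real.exp (-y) := by
    rw [← Real.exp_add]; congr 1; ring
  rw [h2, ← mul_assoc]
  exact mul_le_mul_of_nonneg_right (by linarith) (Real.exp_pos _).le

theorem mul_macdonaldK1_le {y : ℝ} (hy : 0 < y) : y * macdonaldK1 y ≤ 2 * Real.exp (-(y / 2)) := by
  refine le_trans (mul_le_mul_of_nonneg_left (macdonaldK1_le hy) hy.le) ?_
  refine le_trans (le_of_eq ?_) (one_add_mul_exp_neg_le y)
  field_simp

/-- Bound 1 + |s| by a multiple of e^{a|s|/6} and take sixth powers. Three factors `decay` are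
needed: two are lost when dividing by the weight and one must remain. -/
theorem exp_neg_abs_le_decay {a : ℝ} (ha : 0 < a) (s : ℝ) :
    Real.exp (-a * |s|) ≤ (1 + 6 / a) ^ 6 * decay s ^ 3 := by
  have h1 : 1 + |s| ≤ (1 + 6 / a) * Real.exp (a * |s| / 6) := by
    have := Real.add_one_le_exp (a * |s| / 6)
    calc 1 + |s| ≤ (1 + 6 / a) * (a * |s| / 6 + 1) := by
          have e : (1 + 6 / a) * (a * |s| / 6 + 1) = 1 + |s| + (a * |s| / 6 + 6 / a) := by
            field_simp
            ring
          rw [e]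
          have : 0 ≤ a * |s| / 6 + 6 / a := by positivity
          linarith
      _ ≤ _ := by gcongr
  have h2 : (1 + s ^ 2) ^ 3 ≤ (1 + 6 / a) ^ 6 * Real.exp (a * |s|) := by
    calc (1 + s ^ 2) ^ 3 ≤ ((1 + |s|) ^ 2) ^ 3 := by
          gcongr
          rw [← sq_abs s]
          nlinarith [abs_nonneg s]
      _ ≤ (((1 + 6 / a) * Real.exp (a * |s| / 6)) ^ 2) ^ 3 := by gcongr
      _ = _ := by
          rw [← pow_mul, mul_pow, ← Real.exp_nat_mul]
          congr 2
          push_cast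
          ring
  have h3 : decay s ^ 3 = ((1 + s ^ 2) ^ 3)⁻¹ := by rw [decay, inv_pow]
  rw [h3, neg_mul, Real.exp_neg, ← div_eq_mul_inv, le_div_iff₀ (by positivity),
    inv_mul_le_iff₀ (Real.exp_pos _), mul_comm (Real.exp _)]
  exact h2

/-- The constant in the bounds of the perturbation kernel. -/
def bentConst (α M S : ℝ) : ℝ :=
  M ^ 2 * (2 + 8 / α) * Real.exp (4 * (α / 16) * S) * ((1 + 6 / (α / 16)) ^ 6) ^ 2

theorem bentConst_nonneg {α : ℝ} (hα : 0 < α) (M S : ℝ) : 0 ≤ bentConst α M S := by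
  unfold bentConst
  positivity

section Bounds

variable {Φ : ℝ → ℝ} {M S α : ℝ}

theorem bentKernel_self (Φ : ℝ → ℝ) (β κ s : ℝ) : bentKernel Φ β κ (s, s) = 0 := by
  simp [bentKernel, chord_self]

theorem two_pi_inv_le_one : (2 * Real.pi)⁻¹ ≤ 1 :=
  inv_le_one_of_one_le₀ (by linarith [Real.pi_gt_three])

theorem exp_neg_sub_le {a L x y S : ℝ} (ha : 0 < a) (h : x + y - 4 * S ≤ L) :
    Real.exp (-a * L) ≤ Real.exp (4 * a * S) * (Real.exp (-a * x) * Real.exp (-a * y)) := by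
  rw [← Real.exp_add, ← Real.exp_add]
  refine Real.exp_le_exp.2 ?_
  nlinarith

/-- Reduction of kernel bounds to exponential bounds in the distance. -/
theorem bound_of_exp_bound (h : IsProfile Φ M S) (hα : 0 < α) {β c x : ℝ} {p : ℝ × ℝ}
    (hc : 0 ≤ c) (hx0 : chord Φ β p.1 p.2 = |p.1 - p.2| → x = 0)
    (hx : x ≤ M ^ 2 * (2 + 8 / α) * c * Real.exp (-(α / 16) * |p.1 - p.2|)) :
    x ≤ bentConst α M S * c * (decay p.1 ^ 3 * decay p.2 ^ 3) := by
  have d1 := decay_pos p.1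
  have d2 := decay_pos p.2
  rcases chord_eq_or h β p.1 p.2 with h1 | h1
  · rw [hx0 h1]
    have := bentConst_nonneg hα M S
    positivity
  · have ha : 0 < α / 16 := by positivity
    have e1 := exp_neg_abs_le_decay ha p.1
    have e2 := exp_neg_abs_le_decay ha p.2
    have e3 := exp_neg_sub_le ha h1
    calc x ≤ M ^ 2 * (2 + 8 / α) * c * Real.exp (-(α / 16) * |p.1 - p.2|) := hx
      _ ≤ M ^ 2 * (2 + 8 / α) * c * (Real.exp (4 * (α / 16) * S) *
          (Real.exp (-(α / 16) * |p.1|) * Real.exp (-(α / 16) * |p.2|))) := by gcongr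
      _ ≤ M ^ 2 * (2 + 8 / α) * c * (Real.exp (4 * (α / 16) * S) *
          (((1 + 6 / (α / 16)) ^ 6 * decay p.1 ^ 3) * ((1 + 6 / (α / 16)) ^ 6 * decay p.2 ^ 3))) := by
          gcongr
      _ = _ := by rw [bentConst]; ring

theorem bentKernel_eq_zero_of_chord {β κ : ℝ} {p : ℝ × ℝ}
    (h : chord Φ β p.1 p.2 = |p.1 - p.2|) : bentKernel Φ β κ p = 0 := by
  rw [bentKernel, h, sub_self]

theorem sub_chord_le (h : IsProfile Φ M S) (β s s' : ℝ) :
    |s - s'| - chord Φ β s s' ≤ β ^ 2 * M ^ 2 / 2 * |s - s'| := by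
  have := le_chord h β s s'
  linarith

/-- Bending brings points closer together and the Green function decreases; this sign is the source
of the bound state. -/
theorem bentKernel_nonneg (h : IsProfile Φ M S) {β κ : ℝ} (hβ : β ^ 2 * M ^ 2 ≤ 1) (hκ : 0 < κ)
    (p : ℝ × ℝ) : 0 ≤ bentKernel Φ β κ p := by
  rcases eq_or_ne p.1 p.2 with he | he
  · rw [show p = (p.1, p.1) from Prod.ext rfl he.symm, bentKernel_self]
  · have hL : 0 < |p.1 - p.2| := abs_pos.2 (sub_ne_zero.2 he)
    have hr : 0 < chord Φ β p.1 p.2 := (half_pos hL).trans_le (half_le_chord h hβ _ _)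
    exact sub_nonneg.2 (green_anti hκ hr (chord_le h.measurable β _ _))

/-- With L the arc length and r the chord, K₀(κr) - K₀(κL) ≤ κ(L - r) K₁(κr), and L - r ≤ β²M² r
because L ≤ 2r. Since y K₁(y) ≤ 2e^{-y/2}, the singularity on the diagonal cancels. The exponent α/8
available here is weakened to α/16, which the Lipschitz estimate in κ requires. -/
theorem abs_bentKernel_le (h : IsProfile Φ M S) (hα : 0 < α) {β κ : ℝ} (hβ : β ^ 2 * M ^ 2 ≤ 1)
    (hκ : α / 2 ≤ κ) (p : ℝ × ℝ) :
    |bentKernel Φ β κ p| ≤ bentConst α M S * β ^ 2 * (decay p.1 ^ 3 * decay p.2 ^ 3) := by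
  have hκ0 : 0 < κ := (half_pos hα).trans_le hκ
  refine bound_of_exp_bound h hα (sq_nonneg β)
    (fun e => by rw [bentKernel_eq_zero_of_chord e, abs_zero]) ?_
  rw [abs_of_nonneg (bentKernel_nonneg h hβ hκ0 p)]
  rcases eq_or_ne p.1 p.2 with he | he
  · rw [show p = (p.1, p.1) from Prod.ext rfl he.symm, bentKernel_self]
    positivity
  have hL : 0 < |p.1 - p.2| := abs_pos.2 (sub_ne_zero.2 he)
  have hhalf := half_le_chord h hβ p.1 p.2
  have hle := chord_le h.measurable β p.1 p.2
  have hsub := sub_chord_le h β p.1 p.2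
  rw [bentKernel]
  set L := |p.1 - p.2| with hLdef
  set r := chord Φ β p.1 p.2 with hrdef
  have hr : 0 < r := (half_pos hL).trans_le hhalf
  have h1 : macdonaldK0 (κ * r) - macdonaldK0 (κ * L) ≤ (κ * L - κ * r) * macdonaldK1 (κ * r) :=
    macdonaldK0_sub_le (by positivity) (by gcongr)
  have hK := macdonaldK1_pos (mul_pos hκ0 hr)
  have h2 : (κ * L - κ * r) * macdonaldK1 (κ * r) ≤ M ^ 2 * β ^ 2 * ((κ * r) * macdonaldK1 (κ * r)) := by
    rw [← mul_assoc]
    refine mul_le_mul_of_nonneg_right ?_ hK.le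
    have : β ^ 2 * M ^ 2 / 2 * L ≤ β ^ 2 * M ^ 2 * r := by
      nlinarith [mul_nonneg (sq_nonneg β) (sq_nonneg M)]
    calc κ * L - κ * r = κ * (L - r) := by ring
      _ ≤ κ * (β ^ 2 * M ^ 2 * r) := by gcongr; linarith
      _ = _ := by ring
  have h3 := mul_macdonaldK1_le (mul_pos hκ0 hr)
  have h4 : Real.exp (-(κ * r / 2)) ≤ Real.exp (-(α / 16) * L) := by
    refine Real.exp_le_exp.2 ?_
    have : α / 2 * (L / 2) ≤ κ * r := mul_le_mul hκ hhalf (by positivity) hκ0.le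
    have : 0 < α * L := by positivity
    linarith
  have h5 : 0 ≤ macdonaldK0 (κ * r) - macdonaldK0 (κ * L) :=
    sub_nonneg.2 (macdonaldK0_anti (by positivity) (by gcongr))
  calc green κ r - green κ L = (2 * Real.pi)⁻¹ * (macdonaldK0 (κ * r) - macdonaldK0 (κ * L)) := by
        rw [green, green]; ring
    _ ≤ 1 * (macdonaldK0 (κ * r) - macdonaldK0 (κ * L)) :=
        mul_le_mul_of_nonneg_right two_pi_inv_le_one h5
    _ ≤ M ^ 2 * β ^ 2 * (2 * Real.exp (-(κ * r / 2))) := by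
        rw [one_mul]
        exact h1.trans (h2.trans (by gcongr))
    _ ≤ M ^ 2 * β ^ 2 * (2 * Real.exp (-(α / 16) * L)) := by gcongr
    _ = M ^ 2 * 2 * β ^ 2 * Real.exp (-(α / 16) * L) := by ring
    _ ≤ _ := by
        gcongr
        have : 0 < 8 / α := by positivity
        linarith

/-- The same argument with the mixed difference of K₀. There K₁ is taken at half of (α/2)r, which
costs the factor 4/α and leaves the exponent α/16. -/
theorem abs_bentKernel_sub_le (h : IsProfile Φ M S) (hα : 0 < α) {β κ κ' : ℝ}
    (hβ : β ^ 2 * M ^ 2 ≤ 1) (hκ : α / 2 ≤ κ) (hκ' : α / 2 ≤ κ') (p : ℝ × ℝ) :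
    |bentKernel Φ β κ p - bentKernel Φ β κ' p|
      ≤ bentConst α M S * (β ^ 2 * |κ - κ'|) * (decay p.1 ^ 3 * decay p.2 ^ 3) := by
  refine bound_of_exp_bound h hα (by positivity)
    (fun e => by rw [bentKernel_eq_zero_of_chord e, bentKernel_eq_zero_of_chord e, sub_zero, abs_zero])
    ?_
  rcases eq_or_ne p.1 p.2 with he | he
  · rw [show p = (p.1, p.1) from Prod.ext rfl he.symm, bentKernel_self, bentKernel_self, sub_zero,
      abs_zero]
    positivity
  have hL : 0 < |p.1 - p.2| := abs_pos.2 (sub_ne_zero.2 he)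
  have hhalf := half_le_chord h hβ p.1 p.2
  have hle := chord_le h.measurable β p.1 p.2
  have hsub := sub_chord_le h β p.1 p.2
  rw [bentKernel, bentKernel]
  set L := |p.1 - p.2| with hLdef
  set r := chord Φ β p.1 p.2 with hrdef
  have hr : 0 < r := (half_pos hL).trans_le hhalf
  have hy : 0 < α / 2 * r / 2 := by positivity
  have h1 := abs_macdonaldK0_mixed_sub_le (half_pos hα) hκ hκ' hr hle
  have hK := macdonaldK1_pos hy
  have h2 : (L - r) * macdonaldK1 (α / 2 * r / 2)
      ≤ M ^ 2 * β ^ 2 * (4 / α) * ((α / 2 * r / 2) * macdonaldK1 (α / 2 * r / 2)) := by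
    rw [← mul_assoc]
    refine mul_le_mul_of_nonneg_right ?_ hK.le
    have : β ^ 2 * M ^ 2 / 2 * L ≤ β ^ 2 * M ^ 2 * r := by
      nlinarith [mul_nonneg (sq_nonneg β) (sq_nonneg M)]
    calc L - r ≤ β ^ 2 * M ^ 2 * r := by linarith
      _ = _ := by field_simp; ring
  have h3 := mul_macdonaldK1_le hy
  have h4 : Real.exp (-(α / 2 * r / 2 / 2)) ≤ Real.exp (-(α / 16) * L) := by
    refine Real.exp_le_exp.2 ?_
    have : α * (L / 2) ≤ α * r := by gcongr
    linarith
  calc |green κ r - green κ L - (green κ' r - green κ' L)|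
      = (2 * Real.pi)⁻¹ * |(macdonaldK0 (κ * r) - macdonaldK0 (κ * L))
        - (macdonaldK0 (κ' * r) - macdonaldK0 (κ' * L))| := by
        rw [← abs_of_pos (inv_pos.2 Real.two_pi_pos), ← abs_mul]
        congr 1
        simp only [green]
        ring
    _ ≤ 1 * |(macdonaldK0 (κ * r) - macdonaldK0 (κ * L))
        - (macdonaldK0 (κ' * r) - macdonaldK0 (κ' * L))| :=
        mul_le_mul_of_nonneg_right two_pi_inv_le_one (abs_nonneg _)
    _ ≤ |κ - κ'| * ((L - r) * macdonaldK1 (α / 2 * r / 2)) := by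
        rw [one_mul, ← mul_assoc]
        exact h1
    _ ≤ |κ - κ'| * (M ^ 2 * β ^ 2 * (4 / α) * (2 * Real.exp (-(α / 2 * r / 2 / 2)))) := by
        refine mul_le_mul_of_nonneg_left (h2.trans ?_) (abs_nonneg _)
        gcongr
    _ ≤ |κ - κ'| * (M ^ 2 * β ^ 2 * (4 / α) * (2 * Real.exp (-(α / 16) * L))) := by gcongr
    _ = M ^ 2 * (8 / α) * (β ^ 2 * |κ - κ'|) * Real.exp (-(α / 16) * L) := by ring
    _ ≤ _ := by
        gcongr
        linarith

theorem measurable_bentKernel (hΦ : Measurable Φ) (β κ : ℝ) : Measurable (bentKernel Φ β κ) :=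
  ((measurable_green κ).comp (continuous_chord hΦ β).measurable).sub
    ((measurable_green κ).comp (by fun_prop))

theorem bentKernel_swap (Φ : ℝ → ℝ) (β κ : ℝ) (p : ℝ × ℝ) :
    bentKernel Φ β κ p.swap = bentKernel Φ β κ p := by
  simp only [bentKernel, Prod.fst_swap, Prod.snd_swap]
  rw [chord_comm, abs_sub_comm]

end Bounds

end LeakyWire
end

noncomputable section

namespace LeakyWire

/-! ### The weighted perturbation -/

/-- The perturbation kernel divided by the weights. -/
def bentTilde (Φ : ℝ → ℝ) (β κ : ℝ) (p : ℝ × ℝ) : ℝ :=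
  bentKernel Φ β κ p / (weight p.1 * weight p.2)

section Tilde

variable {Φ : ℝ → ℝ} {M S α : ℝ}

theorem weight_mul_bentTilde (Φ : ℝ → ℝ) (β κ : ℝ) (p : ℝ × ℝ) :
    weight p.1 * weight p.2 * bentTilde Φ β κ p = bentKernel Φ β κ p :=
  mul_div_cancel₀ _ (mul_pos (weight_pos _) (weight_pos _)).ne'

theorem div_weight_le {x C : ℝ} {p : ℝ × ℝ} (h : |x| ≤ C * (decay p.1 ^ 3 * decay p.2 ^ 3)) :
    |x / (weight p.1 * weight p.2)| ≤ C * (decay p.1 * decay p.2) := by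
  have hw := mul_pos (weight_pos p.1) (weight_pos p.2)
  rw [abs_div, abs_of_pos hw, div_le_iff₀ hw]
  refine h.trans (le_of_eq ?_)
  simp only [weight]
  ring

theorem kernelBound_bentTilde (h : IsProfile Φ M S) (hα : 0 < α) {β κ : ℝ}
    (hβ : β ^ 2 * M ^ 2 ≤ 1) (hκ : α / 2 ≤ κ) :
    KernelBound (bentTilde Φ β κ) (bentConst α M S * β ^ 2) where
  measurable := (measurable_bentKernel h.measurable β κ).div
    ((continuous_weight.measurable.comp measurable_fst).mul
      (continuous_weight.measurable.comp measurable_snd))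
  bound p := div_weight_le (abs_bentKernel_le h hα hβ hκ p)

theorem kernelBound_bentKernel (h : IsProfile Φ M S) (hα : 0 < α) {β κ : ℝ}
    (hβ : β ^ 2 * M ^ 2 ≤ 1) (hκ : α / 2 ≤ κ) :
    KernelBound (bentKernel Φ β κ) (bentConst α M S * β ^ 2) where
  measurable := measurable_bentKernel h.measurable β κ
  bound p := by
    refine (abs_bentKernel_le h hα hβ hκ p).trans ?_
    refine mul_le_mul_of_nonneg_left ?_ (mul_nonneg (bentConst_nonneg hα M S) (sq_nonneg β))
    have key : ∀ s, decay s ^ 3 ≤ decay s := fun s =>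
      pow_le_of_le_one (decay_pos s).le (decay_le_one s) (by norm_num)
    exact mul_le_mul (key _) (key _) (pow_nonneg (decay_pos _).le 3) (decay_pos _).le

theorem bentTilde_swap (Φ : ℝ → ℝ) (β κ : ℝ) (p : ℝ × ℝ) :
    bentTilde Φ β κ p.swap = bentTilde Φ β κ p := by
  simp only [bentTilde, bentKernel_swap, Prod.fst_swap, Prod.snd_swap, mul_comm]

theorem norm_bentTilde_sub_le (h : IsProfile Φ M S) (hα : 0 < α) {β κ κ' : ℝ}
    (hβ : β ^ 2 * M ^ 2 ≤ 1) (hκ : α / 2 ≤ κ) (hκ' : α / 2 ≤ κ') :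
    ‖kernelOp (bentTilde Φ β κ) - kernelOp (bentTilde Φ β κ')‖
      ≤ bentConst α M S * (β ^ 2 * |κ - κ'|) * ‖decayL2‖ ^ 2 := by
  refine (kernelBound_bentTilde h hα hβ hκ).norm_kernelOp_sub_le
    (kernelBound_bentTilde h hα hβ hκ') fun p => ?_
  rw [bentTilde, bentTilde, ← sub_div]
  exact div_weight_le (abs_bentKernel_sub_le h hα hβ hκ hκ' p)

theorem weighted_bentTilde (h : IsProfile Φ M S) (hα : 0 < α) {β κ : ℝ}
    (hβ : β ^ 2 * M ^ 2 ≤ 1) (hκ : α / 2 ≤ κ) (u : L2Line) :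
    weightOp (kernelOp (bentTilde Φ β κ) (weightOp u)) = kernelOp (bentKernel Φ β κ) u := by
  refine ext_inner_left ℂ fun v => ?_
  rw [← inner_weightOp_left, (kernelBound_bentTilde h hα hβ hκ).inner_kernelOp,
    (kernelBound_bentKernel h hα hβ hκ).inner_kernelOp]
  refine integral_congr_ae ?_
  filter_upwards [ae_fst (coeFn_weightOp v), ae_snd (coeFn_weightOp u)] with p h1 h2
  rw [h1, h2, ← weight_mul_bentTilde]
  simp only [map_mul, Complex.conj_ofReal]
  push_cast
  ring

/-- The weights introduced by the vectors cancel those divided out, so the first-order coupling does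
not depend on the choice of weight. -/
theorem inner_weightL2_bentTilde (h : IsProfile Φ M S) (hα : 0 < α) {β κ : ℝ}
    (hβ : β ^ 2 * M ^ 2 ≤ 1) (hκ : α / 2 ≤ κ) :
    inner ℂ weightL2 (kernelOp (bentTilde Φ β κ) weightL2)
      = ((∫ p, bentKernel Φ β κ p : ℝ) : ℂ) := by
  rw [(kernelBound_bentTilde h hα hβ hκ).inner_kernelOp, kernelForm, ← integral_complex_ofReal]
  refine integral_congr_ae ?_
  filter_upwards [ae_fst coeFn_weightL2, ae_snd coeFn_weightL2] with p h1 h2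
  rw [h1, h2, ← weight_mul_bentTilde, Complex.conj_ofReal]
  push_cast
  ring

end Tilde

/-! ### A rank one reduction -/

section RankOne

variable {H : Type*} [NormedAddCommGroup H] [InnerProductSpace ℂ H] [CompleteSpace H]

/-- The solution `x` of `x = D w + α D N x`. -/
def coupled (a : ℝ) (D N : H →L[ℂ] H) (w : H) : H :=
  Ring.inverse (1 - (a : ℂ) • (D * N)) (D w)

variable {a : ℝ} {D D' N N' : H →L[ℂ] H} {w : H}

theorem norm_smul_mul_le (ha : 0 ≤ a) (D N : H →L[ℂ] H) :
    ‖(a : ℂ) • (D * N)‖ ≤ a * (‖D‖ * ‖N‖) := by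
  rw [norm_smul, Complex.norm_real, Real.norm_of_nonneg ha]
  exact mul_le_mul_of_nonneg_left (norm_mul_le _ _) ha

theorem isUnit_coupled (ha : 0 ≤ a) (h : a * (‖D‖ * ‖N‖) ≤ 1 / 2) :
    IsUnit (1 - (a : ℂ) • (D * N)) :=
  isUnit_one_sub_of_norm_lt_one (((norm_smul_mul_le ha D N).trans h).trans_lt (by norm_num))

theorem coupled_eq_iff (ha : 0 ≤ a) (h : a * (‖D‖ * ‖N‖) ≤ 1 / 2) (y z : H) :
    y = (a : ℂ) • D (N y) + z ↔ y = Ring.inverse (1 - (a : ℂ) • (D * N)) z := by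
  have hu := isUnit_coupled ha h
  constructor
  · intro e
    have h1 : (1 - (a : ℂ) • (D * N)) y = z := by
      change y - (a : ℂ) • D (N y) = z
      rw [sub_eq_iff_eq_add, add_comm]
      exact e
    rw [← h1]
    change y = (Ring.inverse (1 - (a : ℂ) • (D * N)) * (1 - (a : ℂ) • (D * N))) y
    rw [Ring.inverse_mul_cancel _ hu]
    rfl
  · intro e
    have h1 : ((1 - (a : ℂ) • (D * N)) * Ring.inverse (1 - (a : ℂ) • (D * N))) z = z := by
      rw [Ring.mul_inverse_cancel _ hu]
      rfl
    have h2 : y - (a : ℂ) • D (N y) = z := by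
      rw [← h1, e]
      rfl
    rw [← h2]
    abel

theorem coupled_eq (ha : 0 ≤ a) (h : a * (‖D‖ * ‖N‖) ≤ 1 / 2) (w : H) :
    coupled a D N w = (a : ℂ) • D (N (coupled a D N w)) + D w :=
  (coupled_eq_iff ha h _ _).2 rfl

theorem norm_le_two_mul (ha : 0 ≤ a) (h : a * (‖D‖ * ‖N‖) ≤ 1 / 2) {y z : H}
    (e : y = (a : ℂ) • D (N y) + z) : ‖y‖ ≤ 2 * ‖z‖ := by
  have h1 : ‖(a : ℂ) • D (N y)‖ ≤ 1 / 2 * ‖y‖ :=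
    (((a : ℂ) • (D * N)).le_opNorm y).trans
      (mul_le_mul_of_nonneg_right ((norm_smul_mul_le ha D N).trans h) (norm_nonneg _))
  have h2 : ‖y‖ ≤ ‖(a : ℂ) • D (N y)‖ + ‖z‖ := by
    conv_lhs => rw [e]
    exact norm_add_le _ _
  linarith

theorem norm_coupled_le (ha : 0 ≤ a) (h : a * (‖D‖ * ‖N‖) ≤ 1 / 2) (w : H) :
    ‖coupled a D N w‖ ≤ 2 * (‖D‖ * ‖w‖) :=
  (norm_le_two_mul ha h (coupled_eq ha h w)).trans (by gcongr; exact D.le_opNorm w)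

theorem norm_coupled_sub_le (ha : 0 ≤ a) (h : a * (‖D‖ * ‖N‖) ≤ 1 / 2)
    (h' : a * (‖D'‖ * ‖N'‖) ≤ 1 / 2) (w : H) :
    ‖coupled a D N w - coupled a D' N' w‖ ≤ 2 * (‖D - D'‖ * ‖w‖
      + a * (‖D - D'‖ * ‖N‖ + ‖D'‖ * ‖N - N'‖) * (2 * (‖D'‖ * ‖w‖))) := by
  set x := coupled a D N w with hx
  set x' := coupled a D' N' w with hx'
  -- The difference of the two solutions solves the first equation with a source built from D - D'
  -- and N - N'.
  have e : x - x' = (a : ℂ) • D (N (x - x'))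
      + ((D - D') w + (a : ℂ) • ((D - D') (N x') + D' ((N - N') x'))) := by
    have e1 := coupled_eq ha h w
    have e2 := coupled_eq ha h' w
    rw [← hx] at e1
    rw [← hx'] at e2
    calc x - x' = ((a : ℂ) • D (N x) + D w) - ((a : ℂ) • D' (N' x') + D' w) := by
          rw [← e1, ← e2]
      _ = _ := by
          change _ = (a : ℂ) • D (N (x - x'))
            + ((D w - D' w) + (a : ℂ) • ((D (N x') - D' (N x')) + D' (N x' - N' x')))
          simp only [map_sub, smul_sub, smul_add]
          abel
  refine (norm_le_two_mul ha h e).trans ?_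
  gcongr
  refine (norm_add_le _ _).trans (add_le_add ((D - D').le_opNorm w) ?_)
  rw [norm_smul, Complex.norm_real, Real.norm_of_nonneg ha, mul_assoc]
  gcongr
  refine (norm_add_le _ _).trans ?_
  rw [add_mul]
  have hb := norm_coupled_le ha h' w
  refine add_le_add ?_ ?_
  · refine ((D - D').le_opNorm _).trans ?_
    rw [mul_assoc]
    gcongr
    exact (N.le_opNorm _).trans (by gcongr)
  · refine (D'.le_opNorm _).trans ?_
    rw [mul_assoc]
    gcongr
    exact ((N - N').le_opNorm _).trans (by gcongr)

/-- Replacing D w by x - αDNx turns (w, x) into a combination, with real coefficients, of quadratic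
forms of symmetric operators. -/
theorem inner_coupled_im (ha : 0 ≤ a) (h : a * (‖D‖ * ‖N‖) ≤ 1 / 2)
    (hD : ∀ f g, inner ℂ (D f) g = inner ℂ f (D g))
    (hN : ∀ f g, inner ℂ (N f) g = inner ℂ f (N g)) (w : H) :
    (((inner ℂ w (coupled a D N w) : ℂ).re : ℝ) : ℂ) = inner ℂ w (coupled a D N w) := by
  set x := coupled a D N w with hx
  have e : x = (a : ℂ) • D (N x) + D w := coupled_eq ha h w
  have eD : D w = x - (a : ℂ) • D (N x) := eq_sub_of_add_eq' e.symm
  have key : inner ℂ w x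
      = (a : ℂ) * (inner ℂ x (N x) - (a : ℂ) * inner ℂ (D (N x)) (N x)) + inner ℂ w (D w) := by
    calc inner ℂ w x = inner ℂ w ((a : ℂ) • D (N x) + D w) := by rw [← e]
      _ = (a : ℂ) * inner ℂ (D w) (N x) + inner ℂ w (D w) := by
          rw [inner_add_right, inner_smul_right, hD]
      _ = _ := by
          rw [eD, inner_sub_left, inner_smul_left, Complex.conj_ofReal]
  rw [← Complex.conj_eq_iff_re, key]
  simp only [map_add, map_mul, map_sub, Complex.conj_ofReal, inner_conj_symm]
  rw [hN x x, hD (N x) (N x), hD w w]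

variable {A B W : H →L[ℂ] H} {c : ℂ}

/-- Put η = D W ψ. Inverting A gives ψ = αBWη, hence η = αDNη + αc(w, η) D w, so η is αc(w, η) times
the coupled solution x. Pairing with w forces (w, η) = 0 unless αc(w, x) = 1. -/
theorem eq_zero_of_mem_ker (ha : 0 ≤ a) (h : a * (‖D‖ * ‖N‖) ≤ 1 / 2)
    (hBA : B * A = 1) (hWBW : ∀ f, W (B (W f)) = c • (inner ℂ w f • w) + N f)
    (hne : (a : ℂ) * c * inner ℂ w (coupled a D N w) ≠ 1) {ψ : H}
    (hψ : A ψ = (a : ℂ) • W (D (W ψ))) : ψ = 0 := by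
  have h1 : ψ = (a : ℂ) • B (W (D (W ψ))) := by
    rw [← map_smul, ← hψ]
    change ψ = (B * A) ψ
    rw [hBA]
    rfl
  set η := D (W ψ) with hη
  have h2 : η = (a : ℂ) • D (N η) + ((a : ℂ) * c * inner ℂ w η) • D w := by
    calc η = D (W ((a : ℂ) • B (W η))) := by rw [← h1]
      _ = (a : ℂ) • D (c • (inner ℂ w η • w) + N η) := by rw [map_smul, map_smul, hWBW]
      _ = _ := by
          simp only [map_add, map_smul, smul_add, smul_smul]
          rw [add_comm]
          congr 2
          ring
  have h3 : η = ((a : ℂ) * c * inner ℂ w η) • coupled a D N w := by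
    refine ((coupled_eq_iff ha h _ _).1 h2).trans ?_
    rw [map_smul]
    rfl
  have h4 : inner ℂ w η = 0 := by
    have := congrArg (inner ℂ w) h3
    rw [inner_smul_right] at this
    by_contra h0
    apply hne
    have h5 : (inner ℂ w η : ℂ) * 1
        = inner ℂ w η * ((a : ℂ) * c * inner ℂ w (coupled a D N w)) := by
      rw [mul_one]
      linear_combination this
    exact (mul_left_cancel₀ h0 h5).symm
  rw [h1, h3, h4, mul_zero, zero_smul, map_zero, map_zero, smul_zero]

/-- In the resonant case the same elimination runs backwards: the coupled solution x reproduces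
itself, and every solution is a multiple of αBWx. -/
theorem exists_span_ker (ha : 0 ≤ a) (h : a * (‖D‖ * ‖N‖) ≤ 1 / 2)
    (hAB : A * B = 1) (hBA : B * A = 1)
    (hWBW : ∀ f, W (B (W f)) = c • (inner ℂ w f • w) + N f)
    (hc : (a : ℂ) * c * inner ℂ w (coupled a D N w) = 1) :
    ∃ ψ₀ : H, ψ₀ ≠ 0 ∧ A ψ₀ = (a : ℂ) • W (D (W ψ₀)) ∧
      ∀ ψ, A ψ = (a : ℂ) • W (D (W ψ)) → ∃ z : ℂ, ψ = z • ψ₀ := by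
  set x := coupled a D N w with hx
  have hx0 : x ≠ 0 := by
    intro h0
    rw [h0, inner_zero_right, mul_zero] at hc
    exact zero_ne_one hc
  have key : ∀ η, D (W ((a : ℂ) • B (W η)))
      = (a : ℂ) • D (N η) + ((a : ℂ) * c * inner ℂ w η) • D w := by
    intro η
    rw [map_smul, map_smul, hWBW]
    simp only [map_add, map_smul, smul_add, smul_smul]
    rw [add_comm]
    congr 2
    ring
  have hDx : D (W ((a : ℂ) • B (W x))) = x := by
    rw [key, hc, one_smul]
    exact (coupled_eq ha h w).symm
  refine ⟨(a : ℂ) • B (W x), fun h0 => hx0 ?_, ?_, fun ψ hψ => ?_⟩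
  · rw [← hDx, h0, map_zero, map_zero]
  · rw [hDx, map_smul]
    change (a : ℂ) • (A * B) (W x) = _
    rw [hAB]
    rfl
  · have h1 : ψ = (a : ℂ) • B (W (D (W ψ))) := by
      rw [← map_smul, ← hψ]
      change ψ = (B * A) ψ
      rw [hBA]
      rfl
    set η := D (W ψ) with hη
    have h2 : η = (a : ℂ) • D (N η) + ((a : ℂ) * c * inner ℂ w η) • D w := by
      rw [← key, ← h1]
    have h3 : η = ((a : ℂ) * c * inner ℂ w η) • x := by
      refine ((coupled_eq_iff ha h _ _).1 h2).trans ?_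
      rw [map_smul]
      rfl
    refine ⟨(a : ℂ) * c * inner ℂ w η, ?_⟩
    conv_lhs => rw [h1, h3]
    rw [map_smul, map_smul, smul_comm]

end RankOne

/-! ### A contraction on the half line -/

/-- The intermediate value theorem for F(x) - x on [0, 2F(0)] gives existence. The Lipschitz
constant below 1 gives uniqueness and the distance from F(0). -/
theorem exists_unique_fixedPoint {F : ℝ → ℝ} {q : ℝ} (hq : q ≤ 1 / 2)
    (hF : ∀ x y, 0 ≤ x → 0 ≤ y → |F x - F y| ≤ q * |x - y|) (h0 : 0 < F 0) :
    ∃ δ, 0 < δ ∧ F δ = δ ∧ δ ≤ 2 * F 0 ∧ |δ - F 0| ≤ q * δ ∧ ∀ δ', 0 < δ' → F δ' = δ' → δ' = δ := by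
  have hcont : ContinuousOn (fun x => F x - x) (Set.Icc 0 (2 * F 0)) := by
    have : LipschitzOnWith (1 / 2) F (Set.Icc 0 (2 * F 0)) :=
      LipschitzOnWith.of_dist_le_mul fun x hx y hy => by
        rw [Real.dist_eq, Real.dist_eq]
        exact (hF x y hx.1 hy.1).trans (mul_le_mul_of_nonneg_right (by simpa using hq)
          (abs_nonneg _))
    exact this.continuousOn.sub continuousOn_id
  have h2 : F (2 * F 0) - 2 * F 0 ≤ 0 := by
    have h3 := (abs_le.1 (hF (2 * F 0) 0 (by positivity) le_rfl)).2
    rw [sub_zero, abs_of_pos (by positivity)] at h3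
    nlinarith
  obtain ⟨δ, hδ, hδ0⟩ := intermediate_value_Icc' (by positivity : (0 : ℝ) ≤ 2 * F 0) hcont
    (Set.mem_Icc.2 ⟨h2, by simpa using h0.le⟩)
  have hfix : F δ = δ := by simpa [sub_eq_zero] using hδ0
  have hpos : 0 < δ := by
    refine hδ.1.lt_of_ne ?_
    rintro rfl
    exact h0.ne' hfix
  refine ⟨δ, hpos, hfix, hδ.2, ?_, fun δ' hδ' hf' => ?_⟩
  · have := hF δ 0 hδ.1 le_rfl
    rwa [hfix, sub_zero, abs_of_pos hpos] at this
  · have := hF δ' δ hδ'.le hδ.1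
    rw [hfix, hf'] at this
    have h3 := abs_nonneg (δ' - δ)
    have h4 : |δ' - δ| = 0 := by nlinarith
    exact sub_eq_zero.1 (abs_eq_zero.1 h4)

end LeakyWire

end

noncomputable section

namespace LeakyWire

open scoped BoundedContinuousFunction FourierTransform SchwartzMap LineDeriv

/-! ### Bessel potentials in the plane -/

theorem continuous_planeFreq (κ : ℝ) : Continuous fun ξ : Plane => freq κ ‖ξ‖ :=
  (continuous_freq κ).comp continuous_norm

theorem abs_two_pi_coord_le (κ : ℝ) (j : Fin 2) (ξ : Plane) :
    |2 * Real.pi * ξ j| ≤ freq κ ‖ξ‖ := by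
  refine Real.abs_le_sqrt ?_
  have h1 : ξ j ^ 2 ≤ ‖ξ‖ ^ 2 := sq_le_sq.2 (by rw [abs_norm]; exact abs_apply_le_norm ξ j)
  nlinarith [sq_nonneg κ, sq_nonneg Real.pi, mul_le_mul_of_nonneg_left h1 (sq_nonneg Real.pi)]

/-- The symbol of `(-Δ + κ²)^{-1/2}`. -/
def potentialSymbol {κ : ℝ} (hκ : 0 < κ) : Plane →ᵇ ℂ :=
  BoundedContinuousFunction.ofNormedAddCommGroup (fun ξ => (((freq κ ‖ξ‖)⁻¹ : ℝ) : ℂ))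
    (Complex.continuous_ofReal.comp
      ((continuous_planeFreq κ).inv₀ fun ξ => (freq_pos hκ _).ne')) κ⁻¹ fun ξ => by
    rw [Complex.norm_real, Real.norm_of_nonneg (inv_nonneg.2 (freq_pos hκ _).le)]
    exact inv_anti₀ hκ (le_freq _)

/-- The symbol of `∂ⱼ (-Δ + κ²)^{-1/2}`. -/
def gradientSymbol {κ : ℝ} (hκ : 0 < κ) (j : Fin 2) : Plane →ᵇ ℂ :=
  BoundedContinuousFunction.ofNormedAddCommGroup
    (fun ξ => ((2 * Real.pi * ξ j * (freq κ ‖ξ‖)⁻¹ : ℝ) : ℂ) * Complex.I)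
    ((Complex.continuous_ofReal.comp ((by fun_prop : Continuous fun ξ : Plane =>
      2 * Real.pi * ξ j).mul
      ((continuous_planeFreq κ).inv₀ fun ξ => (freq_pos hκ _).ne'))).mul continuous_const) 1
    fun ξ => by
    rw [norm_mul, Complex.norm_I, mul_one, Complex.norm_real, Real.norm_eq_abs, abs_mul,
      abs_of_nonneg (inv_nonneg.2 (freq_pos hκ _).le), ← div_eq_mul_inv,
      div_le_one (freq_pos hκ _)]
    exact abs_two_pi_coord_le κ j ξ

theorem potentialSymbol_apply {κ : ℝ} (hκ : 0 < κ) (ξ : Plane) :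
    potentialSymbol hκ ξ = (((freq κ ‖ξ‖)⁻¹ : ℝ) : ℂ) := rfl

theorem gradientSymbol_apply {κ : ℝ} (hκ : 0 < κ) (j : Fin 2) (ξ : Plane) :
    gradientSymbol hκ j ξ = ((2 * Real.pi * ξ j * (freq κ ‖ξ‖)⁻¹ : ℝ) : ℂ) * Complex.I := rfl

/-- The identity (|2πξ|² + κ²)/f² = 1, where f = `freq κ ‖ξ‖`, in a form that transfers to
operators. -/
theorem symbol_resolution {κ : ℝ} (hκ : 0 < κ) :
    (∑ j, star (gradientSymbol hκ j) * gradientSymbol hκ j)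
      + ((κ ^ 2 : ℝ) : ℂ) • (star (potentialSymbol hκ) * potentialSymbol hκ) = 1 := by
  ext ξ
  simp only [Fin.sum_univ_two, BoundedContinuousFunction.add_apply,
    BoundedContinuousFunction.mul_apply, BoundedContinuousFunction.star_apply,
    BoundedContinuousFunction.smul_apply, BoundedContinuousFunction.coe_one, Pi.one_apply,
    gradientSymbol_apply, potentialSymbol_apply, RCLike.star_def, map_mul, Complex.conj_ofReal,
    Complex.conj_I, smul_eq_mul]
  have hf := freq_pos hκ ‖ξ‖
  have h2 := freq_sq κ ‖ξ‖
  rw [norm_sq_plane] at h2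
  set f := freq κ ‖ξ‖
  have h3 : (2 * Real.pi * ξ 0 * f⁻¹) ^ 2 + (2 * Real.pi * ξ 1 * f⁻¹) ^ 2 + κ ^ 2 * f⁻¹ ^ 2 = 1 := by
    field_simp
    linarith
  have h4 := congrArg (Complex.ofReal) h3
  push_cast at h4 ⊢
  linear_combination h4 - ((2 * Real.pi * ξ 0 * (f : ℂ)⁻¹) ^ 2
    + (2 * Real.pi * ξ 1 * (f : ℂ)⁻¹) ^ 2) * (Complex.I_sq)

/-- The unitary Fourier transform on `L²(ℝ²)`. -/
def planeFourier : L2Plane ≃ₗᵢ[ℂ] L2Plane := Lp.fourierTransformₗᵢ Plane ℂ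

/-- The operator `(-Δ + κ²)^{-1/2}`, applied after the inverse Fourier transform. -/
def potential {κ : ℝ} (hκ : 0 < κ) : L2Plane →L[ℂ] L2Plane :=
  (planeFourier.symm.toContinuousLinearEquiv : L2Plane →L[ℂ] L2Plane) ∘L mulOp (potentialSymbol hκ)

/-- The operator `∂ⱼ (-Δ + κ²)^{-1/2}`, applied after the inverse Fourier transform. -/
def potentialGrad {κ : ℝ} (hκ : 0 < κ) (j : Fin 2) : L2Plane →L[ℂ] L2Plane :=
  (planeFourier.symm.toContinuousLinearEquiv : L2Plane →L[ℂ] L2Plane) ∘L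
    mulOp (gradientSymbol hκ j)

theorem inner_mulOp_mulOp {X : Type*} [MeasureSpace X] [TopologicalSpace X]
    [OpensMeasurableSpace X] (m : X →ᵇ ℂ) (f g : L2 X) :
    inner ℂ (mulOp m f) (mulOp m g) = inner ℂ f (mulOp (star m * m) g) := by
  rw [inner_mulOp_left, mulOp_mul]
  rfl

/-- By this identity the Bessel potential is an isometry from L² into W^{1,2} with the norm √(‖∇f‖²
+ κ²‖f‖²). -/
theorem energy_potential {κ : ℝ} (hκ : 0 < κ) (h' h : L2Plane) :
    (∑ j, inner ℂ (potentialGrad hκ j h') (potentialGrad hκ j h))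
      + ((κ ^ 2 : ℝ) : ℂ) * inner ℂ (potential hκ h') (potential hκ h) = inner ℂ h' h := by
  have e1 : ∀ j, inner ℂ (potentialGrad hκ j h') (potentialGrad hκ j h)
      = inner ℂ h' (mulOp (star (gradientSymbol hκ j) * gradientSymbol hκ j) h) := fun j =>
    (planeFourier.symm.inner_map_map _ _).trans (inner_mulOp_mulOp _ _ _)
  have e2 : inner ℂ (potential hκ h') (potential hκ h)
      = inner ℂ h' (mulOp (star (potentialSymbol hκ) * potentialSymbol hκ) h) :=
    (planeFourier.symm.inner_map_map _ _).trans (inner_mulOp_mulOp _ _ _)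
  have e3 := congrArg (fun T : L2Plane →L[ℂ] L2Plane => inner ℂ h' (T h))
    ((congrArg mulOp (symbol_resolution hκ)).trans mulOp_one)
  rw [mulOp_add, mulOp_smul, Fin.sum_univ_two, mulOp_add] at e3
  rw [Fin.sum_univ_two, e1, e1, e2, ← inner_add_right, ← inner_smul_right, ← inner_add_right]
  exact e3

theorem potential_injective {κ : ℝ} (hκ : 0 < κ) {h : L2Plane} (h0 : potential hκ h = 0) :
    h = 0 := by
  have h1 : mulOp (potentialSymbol hκ) h = 0 := by
    have := congrArg planeFourier h0
    rw [map_zero] at this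
    rw [← this]
    exact (planeFourier.apply_symm_apply _).symm
  refine Lp.ext ?_
  have h2 : mulOp (potentialSymbol hκ) h =ᵐ[volume] (0 : L2Plane) := by rw [h1]
  filter_upwards [h2, coeFn_mulOp (potentialSymbol hκ) h, Lp.coeFn_zero ℂ 2 (volume : Measure Plane)]
    with ξ e1 e2 e3
  rw [e3]
  rw [e1, e3, Pi.zero_apply, potentialSymbol_apply] at e2
  rcases mul_eq_zero.1 e2.symm with e4 | e4
  · exact absurd e4 (by exact_mod_cast (inv_pos.2 (freq_pos hκ _)).ne')
  · exact e4

theorem hasTemperateGrowth_freq_rpow {κ : ℝ} (hκ : 0 < κ) (r : ℝ) :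
    (fun ξ : Plane => (freq κ ‖ξ‖ ^ 2) ^ r).HasTemperateGrowth := by
  have h1 := Function.hasTemperateGrowth_one_add_norm_sq_rpow Plane r
  have h2 := h1.comp (((2 * Real.pi / κ) • ContinuousLinearMap.id ℝ Plane).hasTemperateGrowth)
  have h3 := (Function.HasTemperateGrowth.const (E := Plane) ((κ ^ 2) ^ r : ℝ)).mul h2
  refine (congrArg Function.HasTemperateGrowth (funext fun ξ => ?_)).mpr h3
  change (freq κ ‖ξ‖ ^ 2) ^ r = (κ ^ 2) ^ r * (1 + ‖(2 * Real.pi / κ) • ξ‖ ^ 2) ^ r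
  rw [← Real.mul_rpow (by positivity) (by positivity), freq_sq, norm_smul, mul_pow,
    Real.norm_eq_abs, sq_abs]
  congr 1
  field_simp
  ring

theorem hasTemperateGrowth_freq {κ : ℝ} (hκ : 0 < κ) :
    (fun ξ : Plane => freq κ ‖ξ‖).HasTemperateGrowth := by
  refine (congrArg Function.HasTemperateGrowth (funext fun ξ => ?_)).mpr
    (hasTemperateGrowth_freq_rpow hκ (1 / 2))
  rw [← Real.sqrt_eq_rpow, Real.sqrt_sq (freq_pos hκ _).le]

theorem hasTemperateGrowth_freq_inv {κ : ℝ} (hκ : 0 < κ) :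
    (fun ξ : Plane => (freq κ ‖ξ‖)⁻¹).HasTemperateGrowth := by
  refine (congrArg Function.HasTemperateGrowth (funext fun ξ => ?_)).mpr
    (hasTemperateGrowth_freq_rpow hκ (-(1 / 2)))
  rw [Real.rpow_neg (by positivity), ← Real.sqrt_eq_rpow, Real.sqrt_sq (freq_pos hκ _).le]

/-- The Fourier transform of `(-Δ + κ²)^{1/2} G`. -/
def energyDensity (κ : ℝ) (G : 𝓢(Plane, ℂ)) : 𝓢(Plane, ℂ) :=
  SchwartzMap.smulLeftCLM ℂ (fun ξ : Plane => freq κ ‖ξ‖) (𝓕 G)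

theorem energyDensity_apply {κ : ℝ} (hκ : 0 < κ) (G : 𝓢(Plane, ℂ)) (ξ : Plane) :
    energyDensity κ G ξ = (freq κ ‖ξ‖ : ℂ) * 𝓕 G ξ := by
  rw [energyDensity, SchwartzMap.smulLeftCLM_apply_apply (hasTemperateGrowth_freq hκ),
    Complex.real_smul]

theorem energyDensity_sub (κ : ℝ) (G G' : 𝓢(Plane, ℂ)) :
    energyDensity κ (G - G') = energyDensity κ G - energyDensity κ G' := by
  rw [energyDensity, sub_eq_add_neg, FourierTransform.fourier_add, FourierTransform.fourier_neg, ← sub_eq_add_neg,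
    map_sub]
  rfl

theorem energyDensity_surjective {κ : ℝ} (hκ : 0 < κ) (η : 𝓢(Plane, ℂ)) :
    ∃ G, energyDensity κ G = η := by
  refine ⟨𝓕⁻ (SchwartzMap.smulLeftCLM ℂ (fun ξ : Plane => (freq κ ‖ξ‖)⁻¹) η), ?_⟩
  ext ξ
  rw [energyDensity_apply hκ, FourierTransform.fourier_fourierInv_eq,
    SchwartzMap.smulLeftCLM_apply_apply (hasTemperateGrowth_freq_inv hκ), Complex.real_smul,
    ← mul_assoc, ← Complex.ofReal_mul, mul_inv_cancel₀ (freq_pos hκ _).ne', Complex.ofReal_one,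
    one_mul]

theorem potential_energyDensity {κ : ℝ} (hκ : 0 < κ) (G : 𝓢(Plane, ℂ)) :
    potential hκ ((energyDensity κ G).toLp 2) = G.toLp 2 := by
  have h1 : mulOp (potentialSymbol hκ) ((energyDensity κ G).toLp 2) = (𝓕 G).toLp 2 := by
    refine Lp.ext ?_
    filter_upwards [coeFn_mulOp (potentialSymbol hκ) ((energyDensity κ G).toLp 2),
      (energyDensity κ G).coeFn_toLp 2, (𝓕 G).coeFn_toLp 2] with ξ e1 e2 e3
    rw [e1, e2, e3, energyDensity_apply hκ, potentialSymbol_apply, ← mul_assoc,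
      ← Complex.ofReal_mul, inv_mul_cancel₀ (freq_pos hκ _).ne', Complex.ofReal_one, one_mul]
  change planeFourier.symm (mulOp (potentialSymbol hκ) ((energyDensity κ G).toLp 2)) = _
  rw [h1, LinearIsometryEquiv.symm_apply_eq]
  exact (SchwartzMap.toLp_fourier_eq G).symm

/-- The partial derivative of a Schwartz function. -/
def schwartzDeriv (j : Fin 2) (G : 𝓢(Plane, ℂ)) : 𝓢(Plane, ℂ) :=
  ∂_{(EuclideanSpace.single j 1 : Plane)} G

theorem schwartzDeriv_apply (j : Fin 2) (G : 𝓢(Plane, ℂ)) (x : Plane) :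
    schwartzDeriv j G x = pderiv j G x :=
  SchwartzMap.lineDerivOp_apply_eq_fderiv _ _ _

theorem potentialGrad_energyDensity {κ : ℝ} (hκ : 0 < κ) (j : Fin 2) (G : 𝓢(Plane, ℂ)) :
    potentialGrad hκ j ((energyDensity κ G).toLp 2) = (schwartzDeriv j G).toLp 2 := by
  have h1 : mulOp (gradientSymbol hκ j) ((energyDensity κ G).toLp 2)
      = (𝓕 (schwartzDeriv j G)).toLp 2 := by
    refine Lp.ext ?_
    filter_upwards [coeFn_mulOp (gradientSymbol hκ j) ((energyDensity κ G).toLp 2),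
      (energyDensity κ G).coeFn_toLp 2, (𝓕 (schwartzDeriv j G)).coeFn_toLp 2] with ξ e1 e2 e3
    have hin : (fun x : Plane =>
        inner ℝ x (EuclideanSpace.single j 1 : Plane)).HasTemperateGrowth := by fun_prop
    rw [e1, e2, e3, energyDensity_apply hκ, gradientSymbol_apply, schwartzDeriv,
      SchwartzMap.fourier_lineDerivOp_eq, smul_apply,
      SchwartzMap.smulLeftCLM_apply_apply hin]
    have h2 : (inner ℝ ξ (EuclideanSpace.single j 1 : Plane) : ℝ) = ξ j := by
      simp [PiLp.inner_apply]
    have h3 : ((freq κ ‖ξ‖ : ℝ) : ℂ) ≠ 0 := by exact_mod_cast (freq_pos hκ _).ne'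
    rw [h2, Complex.real_smul, smul_eq_mul]
    push_cast
    field_simp
  change planeFourier.symm (mulOp (gradientSymbol hκ j) ((energyDensity κ G).toLp 2)) = _
  rw [h1, LinearIsometryEquiv.symm_apply_eq]
  exact (SchwartzMap.toLp_fourier_eq _).symm

theorem norm_energyDensity_sq {κ : ℝ} (hκ : 0 < κ) (G : 𝓢(Plane, ℂ)) :
    ‖(energyDensity κ G).toLp 2‖ ^ 2 = (∑ j, ‖(schwartzDeriv j G).toLp 2‖ ^ 2)
      + κ ^ 2 * ‖G.toLp 2‖ ^ 2 := by
  have h := energy_potential hκ ((energyDensity κ G).toLp 2) ((energyDensity κ G).toLp 2)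
  simp only [potential_energyDensity, potentialGrad_energyDensity,
    inner_self_eq_norm_sq_to_K] at h
  rw [← Complex.ofReal_inj]
  push_cast at h ⊢
  exact h.symm

end LeakyWire

end

noncomputable section

namespace LeakyWire

open scoped BoundedContinuousFunction FourierTransform SchwartzMap LineDeriv

/-! ### Approximation of Schwartz functions by test functions -/

/-- A smooth cutoff function on the plane. -/
def cutoffBump : ContDiffBump (0 : Plane) := ⟨1, 2, one_pos, one_lt_two⟩

/-- The cutoff function at the scale `n + 1`. -/
def cutoff (n : ℕ) (x : Plane) : ℝ := cutoffBump (((n : ℝ) + 1)⁻¹ • x)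

theorem contDiff_cutoff (n : ℕ) : ContDiff ℝ ∞ (cutoff n) :=
  cutoffBump.contDiff.comp (contDiff_const_smul _)

theorem hasCompactSupport_cutoff (n : ℕ) : HasCompactSupport (cutoff n) :=
  cutoffBump.hasCompactSupport.comp_smul (by positivity)

/-- The left side vanishes for ‖x‖ ≤ n + 1, and beyond that radius the right side is at least 1. The
weight 1 + ‖x‖² buys an explicit rate of convergence. -/
theorem abs_cutoff_sub_one_le (n : ℕ) (x : Plane) :
    |cutoff n x - 1| ≤ ((n : ℝ) + 1)⁻¹ * (1 + ‖x‖ ^ 2) := by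
  have hn : (0 : ℝ) < (n : ℝ) + 1 := by positivity
  rcases le_or_gt ‖x‖ ((n : ℝ) + 1) with h | h
  · have : cutoff n x = 1 := by
      refine cutoffBump.one_of_mem_closedBall ?_
      rw [mem_closedBall_zero_iff, norm_smul, Real.norm_of_nonneg (by positivity)]
      change _ ≤ (1 : ℝ)
      rw [inv_mul_le_iff₀ hn]
      linarith
    rw [this, sub_self, abs_zero]
    positivity
  · have h1 : |cutoff n x - 1| ≤ 1 := by
      rw [abs_le]
      have h2 : 0 ≤ cutoff n x := cutoffBump.nonneg
      have h3 : cutoff n x ≤ 1 := cutoffBump.le_one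
      constructor <;> linarith
    refine h1.trans ?_
    rw [le_inv_mul_iff₀ hn]
    nlinarith [sq_nonneg (‖x‖ - 1)]

theorem exists_fderiv_cutoff_bound :
    ∃ C : ℝ, ∀ (n : ℕ) (x : Plane), ‖fderiv ℝ (cutoff n) x‖ ≤ ((n : ℝ) + 1)⁻¹ * C := by
  obtain ⟨C, hC⟩ := (cutoffBump.contDiff.continuous_fderiv (n := ∞)
    (by simp)).bounded_above_of_compact_support
    (cutoffBump.hasCompactSupport.fderiv (𝕜 := ℝ))
  refine ⟨C, fun n x => ?_⟩
  have h : fderiv ℝ (cutoff n) x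
      = ((n : ℝ) + 1)⁻¹ • fderiv ℝ cutoffBump (((n : ℝ) + 1)⁻¹ • x) :=
    fderiv_comp_smul _
  rw [h, norm_smul, Real.norm_of_nonneg (by positivity)]
  gcongr
  exact hC _

/-- The truncation of a Schwartz function. -/
def truncate (G : 𝓢(Plane, ℂ)) (n : ℕ) : 𝓢(Plane, ℂ) :=
  HasCompactSupport.toSchwartzMap (f := fun x => (cutoff n x) • G x)
    ((hasCompactSupport_cutoff n).smul_right) ((contDiff_cutoff n).smul (G.smooth ⊤))

theorem truncate_apply (G : 𝓢(Plane, ℂ)) (n : ℕ) (x : Plane) :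
    truncate G n x = cutoff n x • G x := rfl

theorem hasCompactSupport_truncate (G : 𝓢(Plane, ℂ)) (n : ℕ) : HasCompactSupport (truncate G n) :=
  (hasCompactSupport_cutoff n).smul_right

theorem pderiv_truncate_sub (G : 𝓢(Plane, ℂ)) (n : ℕ) (j : Fin 2) (x : Plane) :
    pderiv j (truncate G n - G : 𝓢(Plane, ℂ)) x = (cutoff n x - 1) • pderiv j G x
      + (fderiv ℝ (cutoff n) x (EuclideanSpace.single j 1)) • G x := by
  have h1 : HasFDerivAt (cutoff n) (fderiv ℝ (cutoff n) x) x :=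
    ((contDiff_cutoff n).differentiable (by simp) x).hasFDerivAt
  have h2 : HasFDerivAt G (fderiv ℝ G x) x := (G.differentiable x).hasFDerivAt
  have h3 : fderiv ℝ (truncate G n - G : 𝓢(Plane, ℂ)) x = cutoff n x • fderiv ℝ G x
      + (fderiv ℝ (cutoff n) x).smulRight (G x) - fderiv ℝ G x := ((h1.smul h2).sub h2).fderiv
  rw [pderiv, pderiv, h3]
  change cutoff n x • fderiv ℝ G x _ + (fderiv ℝ (cutoff n) x _) • G x - fderiv ℝ G x _ = _
  rw [sub_smul, one_smul]
  abel

/-- The dominating function for the error of the truncation. -/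
def truncBound (C : ℝ) (G : 𝓢(Plane, ℂ)) (x : Plane) : ℝ :=
  (1 + ‖x‖ ^ 2) * ‖G x‖ + (∑ j, (1 + ‖x‖ ^ 2) * ‖schwartzDeriv j G x‖) + C * ‖G x‖

theorem memLp_one_add_sq_mul (G : 𝓢(Plane, ℂ)) :
    MemLp (fun x => (1 + ‖x‖ ^ 2) * ‖G x‖) 2 volume := by
  have hg : (fun x : Plane => 1 + ‖x‖ ^ 2).HasTemperateGrowth := by
    have := Function.hasTemperateGrowth_one_add_norm_sq_rpow Plane 1
    simpa using this
  refine ((SchwartzMap.smulLeftCLM ℂ (fun x : Plane => 1 + ‖x‖ ^ 2) G).memLp 2 volume).norm.congr_norm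
    ?_ (Eventually.of_forall fun x => ?_)
  · exact (by fun_prop : Continuous fun x : Plane => (1 + ‖x‖ ^ 2) * ‖G x‖).aestronglyMeasurable
  · rw [SchwartzMap.smulLeftCLM_apply_apply hg, norm_norm, norm_smul, norm_mul, norm_norm]

theorem memLp_truncBound (C : ℝ) (G : 𝓢(Plane, ℂ)) : MemLp (truncBound C G) 2 volume := by
  refine ((memLp_one_add_sq_mul G).add ?_).add ((G.memLp 2 volume).norm.const_mul C)
  exact memLp_finsetSum _ fun j _ => memLp_one_add_sq_mul (schwartzDeriv j G)

theorem tendsto_of_ae_le {D : ℕ → 𝓢(Plane, ℂ)} {B : Plane → ℝ} (hB : MemLp B 2 volume)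
    (h : ∀ n x, ‖D n x‖ ≤ ((n : ℝ) + 1)⁻¹ * B x) :
    Tendsto (fun n => ‖(D n).toLp 2‖) atTop (𝓝 0) := by
  have h1 : ∀ n, ‖(D n).toLp 2‖ ≤ ((n : ℝ) + 1)⁻¹ * ‖hB.toLp‖ := fun n => by
    refine Lp.norm_le_mul_norm_of_ae_le_mul ?_
    filter_upwards [(D n).coeFn_toLp 2, hB.coeFn_toLp] with x e1 e2
    rw [e1, e2]
    exact (h n x).trans (by gcongr; exact le_abs_self _)
  have h2 : Tendsto (fun n : ℕ => ((n : ℝ) + 1)⁻¹ * ‖hB.toLp‖) atTop (𝓝 0) := by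
    have := (tendsto_one_div_add_atTop_nhds_zero_nat (𝕜 := ℝ)).mul_const ‖hB.toLp‖
    simpa using this
  exact squeeze_zero (fun _ => norm_nonneg _) h1 h2

/-- By `norm_energyDensity_sq` this is convergence of the truncations in W^{1,2}; the error terms
are a rate 1/(n + 1) times a fixed square integrable function. -/
theorem tendsto_energyDensity_truncate {κ : ℝ} (hκ : 0 < κ) (G : 𝓢(Plane, ℂ)) :
    Tendsto (fun n => (energyDensity κ (truncate G n)).toLp 2) atTop
      (𝓝 ((energyDensity κ G).toLp 2)) := by
  obtain ⟨C, hC⟩ := exists_fderiv_cutoff_bound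
  have hC0 : 0 ≤ C := by
    have := (norm_nonneg _).trans (hC 0 0)
    simpa using this
  have hpos : ∀ x : Plane, (0 : ℝ) ≤ 1 + ‖x‖ ^ 2 := fun x => by positivity
  have h0 : Tendsto (fun n => ‖(truncate G n - G).toLp 2‖) atTop (𝓝 0) := by
    refine tendsto_of_ae_le (memLp_truncBound C G) fun n x => ?_
    have e : (truncate G n - G) x = (cutoff n x - 1) • G x := by
      rw [sub_apply, truncate_apply, sub_smul, one_smul]
    rw [e, norm_smul, Real.norm_eq_abs]
    refine (mul_le_mul_of_nonneg_right (abs_cutoff_sub_one_le n x) (norm_nonneg _)).trans ?_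
    rw [mul_assoc]
    refine mul_le_mul_of_nonneg_left ?_ (by positivity)
    have h1 : 0 ≤ ∑ j, (1 + ‖x‖ ^ 2) * ‖schwartzDeriv j G x‖ :=
      Finset.sum_nonneg fun j _ => mul_nonneg (hpos x) (norm_nonneg _)
    have h2 := mul_nonneg hC0 (norm_nonneg (G x))
    rw [truncBound]
    linarith
  have h1 : ∀ j, Tendsto (fun n => ‖(schwartzDeriv j (truncate G n - G)).toLp 2‖) atTop (𝓝 0) := by
    intro j
    refine tendsto_of_ae_le (memLp_truncBound C G) fun n x => ?_
    rw [schwartzDeriv_apply, pderiv_truncate_sub]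
    refine (norm_add_le _ _).trans ?_
    rw [norm_smul, norm_smul, Real.norm_eq_abs]
    have e1 := mul_le_mul_of_nonneg_right (abs_cutoff_sub_one_le n x) (norm_nonneg (pderiv j G x))
    have e2 : ‖fderiv ℝ (cutoff n) x (EuclideanSpace.single j 1)‖ ≤ ((n : ℝ) + 1)⁻¹ * C := by
      refine ((fderiv ℝ (cutoff n) x).le_opNorm _).trans ?_
      simpa using hC n x
    have e3 := mul_le_mul_of_nonneg_right e2 (norm_nonneg (G x))
    refine (add_le_add e1 e3).trans ?_
    rw [mul_assoc, mul_assoc, ← mul_add]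
    refine mul_le_mul_of_nonneg_left ?_ (by positivity)
    have h2 : (1 + ‖x‖ ^ 2) * ‖schwartzDeriv j G x‖
        ≤ ∑ i, (1 + ‖x‖ ^ 2) * ‖schwartzDeriv i G x‖ :=
      Finset.single_le_sum (f := fun i => (1 + ‖x‖ ^ 2) * ‖schwartzDeriv i G x‖)
        (fun i _ => mul_nonneg (hpos x) (norm_nonneg _)) (Finset.mem_univ j)
    rw [schwartzDeriv_apply] at h2
    have h3 := mul_nonneg (hpos x) (norm_nonneg (G x))
    rw [truncBound]
    linarith
  rw [tendsto_iff_norm_sub_tendsto_zero]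
  have h2 : Tendsto (fun n => ‖(energyDensity κ (truncate G n - G)).toLp 2‖ ^ 2) atTop (𝓝 0) := by
    simp only [norm_energyDensity_sq hκ]
    have := (tendsto_finsetSum (Finset.univ : Finset (Fin 2)) fun j _ => (h1 j).pow 2).add
      ((h0.pow 2).const_mul (κ ^ 2))
    simpa using this
  have h3 := h2.sqrt
  simp only [Real.sqrt_sq (norm_nonneg _), Real.sqrt_zero] at h3
  refine h3.congr fun n => ?_
  rw [energyDensity_sub]
  rfl

end LeakyWire

end

noncomputable section

namespace LeakyWire

open scoped BoundedContinuousFunction FourierTransform SchwartzMap LineDeriv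

/-! ### The trace operator -/

/-- A continuous curve in the plane on which distances are not less than half of the arc length. -/
structure IsSpread (γ : ℝ → Plane) : Prop where
  continuous : Continuous γ
  lower : ∀ s s', |s - s'| / 2 ≤ ‖γ s - γ s'‖

/-- `R` is the integral operator with kernel `green κ ‖γ s - γ s'‖`. -/
def IsGreenOp (γ : ℝ → Plane) (κ : ℝ) (R : L2Line →L[ℂ] L2Line) : Prop :=
  ∀ v u : 𝓢(ℝ, ℂ), inner ℂ (ofSchwartz v) (R (ofSchwartz u))
    = ∫ p : ℝ × ℝ, (green κ ‖γ p.1 - γ p.2‖ : ℂ) * (starRingEnd ℂ (v p.1) * u p.2)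

section Trace

variable {γ : ℝ → Plane} {κ : ℝ} {R : L2Line →L[ℂ] L2Line}

theorem IsSpread.ne (hγ : IsSpread γ) (s s' : ℝ) (h : s ≠ s') : γ s ≠ γ s' := by
  intro e
  have h1 := hγ.lower s s'
  rw [e, sub_self, norm_zero] at h1
  have h2 := abs_pos.2 (sub_ne_zero.2 h)
  linarith

theorem IsSpread.hasCompactSupport_comp (hγ : IsSpread γ) {g : Plane → ℂ}
    (hg : HasCompactSupport g) : HasCompactSupport (g ∘ γ) := by
  obtain ⟨r, hr⟩ := hg.isCompact.isBounded.subset_closedBall (0 : Plane)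
  refine HasCompactSupport.intro (isCompact_closedBall (0 : ℝ) (2 * (r + ‖γ 0‖))) fun s hs => ?_
  by_contra h0
  apply hs
  have h1 : γ s ∈ Metric.closedBall (0 : Plane) r := hr (subset_tsupport _ h0)
  rw [mem_closedBall_zero_iff] at h1 ⊢
  have h2 := hγ.lower s 0
  rw [sub_zero] at h2
  have h3 := norm_sub_le (γ s) (γ 0)
  rw [Real.norm_eq_abs]
  linarith

theorem IsSpread.memLp_comp (hγ : IsSpread γ) {g : Plane → ℂ} (hc : Continuous g)
    (hg : HasCompactSupport g) : MemLp (g ∘ γ) 2 volume :=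
  (hc.comp hγ.continuous).memLp_of_hasCompactSupport (hγ.hasCompactSupport_comp hg)

theorem IsSpread.lintegral_lt_top (hγ : IsSpread γ) (hκ : 0 < κ) (v u : 𝓢(ℝ, ℂ)) :
    ∫⁻ p : ℝ × ℝ, ENNReal.ofReal (green κ ‖γ p.1 - γ p.2‖)
      * ‖starRingEnd ℂ (v p.1) * u p.2‖ₑ < ⊤ := by
  obtain ⟨C, hC⟩ := exists_bound_schwartz u
  exact lintegral_green_lt_top hκ hγ.lower v.integrable hC

/-- The squared norm is the Green energy of the density u on the curve, which is finite. -/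
theorem IsSpread.memLp_traceDensity (hγ : IsSpread γ) (hκ : 0 < κ) (u : 𝓢(ℝ, ℂ)) :
    MemLp (fun ξ : Plane => (((freq κ ‖ξ‖)⁻¹ : ℝ) : ℂ) * curveFourier γ u ξ) 2 volume := by
  have h1 := (isHeatSuperposition_plane hκ).lintegral_symbol_lt_top hγ.continuous.measurable
    hγ.ne u.integrable (hγ.lintegral_lt_top hκ u u)
  have hm : AEStronglyMeasurable
      (fun ξ : Plane => (((freq κ ‖ξ‖)⁻¹ : ℝ) : ℂ) * curveFourier γ u ξ) volume :=
    (potentialSymbol hκ).continuous.aestronglyMeasurable.mul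
      (aestronglyMeasurable_curveFourier hγ.continuous.measurable u.integrable)
  refine ⟨hm, ?_⟩
  rw [eLpNorm_lt_top_iff_lintegral_rpow_enorm_lt_top (by norm_num) (by norm_num)]
  refine lt_of_le_of_lt (le_of_eq (lintegral_congr fun ξ => ?_)) h1
  have hf := freq_pos hκ ‖ξ‖
  have e : (4 * Real.pi ^ 2 * ‖ξ‖ ^ 2 + κ ^ 2)⁻¹ = (freq κ ‖ξ‖)⁻¹ ^ 2 := by
    rw [← freq_sq, inv_pow]
  rw [e, enorm_mul, ENNReal.toReal_ofNat, ENNReal.mul_rpow_of_nonneg _ _ (by norm_num),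
    ← ofReal_norm (((freq κ ‖ξ‖)⁻¹ : ℝ) : ℂ), Complex.norm_real,
    Real.norm_of_nonneg (inv_nonneg.2 hf.le), ENNReal.ofReal_pow (inv_nonneg.2 hf.le)]
  norm_cast

theorem curveFourier_add (hγ : Measurable γ) (u v : 𝓢(ℝ, ℂ)) (ξ : Plane) :
    curveFourier γ (u + v) ξ = curveFourier γ u ξ + curveFourier γ v ξ := by
  rw [curveFourier, curveFourier, curveFourier, ← integral_add
    (integrable_char_mul hγ u.integrable ξ) (integrable_char_mul hγ v.integrable ξ)]
  simp only [Pi.add_apply, mul_add]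

theorem curveFourier_smul (c : ℂ) (u : 𝓢(ℝ, ℂ)) (ξ : Plane) :
    curveFourier γ (c • u) ξ = c * curveFourier γ u ξ := by
  rw [curveFourier, curveFourier, ← integral_const_mul]
  refine integral_congr_ae (Eventually.of_forall fun s => ?_)
  simp only [Pi.smul_apply, smul_eq_mul]
  ring

/-- The map `u ↦ (-Δ + κ²)^{-1/2} (u δ_γ)` in the Fourier representation. -/
def traceDensity (hγ : IsSpread γ) (hκ : 0 < κ) : 𝓢(ℝ, ℂ) →ₗ[ℂ] L2Plane where
  toFun u := (hγ.memLp_traceDensity hκ u).toLp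
  map_add' u v := by
    rw [← MemLp.toLp_add]
    refine MemLp.toLp_congr _ _ (Eventually.of_forall fun ξ => ?_)
    rw [Pi.add_apply, ← mul_add, ← curveFourier_add hγ.continuous.measurable]
    rfl
  map_smul' c u := by
    rw [RingHom.id_apply, ← MemLp.toLp_const_smul]
    refine MemLp.toLp_congr _ _ (Eventually.of_forall fun ξ => ?_)
    rw [Pi.smul_apply, smul_eq_mul, mul_left_comm, ← curveFourier_smul]
    rfl

theorem coeFn_traceDensity (hγ : IsSpread γ) (hκ : 0 < κ) (u : 𝓢(ℝ, ℂ)) :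
    traceDensity hγ hκ u =ᵐ[volume]
      fun ξ : Plane => (((freq κ ‖ξ‖)⁻¹ : ℝ) : ℂ) * curveFourier γ u ξ :=
  (hγ.memLp_traceDensity hκ u).coeFn_toLp

theorem inner_traceDensity (hγ : IsSpread γ) (hκ : 0 < κ) (hR : IsGreenOp γ κ R)
    (v u : 𝓢(ℝ, ℂ)) : inner ℂ (traceDensity hγ hκ v) (traceDensity hγ hκ u)
      = inner ℂ (ofSchwartz v) (R (ofSchwartz u)) := by
  rw [hR, ← (isHeatSuperposition_plane hκ).integral_symbol hγ.continuous.measurable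
    hγ.ne u.integrable v.integrable (hγ.lintegral_lt_top hκ u u) (hγ.lintegral_lt_top hκ v v)
    (hγ.lintegral_lt_top hκ v u), inner_L2]
  refine integral_congr_ae ?_
  filter_upwards [coeFn_traceDensity hγ hκ v, coeFn_traceDensity hγ hκ u] with ξ e1 e2
  have e : (4 * Real.pi ^ 2 * ‖ξ‖ ^ 2 + κ ^ 2)⁻¹ = (freq κ ‖ξ‖)⁻¹ ^ 2 := by
    rw [← freq_sq, inv_pow]
  rw [e1, e2, e, map_mul, Complex.conj_ofReal]
  push_cast
  ring

/-- On Schwartz densities ‖Tu‖² = (u, Ru) ≤ ‖R‖ ‖u‖², so T extends by density. The trace theorem is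
thus a consequence of the boundedness of R. -/
theorem exists_traceOp (hγ : IsSpread γ) (hκ : 0 < κ) (hR : IsGreenOp γ κ R) :
    ∃ T : L2Line →L[ℂ] L2Plane, (∀ u : 𝓢(ℝ, ℂ), T (ofSchwartz u) = traceDensity hγ hκ u) ∧
      T.adjoint ∘L T = R := by
  obtain ⟨T, h1⟩ : ∃ T : L2Line →L[ℂ] L2Plane,
      ∀ u : 𝓢(ℝ, ℂ), T (ofSchwartz u) = traceDensity hγ hκ u := by
    refine ⟨(traceDensity hγ hκ).extendOfNorm
      (SchwartzMap.toLpCLM ℂ ℂ 2 (volume : Measure ℝ)).toLinearMap, ?_⟩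
    refine LinearMap.extendOfNorm_eq denseRange_ofSchwartz ⟨√‖R‖, fun u => ?_⟩
    refine le_of_sq_le_sq ?_ (by positivity)
    rw [mul_pow, Real.sq_sqrt (norm_nonneg _)]
    have h2 := inner_traceDensity hγ hκ hR u u
    rw [inner_self_eq_norm_sq_to_K] at h2
    have h3 := norm_inner_le_norm (𝕜 := ℂ) (ofSchwartz u) (R (ofSchwartz u))
    rw [← h2] at h3
    have h4 := R.le_opNorm (ofSchwartz u)
    have h5 : ‖traceDensity hγ hκ u‖ ^ 2 ≤ ‖ofSchwartz u‖ * ‖R (ofSchwartz u)‖ := by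
      simpa using h3
    refine h5.trans ?_
    change _ ≤ ‖R‖ * ‖ofSchwartz u‖ ^ 2
    nlinarith [norm_nonneg (ofSchwartz u)]
  refine ⟨T, h1, continuousLinearMap_ext_of_inner_ofSchwartz fun u v => ?_⟩
  rw [← inner_traceDensity hγ hκ hR, ← h1, ← h1]
  change inner ℂ (ofSchwartz v) (T.adjoint (T (ofSchwartz u))) = _
  rw [ContinuousLinearMap.adjoint_inner_right]

/-- Fubini followed by Fourier inversion at the points of the curve. -/
theorem integral_conj_curveFourier_mul (hγ : Measurable γ) (u : 𝓢(ℝ, ℂ)) (G : 𝓢(Plane, ℂ)) :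
    ∫ ξ, starRingEnd ℂ (curveFourier γ u ξ) * 𝓕 G ξ = ∫ s, starRingEnd ℂ (u s) * G (γ s) := by
  have hint : Integrable (fun q : Plane × ℝ => Complex.exp ((2 * Real.pi * inner ℝ q.1 (γ q.2) : ℝ)
      * Complex.I) * (𝓕 G q.1 * starRingEnd ℂ (u q.2))) := by
    have h0 : Integrable (fun q : Plane × ℝ => 𝓕 G q.1 * starRingEnd ℂ (u q.2)) :=
      Integrable.mul_prod (𝓕 G).integrable (Complex.conjCLE.integrable_comp_iff.2 u.integrable)
    refine h0.bdd_mul (c := 1) ?_ (Eventually.of_forall fun q => ?_)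
    · refine Measurable.aestronglyMeasurable ?_
      have : Measurable fun q : Plane × ℝ => inner ℝ q.1 (γ q.2) :=
        measurable_fst.inner (hγ.comp measurable_snd)
      fun_prop
    · rw [Complex.norm_exp_ofReal_mul_I]
  have e1 : ∀ ξ, starRingEnd ℂ (curveFourier γ u ξ) * 𝓕 G ξ
      = ∫ s, Complex.exp ((2 * Real.pi * inner ℝ ξ (γ s) : ℝ) * Complex.I)
        * (𝓕 G ξ * starRingEnd ℂ (u s)) := by
    intro ξ
    rw [curveFourier, ← integral_conj, ← integral_mul_const]
    refine integral_congr_ae (Eventually.of_forall fun s => ?_)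
    simp only [map_mul, ← Complex.exp_conj, map_neg, Complex.conj_ofReal, Complex.conj_I]
    rw [show -((2 * Real.pi * inner ℝ ξ (γ s) : ℝ) : ℂ) * -Complex.I
      = ((2 * Real.pi * inner ℝ ξ (γ s) : ℝ) : ℂ) * Complex.I by ring]
    ring
  have e2 : ∀ s, ∫ ξ, Complex.exp ((2 * Real.pi * inner ℝ ξ (γ s) : ℝ) * Complex.I)
        * (𝓕 G ξ * starRingEnd ℂ (u s)) = starRingEnd ℂ (u s) * G (γ s) := by
    intro s
    have h1 : G (γ s) = 𝓕⁻ (𝓕 G : 𝓢(Plane, ℂ)) (γ s) := by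
      rw [FourierTransform.fourierInv_fourier_eq]
    rw [h1, SchwartzMap.fourierInv_coe, Real.fourierInv_eq', ← integral_const_mul]
    refine integral_congr_ae (Eventually.of_forall fun ξ => ?_)
    simp only [smul_eq_mul]
    ring
  simp_rw [e1]
  rw [integral_integral_swap hint]
  simp_rw [e2]

/-- The factor 1/`freq` in T cancels the factor `freq` in the energy density, so T* restricts G to
the curve. -/
theorem adjoint_energyDensity (hγ : IsSpread γ) (hκ : 0 < κ) {T : L2Line →L[ℂ] L2Plane}
    (hT : ∀ u : 𝓢(ℝ, ℂ), T (ofSchwartz u) = traceDensity hγ hκ u) {G : 𝓢(Plane, ℂ)}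
    (hG : HasCompactSupport G) :
    T.adjoint ((energyDensity κ G).toLp 2) = (hγ.memLp_comp G.continuous hG).toLp := by
  refine ext_inner_left ℂ fun v => ?_
  refine denseRange_ofSchwartz.induction_on v (isClosed_eq (by fun_prop) (by fun_prop)) fun u => ?_
  rw [ContinuousLinearMap.adjoint_inner_right, hT, inner_L2, inner_L2]
  calc _ = ∫ ξ, starRingEnd ℂ (curveFourier γ u ξ) * 𝓕 G ξ := by
        refine integral_congr_ae ?_
        filter_upwards [coeFn_traceDensity hγ hκ u, (energyDensity κ G).coeFn_toLp 2] with ξ e1 e2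
        have h3 : ((freq κ ‖ξ‖ : ℝ) : ℂ) ≠ 0 := by exact_mod_cast (freq_pos hκ _).ne'
        rw [e1, e2, energyDensity_apply hκ, map_mul, Complex.conj_ofReal]
        push_cast
        field_simp
    _ = _ := integral_conj_curveFourier_mul hγ.continuous.measurable u G
    _ = _ := by
        refine integral_congr_ae ?_
        filter_upwards [coeFn_ofSchwartz u, (hγ.memLp_comp G.continuous hG).coeFn_toLp] with s e1 e2
        rw [e1, e2, Function.comp_apply]

/-! ### The form domain as the range of the Bessel potential -/

theorem mem_testTriples_schwartz {G : 𝓢(Plane, ℂ)} (hγ : IsSpread γ) (hG : HasCompactSupport G) :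
    ((G.toLp 2 : L2Plane), fun j => ((schwartzDeriv j G).toLp 2 : L2Plane),
      (hγ.memLp_comp G.continuous hG).toLp) ∈ testTriples γ :=
  ⟨G, ⟨G.smooth ⊤, hG⟩, G.coeFn_toLp 2,
    fun j => ((schwartzDeriv j G).coeFn_toLp 2).trans
      (Eventually.of_forall fun x => schwartzDeriv_apply j G x),
    (hγ.memLp_comp G.continuous hG).coeFn_toLp⟩

theorem eq_of_mem_testTriples (hγ : IsSpread γ) {p : L2Plane × (Fin 2 → L2Plane) × L2Line}
    (hp : p ∈ testTriples γ) : ∃ (G : 𝓢(Plane, ℂ)) (hG : HasCompactSupport G),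
      p = (G.toLp 2, fun j => (schwartzDeriv j G).toLp 2,
        (hγ.memLp_comp G.continuous hG).toLp) := by
  obtain ⟨u, hu, h1, h2, h3⟩ := hp
  set G : 𝓢(Plane, ℂ) := hu.2.toSchwartzMap hu.1 with hGdef
  have hGu : (G : Plane → ℂ) = u := rfl
  have hG : HasCompactSupport G := hu.2
  refine ⟨G, hG, Prod.ext ?_ (Prod.ext (funext fun j => ?_) ?_)⟩
  · exact Lp.ext (h1.trans (G.coeFn_toLp 2).symm)
  · refine Lp.ext ((h2 j).trans (EventuallyEq.symm (((schwartzDeriv j G).coeFn_toLp 2).trans ?_)))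
    exact Eventually.of_forall fun x => schwartzDeriv_apply j G x
  · exact Lp.ext (h3.trans (hγ.memLp_comp G.continuous hG).coeFn_toLp.symm)

/-- The function with Fourier transform `h / freq`, its gradient and its trace. -/
def potentialTriple (hκ : 0 < κ) (T : L2Line →L[ℂ] L2Plane) (h : L2Plane) :
    L2Plane × (Fin 2 → L2Plane) × L2Line :=
  (potential hκ h, fun j => potentialGrad hκ j h, T.adjoint h)

theorem continuous_potentialTriple (hκ : 0 < κ) (T : L2Line →L[ℂ] L2Plane) :
    Continuous (potentialTriple hκ T) :=
  (potential hκ).continuous.prodMk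
    ((continuous_pi fun j => (potentialGrad hκ j).continuous).prodMk T.adjoint.continuous)

/-- A left inverse of the map `potentialTriple`. -/
def tripleInverse (hκ : 0 < κ) (p : L2Plane × (Fin 2 → L2Plane) × L2Line) : L2Plane :=
  (∑ j, (potentialGrad hκ j).adjoint (p.2.1 j))
    + ((κ ^ 2 : ℝ) : ℂ) • (potential hκ).adjoint p.1

theorem continuous_tripleInverse (hκ : 0 < κ) : Continuous (tripleInverse hκ) := by
  have h1 : Continuous fun p : L2Plane × (Fin 2 → L2Plane) × L2Line => (potential hκ).adjoint p.1 :=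
    (potential hκ).adjoint.continuous.comp continuous_fst
  have h2 : ∀ j, Continuous fun p : L2Plane × (Fin 2 → L2Plane) × L2Line =>
      (potentialGrad hκ j).adjoint (p.2.1 j) := fun j =>
    (potentialGrad hκ j).adjoint.continuous.comp
      ((continuous_apply j).comp (continuous_fst.comp continuous_snd))
  exact (continuous_finsetSum _ fun j _ => h2 j).add (h1.const_smul ((κ ^ 2 : ℝ) : ℂ))

theorem tripleInverse_potentialTriple (hκ : 0 < κ) (T : L2Line →L[ℂ] L2Plane) (h : L2Plane) :
    tripleInverse hκ (potentialTriple hκ T h) = h := by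
  refine ext_inner_left ℂ fun h' => ?_
  rw [← energy_potential hκ h' h, tripleInverse, inner_add_right, inner_sum, inner_smul_right]
  simp only [ContinuousLinearMap.adjoint_inner_right]
  rfl

theorem potentialTriple_energyDensity (hγ : IsSpread γ) (hκ : 0 < κ) {T : L2Line →L[ℂ] L2Plane}
    (hT : ∀ u : 𝓢(ℝ, ℂ), T (ofSchwartz u) = traceDensity hγ hκ u) {G : 𝓢(Plane, ℂ)}
    (hG : HasCompactSupport G) :
    potentialTriple hκ T ((energyDensity κ G).toLp 2)
      = (G.toLp 2, fun j => (schwartzDeriv j G).toLp 2,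
        (hγ.memLp_comp G.continuous hG).toLp) := by
  rw [potentialTriple, potential_energyDensity, adjoint_energyDensity hγ hκ hT hG]
  simp only [potentialGrad_energyDensity]

/-- Test triples lie in the range, which is closed because `potentialTriple` has a continuous left
inverse. Conversely, every Schwartz function is an energy density and is approximated by those of
truncations. -/
theorem closure_testTriples (hγ : IsSpread γ) (hκ : 0 < κ) {T : L2Line →L[ℂ] L2Plane}
    (hT : ∀ u : 𝓢(ℝ, ℂ), T (ofSchwartz u) = traceDensity hγ hκ u) :
    closure (testTriples γ) = Set.range (potentialTriple hκ T) := by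
  refine Set.Subset.antisymm (fun p hp => ⟨tripleInverse hκ p, ?_⟩) ?_
  · refine closure_minimal (t := {p | potentialTriple hκ T (tripleInverse hκ p) = p}) ?_
      (isClosed_eq ((continuous_potentialTriple hκ T).comp (continuous_tripleInverse hκ))
        continuous_id) hp
    intro q hq
    obtain ⟨G, hG, rfl⟩ := eq_of_mem_testTriples hγ hq
    rw [Set.mem_ofPred_eq, ← potentialTriple_energyDensity hγ hκ hT hG,
      tripleInverse_potentialTriple]
  · rintro _ ⟨h, rfl⟩
    have hd : DenseRange fun η : 𝓢(Plane, ℂ) => (η.toLp 2 : L2Plane) :=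
      SchwartzMap.denseRange_toLpCLM (F := ℂ) (p := 2) (μ := volume) ENNReal.ofNat_ne_top
    refine hd.induction_on (p := fun h => potentialTriple hκ T h ∈ closure (testTriples γ)) h
      (isClosed_closure.preimage (continuous_potentialTriple hκ T)) fun η => ?_
    obtain ⟨G, rfl⟩ := energyDensity_surjective hκ η
    refine isClosed_closure.mem_of_tendsto
      (((continuous_potentialTriple hκ T).tendsto _).comp (tendsto_energyDensity_truncate hκ G))
      (Eventually.of_forall fun n => subset_closure ?_)
    rw [Function.comp_apply,
      potentialTriple_energyDensity hγ hκ hT (hasCompactSupport_truncate G n)]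
    exact mem_testTriples_schwartz hγ (hasCompactSupport_truncate G n)

theorem continuous_integral_mul {φ : Plane → ℂ} (hφ : MemLp φ 2 volume) :
    Continuous fun f : L2Plane => ∫ x, f x * φ x := by
  have hc : MemLp (fun x => starRingEnd ℂ (φ x)) 2 volume :=
    Complex.conjLIE.toContinuousLinearEquiv.toContinuousLinearMap.comp_memLp' hφ
  have e : (fun f : L2Plane => ∫ x, f x * φ x) = fun f => inner ℂ hc.toLp f := by
    funext f
    rw [inner_L2]
    refine integral_congr_ae ?_
    filter_upwards [hc.coeFn_toLp] with x hx
    rw [hx, Complex.conj_conj, mul_comm]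
  rw [e]
  fun_prop

/-- Integration by parts for test functions passes to the limit, so membership in the closure
already implies the weak gradient condition of `InFormDomain`. -/
theorem isWeakGradient_of_mem_closure {p : L2Plane × (Fin 2 → L2Plane) × L2Line}
    (hp : p ∈ closure (testTriples γ)) : IsWeakGradient p.1 p.2.1 := by
  intro j φ hφ
  refine closure_minimal (t := {p : L2Plane × (Fin 2 → L2Plane) × L2Line |
    ∫ x, p.1 x * pderiv j φ x = - ∫ x, p.2.1 j x * φ x}) ?_ (isClosed_eq ?_ ?_) hp
  · rintro q ⟨u, hu, h1, h2, -⟩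
    have e1 : ∫ x, q.1 x * pderiv j φ x = ∫ x, u x * pderiv j φ x :=
      integral_congr_ae (by filter_upwards [h1] with x hx; rw [hx])
    have e2 : ∫ x, q.2.1 j x * φ x = ∫ x, pderiv j u x * φ x :=
      integral_congr_ae (by filter_upwards [h2 j] with x hx; rw [hx])
    rw [Set.mem_ofPred_eq, e1, e2]
    exact integral_mul_fderiv_eq_neg_fderiv_mul_of_integrable
      ((hu.memLp_pderiv j).integrable_mul hφ.memLp) (hu.memLp.integrable_mul (hφ.memLp_pderiv j))
      (hu.memLp.integrable_mul hφ.memLp) (fun x _ => hu.1.differentiable (by simp) x)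
      (fun x _ => hφ.1.differentiable (by simp) x)
  · exact (continuous_integral_mul (hφ.memLp_pderiv j)).comp continuous_fst
  · exact ((continuous_integral_mul hφ.memLp).comp
      ((continuous_apply j).comp (continuous_fst.comp continuous_snd))).neg

theorem inFormDomain_iff (hγ : IsSpread γ) (hκ : 0 < κ) {T : L2Line →L[ℂ] L2Plane}
    (hT : ∀ u : 𝓢(ℝ, ℂ), T (ofSchwartz u) = traceDensity hγ hκ u) {f : L2Plane}
    {F : Fin 2 → L2Plane} {t : L2Line} :
    InFormDomain γ f F t ↔ ∃ h, potentialTriple hκ T h = (f, F, t) := by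
  rw [InFormDomain, closure_testTriples hγ hκ hT]
  refine ⟨fun h => h.2, fun h => ⟨?_, h⟩⟩
  have : (f, F, t) ∈ closure (testTriples γ) := by
    rw [closure_testTriples hγ hκ hT]
    exact h
  exact isWeakGradient_of_mem_closure this

/-! ### The Birman–Schwinger principle -/

/-- By the energy identity the gradient term plus κ² times the mass term is just (h', h); what is
left of the form is the boundary term. -/
theorem form_potentialTriple (hκ : 0 < κ) (T : L2Line →L[ℂ] L2Plane) (α : ℝ) (h h' : L2Plane) :
    form α (fun j => potentialGrad hκ j h) (T.adjoint h) (fun j => potentialGrad hκ j h')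
        (T.adjoint h') = inner ℂ (potential hκ h') (((-κ ^ 2 : ℝ) : ℂ) • potential hκ h) ↔
      inner ℂ h' (h - (α : ℂ) • T (T.adjoint h)) = 0 := by
  have e := energy_potential hκ h' h
  rw [form, inner_smul_right, inner_sub_right, inner_smul_right, ← e,
    ContinuousLinearMap.adjoint_inner_left]
  push_cast
  constructor
  · intro h1
    linear_combination h1
  · intro h1
    linear_combination h1

theorem mem_eigenspace_iff (hγ : IsSpread γ) (hκ : 0 < κ) {T : L2Line →L[ℂ] L2Plane}
    (hT : ∀ u : 𝓢(ℝ, ℂ), T (ofSchwartz u) = traceDensity hγ hκ u) (α : ℝ) (f : L2Plane) :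
    f ∈ eigenspace α γ (-κ ^ 2) ↔
      ∃ h, f = potential hκ h ∧ h = (α : ℂ) • T (T.adjoint h) := by
  change HamiltonianMaps α γ f (((-κ ^ 2 : ℝ) : ℂ) • f) ↔ _
  constructor
  · rintro ⟨F, t, hF, hform⟩
    obtain ⟨h, hh⟩ := (inFormDomain_iff hγ hκ hT).1 hF
    obtain ⟨rfl, hh⟩ := Prod.ext_iff.1 hh
    obtain ⟨rfl, rfl⟩ := Prod.ext_iff.1 hh
    refine ⟨h, rfl, sub_eq_zero.1 (ext_inner_left ℂ fun h' => ?_)⟩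
    rw [inner_zero_right]
    refine (form_potentialTriple hκ T α h h').1 ?_
    exact hform _ _ _ ((inFormDomain_iff hγ hκ hT).2 ⟨h', rfl⟩)
  · rintro ⟨h, rfl, hh⟩
    refine ⟨_, _, (inFormDomain_iff hγ hκ hT).2 ⟨h, rfl⟩, fun g G t' hg => ?_⟩
    obtain ⟨h', hh'⟩ := (inFormDomain_iff hγ hκ hT).1 hg
    obtain ⟨rfl, hh'⟩ := Prod.ext_iff.1 hh'
    obtain ⟨rfl, rfl⟩ := Prod.ext_iff.1 hh'
    refine (form_potentialTriple hκ T α h h').2 ?_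
    rw [sub_eq_zero.2 hh, inner_zero_right]

/-- If h = αTT*h, then t = T*h solves t = αT*Tt = αRt, and h = αTt is recovered from t. -/
theorem eigenspace_eq_bot (hγ : IsSpread γ) (hκ : 0 < κ) (hR : IsGreenOp γ κ R) {α : ℝ}
    (h0 : ∀ t, t = (α : ℂ) • R t → t = 0) : eigenspace α γ (-κ ^ 2) = ⊥ := by
  obtain ⟨T, hT, hTR⟩ := exists_traceOp hγ hκ hR
  refine (Submodule.eq_bot_iff _).2 fun f hf => ?_
  obtain ⟨h, rfl, hh⟩ := (mem_eigenspace_iff hγ hκ hT α f).1 hf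
  have h1 : T.adjoint h = 0 := by
    apply h0
    conv_lhs => rw [hh]
    rw [map_smul, ← hTR]
    rfl
  rw [hh, h1, map_zero, smul_zero, map_zero]

theorem finrank_eigenspace_eq_one (hγ : IsSpread γ) (hκ : 0 < κ) (hR : IsGreenOp γ κ R) {α : ℝ}
    {t₀ : L2Line} (ht₀ : t₀ ≠ 0) (h0 : t₀ = (α : ℂ) • R t₀)
    (hspan : ∀ t, t = (α : ℂ) • R t → ∃ z : ℂ, t = z • t₀) :
    Module.finrank ℂ (eigenspace α γ (-κ ^ 2)) = 1 := by
  obtain ⟨T, hT, hTR⟩ := exists_traceOp hγ hκ hR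
  set h₀ : L2Plane := (α : ℂ) • T t₀ with hh₀
  have h1 : T.adjoint h₀ = t₀ := by
    rw [hh₀, map_smul]
    conv_rhs => rw [h0, ← hTR]
    rfl
  have h2 : potential hκ h₀ ≠ 0 := by
    intro e
    apply ht₀
    rw [← h1, potential_injective hκ e, map_zero]
  have h3 : eigenspace α γ (-κ ^ 2) = Submodule.span ℂ {potential hκ h₀} := by
    refine le_antisymm (fun f hf => ?_) ((Submodule.span_singleton_le_iff_mem _ _).2 ?_)
    · obtain ⟨h, rfl, hh⟩ := (mem_eigenspace_iff hγ hκ hT α f).1 hf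
      obtain ⟨z, hz⟩ := hspan (T.adjoint h) (by
        conv_lhs => rw [hh]
        rw [map_smul, ← hTR]
        rfl)
      refine Submodule.mem_span_singleton.2 ⟨z, ?_⟩
      rw [hh, hz, hh₀, map_smul T, ← map_smul, smul_comm]
    · refine (mem_eigenspace_iff hγ hκ hT α _).2 ⟨h₀, rfl, ?_⟩
      rw [h1]
  rw [h3, finrank_span_singleton h2]

end Trace

end LeakyWire

end

noncomputable section

namespace LeakyWire

open scoped SchwartzMap

/-! ### The spectral condition for weakly bent curves -/

section Spectral

variable {Φ : ℝ → ℝ} {M S α β : ℝ}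

theorem isSpread_profileCurve (h : IsProfile Φ M S) (hβ : β ^ 2 * M ^ 2 ≤ 1) :
    IsSpread (profileCurve Φ β) :=
  ⟨continuous_profileCurve h.measurable β, half_le_chord h hβ⟩

/-- The Birman–Schwinger operator of the bent curve. -/
def bentOp (Φ : ℝ → ℝ) (β : ℝ) {κ : ℝ} (hκ : 0 < κ) : L2Line →L[ℂ] L2Line :=
  lineOp hκ + kernelOp (bentKernel Φ β κ)

theorem integrable_green_mul {γ : ℝ → Plane} (hγ : IsSpread γ) {κ : ℝ} (hκ : 0 < κ)
    (v u : 𝓢(ℝ, ℂ)) :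
    Integrable fun p : ℝ × ℝ => (green κ ‖γ p.1 - γ p.2‖ : ℂ) * (starRingEnd ℂ (v p.1) * u p.2) := by
  refine ⟨?_, ?_⟩
  · have h1 : Measurable fun p : ℝ × ℝ => green κ ‖γ p.1 - γ p.2‖ := by
      refine (measurable_green κ).comp ?_
      have := hγ.continuous
      exact (by fun_prop : Continuous fun p : ℝ × ℝ => ‖γ p.1 - γ p.2‖).measurable
    refine (Complex.measurable_ofReal.comp h1).aestronglyMeasurable.mul
      (Continuous.aestronglyMeasurable ?_)
    have h2 := u.continuous
    have h3 := v.continuous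
    exact (Complex.continuous_conj.comp (h3.comp continuous_fst)).mul (h2.comp continuous_snd)
  · refine lt_of_le_of_lt (le_of_eq (lintegral_congr fun p => ?_)) (hγ.lintegral_lt_top hκ v u)
    rw [enorm_mul, ← ofReal_norm ((green κ ‖γ p.1 - γ p.2‖ : ℝ) : ℂ), Complex.norm_real,
      Real.norm_of_nonneg (green_nonneg _ _)]

theorem isGreenOp_bentOp (h : IsProfile Φ M S) (hα : 0 < α) (hβ : β ^ 2 * M ^ 2 ≤ 1) {κ : ℝ}
    (hκ : 0 < κ) (hακ : α / 2 ≤ κ) : IsGreenOp (profileCurve Φ β) κ (bentOp Φ β hκ) := by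
  intro v u
  have hK := kernelBound_bentKernel h hα hβ hακ
  have h1 : Integrable fun p : ℝ × ℝ =>
      (bentKernel Φ β κ p : ℂ) * (starRingEnd ℂ (v p.1) * u p.2) := by
    refine (hK.integrable (ofSchwartz u) (ofSchwartz v)).congr ?_
    filter_upwards [ae_fst (coeFn_ofSchwartz v), ae_snd (coeFn_ofSchwartz u)] with p h1 h2
    rw [h1, h2]
  have h2 := integrable_green_mul (isSpread_profileCurve h hβ) hκ v u
  have h3 : (fun p : ℝ × ℝ => (green κ |p.1 - p.2| : ℂ) * (starRingEnd ℂ (v p.1) * u p.2))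
      = fun p => (green κ ‖profileCurve Φ β p.1 - profileCurve Φ β p.2‖ : ℂ)
        * (starRingEnd ℂ (v p.1) * u p.2)
        - (bentKernel Φ β κ p : ℂ) * (starRingEnd ℂ (v p.1) * u p.2) := by
    funext p
    simp only [bentKernel, chord]
    push_cast
    ring
  change inner ℂ (ofSchwartz v)
    (lineOp hκ (ofSchwartz u) + kernelOp (bentKernel Φ β κ) (ofSchwartz u)) = _
  rw [inner_add_right, inner_lineOp_ofSchwartz, hK.inner_kernelOp_ofSchwartz, h3,
    integral_sub h2 h1, sub_add_cancel]

theorem eq_smul_bentOp_iff (h : IsProfile Φ M S) (hα : 0 < α) (hβ : β ^ 2 * M ^ 2 ≤ 1) {κ : ℝ}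
    (hκ : 0 < κ) (hακ : α / 2 ≤ κ) (t : L2Line) :
    t = (α : ℂ) • bentOp Φ β hκ t ↔ (1 - (α : ℂ) • lineOp hκ) t
      = (α : ℂ) • weightOp (kernelOp (bentTilde Φ β κ) (weightOp t)) := by
  rw [weighted_bentTilde h hα hβ hακ]
  change t = (α : ℂ) • (lineOp hκ t + kernelOp (bentKernel Φ β κ) t) ↔
    t - (α : ℂ) • lineOp hκ t = _
  rw [smul_add, sub_eq_iff_eq_add, add_comm]

/-- The function whose positive fixed points `δ` give the eigenvalues `-α² / 4 - δ²`. -/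
def couplingFn (Φ : ℝ → ℝ) (hα : 0 < α) (β δ : ℝ) : ℝ :=
  α ^ 3 / 4 * (inner ℂ weightL2 (coupled α (kernelOp (bentTilde Φ β (kap α δ))) (regOp hα δ)
    weightL2) : ℂ).re

/-- The bound of the weighted perturbation. -/
def tildeConst (α M S : ℝ) : ℝ := bentConst α M S * ‖decayL2‖ ^ 2

/-- The bound of the regular part of the weighted free operator. -/
def regConst (α : ℝ) : ℝ := 2 + α ^ 2 / 2 * ‖decayL2‖ ^ 2

/-- The Lipschitz constant of the regular part of the weighted free operator. -/
def regLipConst (α : ℝ) : ℝ := 2 / α + α ^ 2 / 2 * ‖decayL2‖ ^ 2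

theorem tildeConst_nonneg (hα : 0 < α) (M S : ℝ) : 0 ≤ tildeConst α M S :=
  mul_nonneg (bentConst_nonneg hα M S) (by positivity)

theorem norm_tilde_le (h : IsProfile Φ M S) (hα : 0 < α) (hβ : β ^ 2 * M ^ 2 ≤ 1) (δ : ℝ) :
    ‖kernelOp (bentTilde Φ β (kap α δ))‖ ≤ tildeConst α M S * β ^ 2 := by
  refine (kernelBound_bentTilde h hα hβ (half_le_kap α δ)).norm_kernelOp_le.trans (le_of_eq ?_)
  rw [tildeConst]
  ring

theorem norm_tilde_sub_le (h : IsProfile Φ M S) (hα : 0 < α) (hβ : β ^ 2 * M ^ 2 ≤ 1) {δ δ' : ℝ}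
    (hδ : 0 ≤ δ) (hδ' : 0 ≤ δ') :
    ‖kernelOp (bentTilde Φ β (kap α δ)) - kernelOp (bentTilde Φ β (kap α δ'))‖
      ≤ tildeConst α M S * β ^ 2 * |δ - δ'| := by
  refine (norm_bentTilde_sub_le h hα hβ (half_le_kap α δ) (half_le_kap α δ')).trans ?_
  have h1 := abs_kap_sub_le hα hδ hδ'
  have h2 := bentConst_nonneg hα M S
  calc bentConst α M S * (β ^ 2 * |kap α δ - kap α δ'|) * ‖decayL2‖ ^ 2
      ≤ bentConst α M S * (β ^ 2 * |δ - δ'|) * ‖decayL2‖ ^ 2 := by gcongr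
    _ = _ := by
        rw [tildeConst]
        ring

theorem coupling_small (h : IsProfile Φ M S) (hα : 0 < α) (hβ : β ^ 2 * M ^ 2 ≤ 1)
    (hsmall : α * (tildeConst α M S * β ^ 2 * regConst α) ≤ 1 / 2) {δ : ℝ} (hδ : 0 ≤ δ) :
    α * (‖kernelOp (bentTilde Φ β (kap α δ))‖ * ‖regOp hα δ‖) ≤ 1 / 2 := by
  refine le_trans ?_ hsmall
  have h1 := norm_tilde_le h hα hβ δ
  have h2 : ‖regOp hα δ‖ ≤ regConst α := norm_regOp_le hα hδ
  have h3 := tildeConst_nonneg hα M S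
  gcongr

theorem ofReal_couplingFn (h : IsProfile Φ M S) (hα : 0 < α) (hβ : β ^ 2 * M ^ 2 ≤ 1)
    (hsmall : α * (tildeConst α M S * β ^ 2 * regConst α) ≤ 1 / 2) {δ : ℝ} (hδ : 0 ≤ δ) :
    (couplingFn Φ hα β δ : ℂ) = (α ^ 3 / 4 : ℝ) * inner ℂ weightL2
      (coupled α (kernelOp (bentTilde Φ β (kap α δ))) (regOp hα δ) weightL2) := by
  rw [couplingFn, Complex.ofReal_mul, inner_coupled_im hα.le (coupling_small h hα hβ hsmall hδ)]
  · exact fun f g => (kernelBound_bentTilde h hα hβ (half_le_kap α δ)).inner_kernelOp_left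
      (bentTilde_swap Φ β _) f g
  · exact fun f g => inner_regOp_left hα hδ f g

theorem coupling_eq_one_iff (h : IsProfile Φ M S) (hα : 0 < α) (hβ : β ^ 2 * M ^ 2 ≤ 1)
    (hsmall : α * (tildeConst α M S * β ^ 2 * regConst α) ≤ 1 / 2) {δ : ℝ} (hδ : 0 < δ) :
    (α : ℂ) * ((α ^ 2 / (4 * δ) : ℝ) : ℂ) * inner ℂ weightL2
      (coupled α (kernelOp (bentTilde Φ β (kap α δ))) (regOp hα δ) weightL2) = 1 ↔
      couplingFn Φ hα β δ = δ := by
  have e := ofReal_couplingFn h hα hβ hsmall hδ.le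
  have hδ0 : (δ : ℂ) ≠ 0 := by exact_mod_cast hδ.ne'
  rw [← Complex.ofReal_inj, e]
  push_cast
  generalize inner ℂ weightL2
    (coupled α (kernelOp (bentTilde Φ β (kap α δ))) (regOp hα δ) weightL2) = z
  constructor
  · intro h1
    field_simp at h1
    linear_combination h1 / 4
  · intro h1
    field_simp
    linear_combination 4 * h1

theorem finrank_eigenspace_of_fixed (h : IsProfile Φ M S) (hα : 0 < α) (hβ : β ^ 2 * M ^ 2 ≤ 1)
    (hsmall : α * (tildeConst α M S * β ^ 2 * regConst α) ≤ 1 / 2) {δ : ℝ} (hδ : 0 < δ)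
    (hfix : couplingFn Φ hα β δ = δ) :
    Module.finrank ℂ (eigenspace α (profileCurve Φ β) (-kap α δ ^ 2)) = 1 := by
  have hκ := kap_pos hα δ
  obtain ⟨t₀, h0, h1, h2⟩ := exists_span_ker hα.le (coupling_small h hα hβ hsmall hδ.le)
    (lineOp_mul_lineInv hα hδ hκ (kap_sq α δ)) (lineInv_mul_lineOp hα hδ hκ (kap_sq α δ))
    (weighted_lineInv hα hδ) ((coupling_eq_one_iff h hα hβ hsmall hδ).2 hfix)
  have key := eq_smul_bentOp_iff h hα hβ hκ (half_le_kap α δ)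
  exact finrank_eigenspace_eq_one (isSpread_profileCurve h hβ) hκ
    (isGreenOp_bentOp h hα hβ hκ (half_le_kap α δ)) h0 ((key t₀).2 h1)
    fun t ht => h2 t ((key t).1 ht)

theorem eigenspace_eq_bot_of_not_fixed (h : IsProfile Φ M S) (hα : 0 < α)
    (hβ : β ^ 2 * M ^ 2 ≤ 1) (hsmall : α * (tildeConst α M S * β ^ 2 * regConst α) ≤ 1 / 2) {δ : ℝ}
    (hδ : 0 < δ) (hfix : couplingFn Φ hα β δ ≠ δ) :
    eigenspace α (profileCurve Φ β) (-kap α δ ^ 2) = ⊥ := by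
  have hκ := kap_pos hα δ
  refine eigenspace_eq_bot (isSpread_profileCurve h hβ) hκ
    (isGreenOp_bentOp h hα hβ hκ (half_le_kap α δ)) fun t ht => ?_
  exact eq_zero_of_mem_ker hα.le (coupling_small h hα hβ hsmall hδ.le)
    (lineInv_mul_lineOp hα hδ hκ (kap_sq α δ)) (weighted_lineInv hα hδ)
    (fun e => hfix ((coupling_eq_one_iff h hα hβ hsmall hδ).1 e))
    ((eq_smul_bentOp_iff h hα hβ hκ (half_le_kap α δ) t).1 ht)

/-- The Lipschitz constant of the coupling function, up to `β²`. -/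
def couplingConst (α M S : ℝ) : ℝ :=
  α ^ 3 * ‖weightL2‖ ^ 2 * tildeConst α M S * (2 + regLipConst α + α * tildeConst α M S * regConst α)

theorem regConst_ge (α : ℝ) : 2 ≤ regConst α := by
  rw [regConst]
  have : 0 ≤ α ^ 2 / 2 * ‖decayL2‖ ^ 2 := by positivity
  linarith

theorem regLipConst_nonneg (hα : 0 < α) : 0 ≤ regLipConst α := by
  rw [regLipConst]
  positivity

theorem couplingConst_nonneg (hα : 0 < α) (M S : ℝ) : 0 ≤ couplingConst α M S := by
  have h1 := tildeConst_nonneg hα M S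
  have h2 := regLipConst_nonneg hα
  have h3 : 0 ≤ regConst α := by linarith [regConst_ge α]
  rw [couplingConst]
  positivity

/-- D and its Lipschitz constant both carry β², while N is merely bounded and Lipschitz. The
smallness condition absorbs the terms quadratic in D, leaving a single factor β². -/
theorem abs_couplingFn_sub_le (h : IsProfile Φ M S) (hα : 0 < α) (hβ : β ^ 2 * M ^ 2 ≤ 1)
    (hsmall : α * (tildeConst α M S * β ^ 2 * regConst α) ≤ 1 / 2) {δ δ' : ℝ} (hδ : 0 ≤ δ)
    (hδ' : 0 ≤ δ') :
    |couplingFn Φ hα β δ - couplingFn Φ hα β δ'| ≤ couplingConst α M S * β ^ 2 * |δ - δ'| := by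
  set D := kernelOp (bentTilde Φ β (kap α δ))
  set D' := kernelOp (bentTilde Φ β (kap α δ'))
  set c := tildeConst α M S with hc
  have hc0 : 0 ≤ c := tildeConst_nonneg hα M S
  have hN := regConst_ge α
  have hL := regLipConst_nonneg hα
  set w := ‖weightL2‖
  have hw : 0 ≤ w := norm_nonneg _
  set d := |δ - δ'|
  have hd : 0 ≤ d := abs_nonneg _
  have h1 : |couplingFn Φ hα β δ - couplingFn Φ hα β δ'| ≤ α ^ 3 / 4 * (w *
      ‖coupled α D (regOp hα δ) weightL2 - coupled α D' (regOp hα δ') weightL2‖) := by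
    rw [couplingFn, couplingFn, ← mul_sub, abs_mul, abs_of_pos (by positivity), ← Complex.sub_re,
      ← inner_sub_right]
    gcongr
    exact (Complex.abs_re_le_norm _).trans (norm_inner_le_norm _ _)
  have h2 := norm_coupled_sub_le hα.le (coupling_small h hα hβ hsmall hδ)
    (coupling_small h hα hβ hsmall hδ') weightL2
  have hb : 0 ≤ c * β ^ 2 := mul_nonneg hc0 (sq_nonneg β)
  have h3 : ‖coupled α D (regOp hα δ) weightL2 - coupled α D' (regOp hα δ') weightL2‖
      ≤ 2 * (c * β ^ 2 * d * w + α * (c * β ^ 2 * d * regConst α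
        + c * β ^ 2 * (regLipConst α * d)) * (2 * (c * β ^ 2 * w))) := by
    refine h2.trans ?_
    have e1 : ‖D - D'‖ ≤ c * β ^ 2 * d := norm_tilde_sub_le h hα hβ hδ hδ'
    have e2 : ‖D'‖ ≤ c * β ^ 2 := norm_tilde_le h hα hβ δ'
    have e3 : ‖regOp hα δ‖ ≤ regConst α := norm_regOp_le hα hδ
    have e4 : ‖regOp hα δ - regOp hα δ'‖ ≤ regLipConst α * d := norm_regOp_sub_le hα hδ hδ'
    gcongr
  have hα1 : α * (c * β ^ 2) ≤ 1 / 2 := by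
    have : α * (c * β ^ 2) * 1 ≤ α * (c * β ^ 2) * regConst α :=
      mul_le_mul_of_nonneg_left (by linarith) (mul_nonneg hα.le hb)
    linarith
  have h4 : c * β ^ 2 * d * w + α * (c * β ^ 2 * d * regConst α
        + c * β ^ 2 * (regLipConst α * d)) * (2 * (c * β ^ 2 * w))
      ≤ c * β ^ 2 * d * w * (2 + regLipConst α) := by
    have e1 : α * (c * β ^ 2 * regConst α) * (2 * (c * β ^ 2 * d * w))
        ≤ 1 / 2 * (2 * (c * β ^ 2 * d * w)) :=
      mul_le_mul_of_nonneg_right hsmall (by positivity)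
    have e2 : α * (c * β ^ 2) * (2 * (c * β ^ 2 * d * w * regLipConst α))
        ≤ 1 / 2 * (2 * (c * β ^ 2 * d * w * regLipConst α)) :=
      mul_le_mul_of_nonneg_right hα1 (by positivity)
    linarith
  calc _ ≤ α ^ 3 / 4 * (w * (2 * (c * β ^ 2 * d * w * (2 + regLipConst α)))) :=
        h1.trans (by gcongr; exact h3.trans (by gcongr))
    _ = (α ^ 3 * w ^ 2 * c * (2 + regLipConst α)) * β ^ 2 * d * (1 / 2) := by ring
    _ ≤ (α ^ 3 * w ^ 2 * c * (2 + regLipConst α)) * β ^ 2 * d * 1 := by gcongr; norm_num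
    _ = (α ^ 3 * w ^ 2 * c * (2 + regLipConst α + 0)) * β ^ 2 * d := by ring
    _ ≤ couplingConst α M S * β ^ 2 * d := by
        rw [couplingConst]
        have : 0 ≤ regConst α := by linarith
        gcongr
        positivity

theorem kap_zero (hα : 0 < α) : kap α 0 = α / 2 := by
  rw [kap, show α ^ 2 / 4 + 0 ^ 2 = (α / 2) ^ 2 by ring, Real.sqrt_sq (by positivity)]

/-- The first Neumann term (w, Dw) is the integral of the perturbation kernel. The rest is αDNx with
x = O(β²), which is of second order in D. -/
theorem abs_couplingFn_zero_sub_le (h : IsProfile Φ M S) (hα : 0 < α) (hβ : β ^ 2 * M ^ 2 ≤ 1)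
    (hsmall : α * (tildeConst α M S * β ^ 2 * regConst α) ≤ 1 / 2) :
    |couplingFn Φ hα β 0 - α ^ 3 / 4 * ∫ p, bentKernel Φ β (α / 2) p|
      ≤ couplingConst α M S * β ^ 4 := by
  have hs := coupling_small h hα hβ hsmall le_rfl
  have hI := inner_weightL2_bentTilde h hα hβ (half_le_kap α 0)
  have hD := norm_tilde_le h hα hβ 0
  have hNreg : ‖regOp hα 0‖ ≤ regConst α := norm_regOp_le hα le_rfl
  have he := coupled_eq hα.le hs weightL2
  have hx := norm_coupled_le hα.le hs weightL2
  rw [← kap_zero hα]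
  set D := kernelOp (bentTilde Φ β (kap α 0))
  set x := coupled α D (regOp hα 0) weightL2 with hxdef
  set c := tildeConst α M S with hc
  have hc0 : 0 ≤ c := tildeConst_nonneg hα M S
  have hN := regConst_ge α
  have hN0 : 0 ≤ regConst α := by linarith
  have hL := regLipConst_nonneg hα
  have e1 : couplingFn Φ hα β 0 - α ^ 3 / 4 * ∫ p, bentKernel Φ β (kap α 0) p
      = α ^ 3 / 4 * (inner ℂ weightL2 ((α : ℂ) • D (regOp hα 0 x)) : ℂ).re := by
    have e2 : (inner ℂ weightL2 x : ℂ) = inner ℂ weightL2 ((α : ℂ) • D (regOp hα 0 x))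
        + ((∫ p, bentKernel Φ β (kap α 0) p : ℝ) : ℂ) := by
      rw [← hI, ← inner_add_right, ← he]
    rw [couplingFn, ← hxdef, e2, Complex.add_re, Complex.ofReal_re]
    ring
  have hb : 0 ≤ c * β ^ 2 := mul_nonneg hc0 (sq_nonneg β)
  have e3 : ‖(α : ℂ) • D (regOp hα 0 x)‖
      ≤ α * (c * β ^ 2 * (regConst α * (2 * (c * β ^ 2 * ‖weightL2‖)))) := by
    rw [norm_smul, Complex.norm_real, Real.norm_of_nonneg hα.le]
    gcongr
    refine (D.le_opNorm _).trans ?_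
    gcongr
    refine ((regOp hα 0).le_opNorm _).trans ?_
    gcongr
    exact hx.trans (by gcongr)
  rw [e1, abs_mul, abs_of_pos (by positivity)]
  calc _ ≤ α ^ 3 / 4 * (‖weightL2‖
        * (α * (c * β ^ 2 * (regConst α * (2 * (c * β ^ 2 * ‖weightL2‖)))))) := by
        gcongr
        exact (Complex.abs_re_le_norm _).trans ((norm_inner_le_norm _ _).trans (by gcongr))
    _ = α ^ 3 * ‖weightL2‖ ^ 2 * c * (0 + 0 + α * c * regConst α) * β ^ 4 * (1 / 2) := by ring
    _ ≤ α ^ 3 * ‖weightL2‖ ^ 2 * c * (0 + 0 + α * c * regConst α) * β ^ 4 * 1 := by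
        have : 0 ≤ α * c * regConst α := by positivity
        gcongr
        norm_num
    _ ≤ couplingConst α M S * β ^ 4 := by
        rw [couplingConst, mul_one]
        gcongr
        norm_num

end Spectral

end LeakyWire

end

noncomputable section

namespace LeakyWire

/-! ### The leading coefficient -/

section Leading

variable {Φ : ℝ → ℝ} {M S α : ℝ}

/-- The length times the variance of the angle on the interval between `s'` and `s`. -/
def spread (Φ : ℝ → ℝ) (s s' : ℝ) : ℝ :=
  (∫ u in Set.uIoc s' s, Φ u ^ 2) - |s - s'|⁻¹ * (∫ u in Set.uIoc s' s, Φ u) ^ 2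

theorem integrableOn_of_bounded {f : ℝ → ℝ} (hf : Measurable f) {C : ℝ}
    (h : ∀ u, |f u| ≤ C) (a b : ℝ) : IntegrableOn f (Set.uIoc a b) := by
  rw [← intervalIntegrable_iff]
  exact intervalIntegrable_of_bounded hf h a b

theorem IsProfile.sq_le (h : IsProfile Φ M S) (u : ℝ) : |Φ u ^ 2| ≤ M ^ 2 := by
  rw [abs_pow]
  exact pow_le_pow_left₀ (abs_nonneg _) (h.bound u) 2

theorem volume_real_uIoc (a b : ℝ) : volume.real (Set.uIoc a b) = |b - a| := by
  rw [Set.uIoc, Measure.real, Real.volume_Ioc, max_sub_min_eq_abs, ENNReal.toReal_ofReal (abs_nonneg _)]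

theorem integral_sub_sq (h : IsProfile Φ M S) (c s s' : ℝ) :
    ∫ u in Set.uIoc s' s, (Φ u - c) ^ 2
      = (∫ u in Set.uIoc s' s, Φ u ^ 2) - 2 * c * (∫ u in Set.uIoc s' s, Φ u) + c ^ 2 * |s - s'| := by
  have h1 := integrableOn_of_bounded h.measurable h.bound s' s
  have h2 := integrableOn_of_bounded (h.measurable.pow_const 2) h.sq_le s' s
  have h3 : IntegrableOn (fun _ : ℝ => c ^ 2) (Set.uIoc s' s) :=
    integrableOn_of_bounded measurable_const (fun _ => le_rfl) s' s
  have e : ∀ u, (Φ u - c) ^ 2 = Φ u ^ 2 - 2 * c * Φ u + c ^ 2 := fun u => by ring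
  have h4 : IntegrableOn (fun u => Φ u ^ 2 - 2 * c * Φ u) (Set.uIoc s' s) :=
    h2.sub (h1.const_mul (2 * c))
  simp_rw [e]
  rw [integral_add h4 h3, integral_sub h2 (h1.const_mul (2 * c)), integral_const_mul, setIntegral_const, volume_real_uIoc, smul_eq_mul]
  ring

theorem integral_sub_const (h : IsProfile Φ M S) (c s s' : ℝ) :
    ∫ u in Set.uIoc s' s, (Φ u - c) = (∫ u in Set.uIoc s' s, Φ u) - c * |s - s'| := by
  have h1 := integrableOn_of_bounded h.measurable h.bound s' s
  have h3 : IntegrableOn (fun _ : ℝ => c) (Set.uIoc s' s) :=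
    integrableOn_of_bounded measurable_const (fun _ => le_rfl) s' s
  rw [integral_sub h1 h3, setIntegral_const, volume_real_uIoc, smul_eq_mul]
  ring

/-- Length times variance is invariant under shifts of the angle, so the base point s' in the kernel
𝒜 may be replaced by 0. -/
theorem spread_sub_const (h : IsProfile Φ M S) (c : ℝ) {s s' : ℝ} (hs : s ≠ s') :
    |s - s'|⁻¹ * (∫ u in Set.uIoc s' s, (Φ u - c)) ^ 2 - ∫ u in Set.uIoc s' s, (Φ u - c) ^ 2
      = -spread Φ s s' := by
  have hL : |s - s'| ≠ 0 := abs_ne_zero.2 (sub_ne_zero.2 hs)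
  rw [integral_sub_const h, integral_sub_sq h, spread]
  field_simp
  ring

theorem ae_eq_const_of_spread_eq_zero (h : IsProfile Φ M S) {s s' : ℝ} (hs : s ≠ s')
    (h0 : spread Φ s s' = 0) : ∃ c, ∀ᵐ u, u ∈ Set.uIoc s' s → Φ u = c := by
  have hL : |s - s'| ≠ 0 := abs_ne_zero.2 (sub_ne_zero.2 hs)
  set c := |s - s'|⁻¹ * ∫ u in Set.uIoc s' s, Φ u with hc
  refine ⟨c, ?_⟩
  have h1 : ∫ u in Set.uIoc s' s, (Φ u - c) ^ 2 = 0 := by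
    rw [integral_sub_sq h, ← h0, spread, hc]
    field_simp
    ring
  have h2 : IntegrableOn (fun u => (Φ u - c) ^ 2) (Set.uIoc s' s) := by
    refine integrableOn_of_bounded (C := (M + |c|) ^ 2) ((h.measurable.sub_const c).pow_const 2)
      (fun u => ?_) s' s
    rw [abs_pow]
    refine pow_le_pow_left₀ (abs_nonneg _) ((abs_sub _ _).trans ?_) 2
    linarith [h.bound u]
  rw [setIntegral_eq_zero_iff_of_nonneg_ae (Eventually.of_forall fun u => sq_nonneg _) h2] at h1
  rw [← ae_restrict_iff' measurableSet_uIoc]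
  filter_upwards [h1] with u hu
  have : (Φ u - c) ^ 2 = 0 := hu
  exact sub_eq_zero.1 (pow_eq_zero_iff (two_ne_zero) |>.1 this)

/-! ### Second-order expansion of the chord. -/

theorem tendsto_sin_mul_div (x : ℝ) :
    Tendsto (fun β : ℝ => Real.sin (β * x) / β) (𝓝[≠] 0) (𝓝 x) := by
  have h : HasDerivAt (fun β : ℝ => Real.sin (β * x)) (Real.cos (0 * x) * (1 * x)) 0 :=
    ((hasDerivAt_id (0 : ℝ)).mul_const x).sin
  rw [zero_mul, Real.cos_zero, one_mul, one_mul, hasDerivAt_iff_tendsto_slope] at h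
  refine h.congr fun β => ?_
  simp [slope_def_field]

theorem tendsto_one_sub_cos_mul_div (x : ℝ) :
    Tendsto (fun β : ℝ => (1 - Real.cos (β * x)) / β ^ 2) (𝓝[≠] 0) (𝓝 (x ^ 2 / 2)) := by
  have h := ((tendsto_sin_mul_div (x / 2)).pow 2).const_mul 2
  rw [show 2 * (x / 2) ^ 2 = x ^ 2 / 2 by ring] at h
  refine h.congr fun β => ?_
  have e : Real.cos (β * x) = 1 - 2 * Real.sin (β * (x / 2)) ^ 2 := by
    rw [show β * x = 2 * (β * (x / 2)) by ring, Real.cos_two_mul, Real.cos_sq']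
    ring
  rw [e, div_pow]
  ring

theorem abs_sin_mul_div_le (β x : ℝ) : |Real.sin (β * x) / β| ≤ |x| := by
  rcases eq_or_ne β 0 with rfl | hβ
  · simp
  · rw [abs_div, div_le_iff₀ (abs_pos.2 hβ), mul_comm, ← abs_mul]
    exact Real.abs_sin_le_abs

theorem abs_one_sub_cos_mul_div_le (β x : ℝ) : |(1 - Real.cos (β * x)) / β ^ 2| ≤ x ^ 2 := by
  rcases eq_or_ne β 0 with rfl | hβ
  · simpa using sq_nonneg x
  · have h1 := Real.one_sub_sq_div_two_le_cos (x := β * x)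
    have h2 := Real.cos_le_one (β * x)
    rw [abs_of_nonneg (div_nonneg (by linarith) (sq_nonneg β)), div_le_iff₀ (by positivity)]
    nlinarith [sq_nonneg (β * x)]

theorem tendsto_sq_sub_chord (h : IsProfile Φ M S) (s s' : ℝ) :
    Tendsto (fun β : ℝ => (|s - s'| ^ 2 - chord Φ β s s' ^ 2) / β ^ 2) (𝓝[≠] 0)
      (𝓝 ((s - s') * (∫ u in s'..s, Φ u ^ 2) - (∫ u in s'..s, Φ u) ^ 2)) := by
  set c : ℝ → ℝ := fun β => ∫ u in s'..s, (1 - Real.cos (β * Φ u)) / β ^ 2 with hc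
  set d : ℝ → ℝ := fun β => ∫ u in s'..s, Real.sin (β * Φ u) / β with hd
  have h1 : Tendsto c (𝓝[≠] 0) (𝓝 (∫ u in s'..s, Φ u ^ 2 / 2)) := by
    refine intervalIntegral.tendsto_integral_filter_of_dominated_convergence (fun _ => M ^ 2)
      (Eventually.of_forall fun β => ?_) (Eventually.of_forall fun β => ?_) (by simp) ?_
    · exact ((measurable_const.sub (Real.measurable_cos.comp (h.measurable.const_mul β))).div_const
        _).aestronglyMeasurable
    · exact Eventually.of_forall fun u _ => (abs_one_sub_cos_mul_div_le β (Φ u)).trans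
        ((le_abs_self _).trans (h.sq_le u))
    · exact Eventually.of_forall fun u _ => tendsto_one_sub_cos_mul_div (Φ u)
  have h2 : Tendsto d (𝓝[≠] 0) (𝓝 (∫ u in s'..s, Φ u)) := by
    refine intervalIntegral.tendsto_integral_filter_of_dominated_convergence (fun _ => M)
      (Eventually.of_forall fun β => ?_) (Eventually.of_forall fun β => ?_) (by simp) ?_
    · exact ((Real.measurable_sin.comp (h.measurable.const_mul β)).div_const
        _).aestronglyMeasurable
    · exact Eventually.of_forall fun u _ => (abs_sin_mul_div_le β (Φ u)).trans (h.bound u)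
    · exact Eventually.of_forall fun u _ => tendsto_sin_mul_div (Φ u)
  have h3 : Tendsto (fun β : ℝ => β ^ 2) (𝓝[≠] 0) (𝓝 0) := by
    have : Tendsto (fun β : ℝ => β ^ 2) (𝓝 0) (𝓝 (0 ^ 2)) := (continuous_pow 2).tendsto 0
    rw [zero_pow two_ne_zero] at this
    exact this.mono_left nhdsWithin_le_nhds
  -- With L = s - s', the horizontal part of the chord is L - β²c and the vertical part is βd, so L²
  -- minus the squared chord equals β²(2Lc - β²c² - d²).
  have h4 := ((h1.const_mul (2 * (s - s'))).sub (h3.mul (h1.pow 2))).sub (h2.pow 2)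
  rw [intervalIntegral.integral_div, zero_mul, sub_zero,
    show 2 * (s - s') * ((∫ u in s'..s, Φ u ^ 2) / 2) = (s - s') * ∫ u in s'..s, Φ u ^ 2 by ring] at h4
  refine h4.congr' ?_
  filter_upwards [self_mem_nhdsWithin] with β hβ
  have hβ0 : β ≠ 0 := hβ
  have e1 : ∫ u in s'..s, Real.cos (β * Φ u) = (s - s') - β ^ 2 * c β := by
    rw [hc]
    simp only
    rw [intervalIntegral.integral_div, intervalIntegral.integral_sub (by simp)
      (intervalIntegrable_cos h.measurable β s' s), mul_div_cancel₀ _ (pow_ne_zero 2 hβ0)]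
    simp
  have e2 : ∫ u in s'..s, Real.sin (β * Φ u) = β * d β := by
    rw [hd]
    simp only
    rw [intervalIntegral.integral_div, mul_div_cancel₀ _ hβ0]
  rw [chord_sq h.measurable, e1, e2, sq_abs]
  field_simp
  ring

theorem intervalIntegral_spread (Φ : ℝ → ℝ) {s s' : ℝ} (hs : s ≠ s') :
    (s - s') * (∫ u in s'..s, Φ u ^ 2) - (∫ u in s'..s, Φ u) ^ 2 = |s - s'| * spread Φ s s' := by
  have hL : |s - s'| ≠ 0 := abs_ne_zero.2 (sub_ne_zero.2 hs)
  rw [spread, intervalIntegral.intervalIntegral_eq_integral_uIoc,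
    intervalIntegral.intervalIntegral_eq_integral_uIoc, mul_sub, ← mul_assoc |s - s'|,
    mul_inv_cancel₀ hL, one_mul]
  split_ifs with h1
  · rw [abs_of_nonneg (sub_nonneg.2 h1), one_smul, one_smul]
  · rw [abs_of_neg (by linarith), smul_eq_mul, smul_eq_mul]
    ring

theorem tendsto_chord (h : IsProfile Φ M S) (s s' : ℝ) :
    Tendsto (fun β => chord Φ β s s') (𝓝[≠] 0) (𝓝 |s - s'|) := by
  have h3 : Tendsto (fun β : ℝ => (1 - β ^ 2 * M ^ 2 / 2) * |s - s'|) (𝓝[≠] 0) (𝓝 |s - s'|) := by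
    have : Tendsto (fun β : ℝ => (1 - β ^ 2 * M ^ 2 / 2) * |s - s'|) (𝓝 0)
        (𝓝 ((1 - 0 ^ 2 * M ^ 2 / 2) * |s - s'|)) :=
      (by fun_prop : Continuous fun β : ℝ => (1 - β ^ 2 * M ^ 2 / 2) * |s - s'|).tendsto 0
    rw [show (1 - 0 ^ 2 * M ^ 2 / 2) * |s - s'| = |s - s'| by ring] at this
    exact this.mono_left nhdsWithin_le_nhds
  exact tendsto_of_tendsto_of_tendsto_of_le_of_le h3 tendsto_const_nhds
    (fun β => le_chord h β s s') (fun β => chord_le h.measurable β s s')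

theorem tendsto_sub_chord (h : IsProfile Φ M S) {s s' : ℝ} (hs : s ≠ s') :
    Tendsto (fun β : ℝ => (chord Φ β s s' - |s - s'|) / β ^ 2) (𝓝[≠] 0)
      (𝓝 (-(spread Φ s s' / 2))) := by
  have hL : 0 < |s - s'| := abs_pos.2 (sub_ne_zero.2 hs)
  have h1 := tendsto_sq_sub_chord h s s'
  rw [intervalIntegral_spread Φ hs] at h1
  have h2 := (h1.div ((tendsto_const_nhds (x := |s - s'|)).add (tendsto_chord h s s'))
    (by positivity)).neg
  rw [show -(|s - s'| * spread Φ s s' / (|s - s'| + |s - s'|)) = -(spread Φ s s' / 2) by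
    field_simp; ring] at h2
  refine h2.congr fun β => ?_
  have h3 : |s - s'| + chord Φ β s s' ≠ 0 := by linarith [chord_nonneg Φ β s s']
  change -((|s - s'| ^ 2 - chord Φ β s s' ^ 2) / β ^ 2 / (|s - s'| + chord Φ β s s')) = _
  rw [div_right_comm, ← neg_div]
  congr 1
  field_simp
  ring

theorem hasDerivAt_green {κ r : ℝ} (hκ : 0 < κ) (hr : 0 < r) :
    HasDerivAt (green κ) (-((2 * Real.pi)⁻¹ * κ * macdonaldK1 (κ * r))) r := by
  have h1 := (hasDerivAt_macdonaldK0 (mul_pos hκ hr)).comp r ((hasDerivAt_id r).const_mul κ)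
  have h2 := h1.const_mul (2 * Real.pi)⁻¹
  refine h2.congr_deriv ?_
  ring

/-- Chain rule at the arc length. The chord may coincide with the arc, so the difference quotient of
the Green function is taken as `dslope`, which is continuous there. -/
theorem tendsto_bentKernel_div (h : IsProfile Φ M S) {κ : ℝ} (hκ : 0 < κ) {p : ℝ × ℝ}
    (hp : p.1 ≠ p.2) :
    Tendsto (fun β : ℝ => bentKernel Φ β κ p / β ^ 2) (𝓝[≠] 0)
      (𝓝 ((4 * Real.pi)⁻¹ * κ * macdonaldK1 (κ * |p.1 - p.2|) * spread Φ p.1 p.2)) := by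
  have hL : 0 < |p.1 - p.2| := abs_pos.2 (sub_ne_zero.2 hp)
  have hd := hasDerivAt_green hκ hL
  have h1 := (continuousAt_dslope_same.2 hd.differentiableAt).tendsto.comp (tendsto_chord h p.1 p.2)
  rw [dslope_same, hd.deriv] at h1
  have h2 := (tendsto_sub_chord h hp).mul h1
  rw [show -(spread Φ p.1 p.2 / 2) * -((2 * Real.pi)⁻¹ * κ * macdonaldK1 (κ * |p.1 - p.2|))
    = (4 * Real.pi)⁻¹ * κ * macdonaldK1 (κ * |p.1 - p.2|) * spread Φ p.1 p.2 by
      rw [show (4 * Real.pi)⁻¹ = (2 * Real.pi)⁻¹ / 2 by field_simp; norm_num]; ring] at h2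
  refine h2.congr fun β => ?_
  have e := sub_smul_dslope (green κ) |p.1 - p.2| (chord Φ β p.1 p.2)
  rw [smul_eq_mul] at e
  rw [bentKernel, ← e, Function.comp_apply]
  ring

/-! ### The limiting kernel and the sign of its integral. -/

/-- The limit of `α³ / 4` times the perturbation kernel, divided by `β²`. -/
def leadingKernel (α : ℝ) (Φ : ℝ → ℝ) (p : ℝ × ℝ) : ℝ :=
  α ^ 4 / (32 * Real.pi) * macdonaldK1 (α / 2 * |p.1 - p.2|) * spread Φ p.1 p.2

theorem tendsto_leadingKernel (h : IsProfile Φ M S) (hα : 0 < α) {p : ℝ × ℝ} (hp : p.1 ≠ p.2) :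
    Tendsto (fun β : ℝ => α ^ 3 / 4 * (bentKernel Φ β (α / 2) p / β ^ 2)) (𝓝[≠] 0)
      (𝓝 (leadingKernel α Φ p)) := by
  have h1 := (tendsto_bentKernel_div h (half_pos hα) hp).const_mul (α ^ 3 / 4)
  refine (congrArg (fun x => Tendsto _ _ (𝓝 x)) ?_).mp h1
  rw [leadingKernel]
  field_simp
  ring

theorem eventually_small (M : ℝ) : ∀ᶠ β : ℝ in 𝓝[≠] 0, β ^ 2 * M ^ 2 ≤ 1 := by
  have : Tendsto (fun β : ℝ => β ^ 2 * M ^ 2) (𝓝 0) (𝓝 (0 ^ 2 * M ^ 2)) :=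
    (by fun_prop : Continuous fun β : ℝ => β ^ 2 * M ^ 2).tendsto 0
  rw [zero_pow two_ne_zero, zero_mul] at this
  exact ((this.eventually (eventually_lt_nhds zero_lt_one)).mono fun β h => h.le).filter_mono
    nhdsWithin_le_nhds

/-- The dominating function for the perturbation kernel. -/
def leadingBound (α M S : ℝ) (p : ℝ × ℝ) : ℝ :=
  α ^ 3 / 4 * bentConst α M S * (decay p.1 * decay p.2)

theorem integrable_leadingBound (α M S : ℝ) : Integrable (leadingBound α M S) :=
  (Integrable.mul_prod integrable_decay integrable_decay).const_mul _

theorem abs_bentKernel_div_le (h : IsProfile Φ M S) (hα : 0 < α) {β : ℝ}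
    (hβ : β ^ 2 * M ^ 2 ≤ 1) (p : ℝ × ℝ) :
    |α ^ 3 / 4 * (bentKernel Φ β (α / 2) p / β ^ 2)| ≤ leadingBound α M S p := by
  have h1 := (kernelBound_bentKernel h hα hβ le_rfl).bound p
  have h2 := bentConst_nonneg hα M S
  have h3 := mul_nonneg (decay_pos p.1).le (decay_pos p.2).le
  rw [leadingBound, abs_mul, abs_of_pos (by positivity), mul_assoc, abs_div,
    abs_of_nonneg (sq_nonneg β)]
  gcongr
  refine div_le_of_le_mul₀ (sq_nonneg β) (mul_nonneg h2 h3) (h1.trans (le_of_eq ?_))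
  ring

theorem ae_tendsto_leadingKernel (h : IsProfile Φ M S) (hα : 0 < α) : ∀ᵐ p : ℝ × ℝ,
    Tendsto (fun β : ℝ => α ^ 3 / 4 * (bentKernel Φ β (α / 2) p / β ^ 2)) (𝓝[≠] 0)
      (𝓝 (leadingKernel α Φ p)) := by
  filter_upwards [ae_ne_prod] with p hp
  exact tendsto_leadingKernel h hα hp

theorem measurable_bentKernel_div (h : IsProfile Φ M S) (α β : ℝ) :
    Measurable fun p => α ^ 3 / 4 * (bentKernel Φ β (α / 2) p / β ^ 2) :=
  ((measurable_bentKernel h.measurable β (α / 2)).div_const _).const_mul _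

/-- Measurability and the integrable bound are both inherited from the approximating kernels as β →
0. -/
theorem integrable_leadingKernel (h : IsProfile Φ M S) (hα : 0 < α) :
    Integrable (leadingKernel α Φ) := by
  refine (integrable_leadingBound α M S).mono'
    (aestronglyMeasurable_of_tendsto_ae (𝓝[≠] (0 : ℝ))
      (fun β => (measurable_bentKernel_div h α β).aestronglyMeasurable)
      (ae_tendsto_leadingKernel h hα)) ?_
  filter_upwards [ae_tendsto_leadingKernel h hα] with p hp
  refine le_of_tendsto hp.norm ?_
  filter_upwards [eventually_small M] with β hβ
  exact abs_bentKernel_div_le h hα hβ p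

theorem tendsto_integral_bentKernel (h : IsProfile Φ M S) (hα : 0 < α) :
    Tendsto (fun β : ℝ => α ^ 3 / 4 * (∫ p, bentKernel Φ β (α / 2) p) / β ^ 2) (𝓝[≠] 0)
      (𝓝 (∫ p, leadingKernel α Φ p)) := by
  have h1 : Tendsto (fun β : ℝ => ∫ p, α ^ 3 / 4 * (bentKernel Φ β (α / 2) p / β ^ 2)) (𝓝[≠] 0)
      (𝓝 (∫ p, leadingKernel α Φ p)) := by
    refine tendsto_integral_filter_of_dominated_convergence (leadingBound α M S)
      (Eventually.of_forall fun β => (measurable_bentKernel_div h α β).aestronglyMeasurable) ?_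
      (integrable_leadingBound α M S) (ae_tendsto_leadingKernel h hα)
    filter_upwards [eventually_small M] with β hβ
    exact Eventually.of_forall fun p => abs_bentKernel_div_le h hα hβ p
  refine h1.congr fun β => ?_
  rw [integral_const_mul, integral_div, mul_div_assoc]

theorem leadingKernel_nonneg_ae (h : IsProfile Φ M S) (hα : 0 < α) :
    0 ≤ᵐ[volume] leadingKernel α Φ := by
  filter_upwards [ae_tendsto_leadingKernel h hα] with p hp
  refine ge_of_tendsto hp ?_
  filter_upwards [eventually_small M] with β hβ
  have := bentKernel_nonneg h hβ (half_pos hα) p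
  positivity

theorem integral_leadingKernel_pos (h : IsProfile Φ M S) (hα : 0 < α)
    (hne : ∀ c, ¬ ∀ᵐ u, Φ u = c) : 0 < ∫ p, leadingKernel α Φ p := by
  refine (integral_nonneg_of_ae (leadingKernel_nonneg_ae h hα)).lt_of_ne fun h0 => ?_
  rw [eq_comm, integral_eq_zero_iff_of_nonneg_ae (leadingKernel_nonneg_ae h hα)
    (integrable_leadingKernel h hα)] at h0
  -- The zero set has full measure, hence contains a pair lying beyond both ends; zero variance
  -- between its points makes the angle constant there.
  obtain ⟨p, h1, hp⟩ := (Measure.dense_of_ae h0).exists_mem_open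
    ((isOpen_Ioi (a := S + 1)).prod (isOpen_Iio (a := -(S + 1))))
    ⟨(S + 2, -(S + 2)), by constructor <;> simp⟩
  have hp1 : S + 1 < p.1 := hp.1
  have hp2 : p.2 < -(S + 1) := hp.2
  have hS := h.pos
  have hlt : p.2 < p.1 := by linarith
  have h2 : spread Φ p.1 p.2 = 0 := by
    have h3 : leadingKernel α Φ p = 0 := h1
    have h4 : 0 < macdonaldK1 (α / 2 * |p.1 - p.2|) :=
      macdonaldK1_pos (mul_pos (half_pos hα) (abs_pos.2 (sub_ne_zero.2 hlt.ne')))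
    rw [leadingKernel] at h3
    rcases mul_eq_zero.1 h3 with h5 | h5
    · exact absurd h5 (by positivity)
    · exact h5
  obtain ⟨c, hc⟩ := ae_eq_const_of_spread_eq_zero h hlt.ne' h2
  rw [Set.uIoc_of_le hlt.le] at hc
  -- The constant is only known almost everywhere; a good point just beyond S identifies it with the
  -- value on the whole right end, and likewise on the left.
  have hr : Φ S = c := by
    obtain ⟨u, hu, hu2⟩ := (Measure.dense_of_ae hc).exists_mem_open
      (isOpen_Ioo (a := S) (b := S + 1)) ⟨S + 1 / 2, by constructor <;> linarith⟩
    rw [← h.right u hu2.1.le]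
    exact hu ⟨by linarith [hu2.1], by linarith [hu2.2]⟩
  have hl : Φ (-S) = c := by
    obtain ⟨u, hu, hu2⟩ := (Measure.dense_of_ae hc).exists_mem_open
      (isOpen_Ioo (a := -(S + 1)) (b := -S)) ⟨-(S + 1 / 2), by constructor <;> linarith⟩
    rw [← h.left u hu2.2.le]
    exact hu ⟨by linarith [hu2.1], by linarith [hu2.2]⟩
  refine hne c ?_
  filter_upwards [hc] with u hu
  rcases le_or_gt S u with h3 | h3
  · rw [h.right u h3, hr]
  · rcases le_or_gt u (-S) with h4 | h4
    · rw [h.left u h4, hl]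
    · exact hu ⟨by linarith, by linarith⟩

end Leading

end LeakyWire

end

noncomputable section

namespace LeakyWire

/-! ### The weak bending asymptotics -/

theorem exists_isProfile {γ : ℝ → Plane} {V : Finset ℝ} (h : IsAdmissible γ V) :
    ∃ M S, IsProfile (fun u => bending γ V u 0) M S := by
  obtain ⟨M, -, hM⟩ := exists_bending_bound h
  obtain ⟨S, hS, h1, h2⟩ := exists_bending_const h
  exact ⟨M, S, measurable_bending h, hM, hS, h1, h2⟩

/-- The sign of K₀' = -K₁ cancels the sign of minus the variance; the diagonal is a null set. -/
theorem kernelA_ae_eq {γ : ℝ → Plane} {V : Finset ℝ} (h : IsAdmissible γ V) {α : ℝ} (hα : 0 < α) :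
    (fun z : ℝ × ℝ => kernelA α γ V z.1 z.2)
      =ᵐ[volume] leadingKernel α fun u => bending γ V u 0 := by
  obtain ⟨M, S, hΦ⟩ := exists_isProfile h
  filter_upwards [ae_ne_prod] with p hp
  have hL : 0 < |p.1 - p.2| := abs_pos.2 (sub_ne_zero.2 hp)
  have e := spread_sub_const hΦ (bending γ V p.2 0) hp
  simp only [← bending_eq_sub h] at e
  rw [kernelA, e, (hasDerivAt_macdonaldK0 (mul_pos (half_pos hα) hL)).deriv, leadingKernel]
  ring

theorem eventually_mul_sq_le (C : ℝ) {ε : ℝ} (hε : 0 < ε) : ∀ᶠ β : ℝ in 𝓝[≠] 0, C * β ^ 2 ≤ ε := by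
  have : Tendsto (fun β : ℝ => C * β ^ 2) (𝓝 0) (𝓝 (C * 0 ^ 2)) :=
    (by fun_prop : Continuous fun β : ℝ => C * β ^ 2).tendsto 0
  rw [zero_pow two_ne_zero, mul_zero] at this
  exact ((this.eventually (eventually_lt_nhds hε)).mono fun β h => h.le).filter_mono
    nhdsWithin_le_nhds

section Asymptotics

variable {Φ : ℝ → ℝ} {M S α : ℝ}

theorem eventually_coupling_small (M S α : ℝ) : ∀ᶠ β : ℝ in 𝓝[≠] 0, β ^ 2 * M ^ 2 ≤ 1 ∧
    α * (tildeConst α M S * β ^ 2 * regConst α) ≤ 1 / 2 ∧ couplingConst α M S * β ^ 2 ≤ 1 / 2 := by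
  filter_upwards [eventually_small M,
    eventually_mul_sq_le (α * tildeConst α M S * regConst α) one_half_pos,
    eventually_mul_sq_le (couplingConst α M S) one_half_pos] with β h1 h2 h3
  exact ⟨h1, by linarith, h3⟩

theorem tendsto_sq_zero : Tendsto (fun β : ℝ => β ^ 2) (𝓝[≠] 0) (𝓝 0) := by
  have : Tendsto (fun β : ℝ => β ^ 2) (𝓝 0) (𝓝 (0 ^ 2)) := (continuous_pow 2).tendsto 0
  rw [zero_pow two_ne_zero] at this
  exact this.mono_left nhdsWithin_le_nhds

/-- The error O(β⁴) of the first Neumann term disappears after division by β², so only the integral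
of the perturbation kernel matters. -/
theorem tendsto_couplingFn_zero (h : IsProfile Φ M S) (hα : 0 < α) :
    Tendsto (fun β => couplingFn Φ hα β 0 / β ^ 2) (𝓝[≠] 0) (𝓝 (∫ p, leadingKernel α Φ p)) := by
  have h1 := tendsto_integral_bentKernel h hα
  have h2 : Tendsto (fun β : ℝ => couplingFn Φ hα β 0 / β ^ 2
      - α ^ 3 / 4 * (∫ p, bentKernel Φ β (α / 2) p) / β ^ 2) (𝓝[≠] 0) (𝓝 0) := by
    have h3 := tendsto_sq_zero.const_mul (couplingConst α M S)
    rw [mul_zero] at h3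
    refine squeeze_zero_norm' ?_ h3
    filter_upwards [eventually_coupling_small M S α, self_mem_nhdsWithin] with β hβ hβ0
    have hβ2 : 0 < β ^ 2 := sq_pos_of_ne_zero hβ0
    rw [← sub_div, Real.norm_eq_abs, abs_div, abs_of_pos hβ2, div_le_iff₀ hβ2]
    refine (abs_couplingFn_zero_sub_le h hα hβ.1 hβ.2.1).trans (le_of_eq ?_)
    ring
  have h4 := h2.add h1
  rw [zero_add] at h4
  refine h4.congr fun β => ?_
  ring

/-- The bending parameter `β` is small enough for the weak coupling analysis. -/
def IsWeak (Φ : ℝ → ℝ) (hα : 0 < α) (M S β : ℝ) : Prop :=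
  (β ^ 2 * M ^ 2 ≤ 1 ∧ α * (tildeConst α M S * β ^ 2 * regConst α) ≤ 1 / 2 ∧
    couplingConst α M S * β ^ 2 ≤ 1 / 2) ∧ 0 < couplingFn Φ hα β 0

theorem eventually_isWeak (h : IsProfile Φ M S) (hα : 0 < α) (hne : ∀ c, ¬ ∀ᵐ u, Φ u = c) :
    ∀ᶠ β in 𝓝[≠] 0, IsWeak Φ hα M S β := by
  filter_upwards [eventually_coupling_small M S α, self_mem_nhdsWithin,
    (tendsto_couplingFn_zero h hα).eventually
      (eventually_gt_nhds (integral_leadingKernel_pos h hα hne))] with β h1 h2 h3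
  refine ⟨h1, ?_⟩
  have hβ2 : 0 < β ^ 2 := sq_pos_of_ne_zero h2
  exact (div_pos_iff_of_pos_right hβ2).1 h3

theorem IsWeak.exists_fixedPoint (h : IsProfile Φ M S) {hα : 0 < α} {β : ℝ}
    (hβ : IsWeak Φ hα M S β) : ∃ δ, 0 < δ ∧ couplingFn Φ hα β δ = δ ∧
      δ ≤ 2 * couplingFn Φ hα β 0 ∧ |δ - couplingFn Φ hα β 0| ≤ couplingConst α M S * β ^ 2 * δ ∧
      ∀ δ', 0 < δ' → couplingFn Φ hα β δ' = δ' → δ' = δ :=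
  exists_unique_fixedPoint hβ.1.2.2
    (fun _ _ hx hy => abs_couplingFn_sub_le h hα hβ.1.1 hβ.1.2.1 hx hy) hβ.2

/-- The positive fixed point of the coupling function. -/
def couplingRoot (Φ : ℝ → ℝ) (hα : 0 < α) (β : ℝ) : ℝ :=
  Classical.epsilon fun δ => 0 < δ ∧ couplingFn Φ hα β δ = δ

theorem IsWeak.couplingRoot_spec (h : IsProfile Φ M S) {hα : 0 < α} {β : ℝ}
    (hβ : IsWeak Φ hα M S β) : 0 < couplingRoot Φ hα β ∧
      couplingFn Φ hα β (couplingRoot Φ hα β) = couplingRoot Φ hα β ∧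
      couplingRoot Φ hα β ≤ 2 * couplingFn Φ hα β 0 ∧
      |couplingRoot Φ hα β - couplingFn Φ hα β 0|
        ≤ couplingConst α M S * β ^ 2 * couplingRoot Φ hα β ∧
      ∀ δ', 0 < δ' → couplingFn Φ hα β δ' = δ' → δ' = couplingRoot Φ hα β := by
  obtain ⟨δ, h1, h2, h3, h4, h5⟩ := hβ.exists_fixedPoint h
  have h6 := Classical.epsilon_spec (p := fun δ => 0 < δ ∧ couplingFn Φ hα β δ = δ) ⟨δ, h1, h2⟩
  have h7 : couplingRoot Φ hα β = δ := h5 _ h6.1 h6.2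
  rw [h7]
  exact ⟨h1, h2, h3, h4, h5⟩

theorem IsWeak.eigenvalues (h : IsProfile Φ M S) {hα : 0 < α} {β : ℝ} (hβ : IsWeak Φ hα M S β) :
    {μ : ℝ | μ < -α ^ 2 / 4 ∧ IsEigenvalue α (profileCurve Φ β) μ}
        = {-kap α (couplingRoot Φ hα β) ^ 2} ∧
      Module.finrank ℂ (eigenspace α (profileCurve Φ β) (-kap α (couplingRoot Φ hα β) ^ 2)) = 1 := by
  obtain ⟨h1, h2, -, -, h5⟩ := hβ.couplingRoot_spec h
  have hfin := finrank_eigenspace_of_fixed h hα hβ.1.1 hβ.1.2.1 h1 h2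
  refine ⟨Set.ext fun μ => ⟨?_, ?_⟩, hfin⟩
  · rintro ⟨hμ, he⟩
    have hpos : 0 < -μ - α ^ 2 / 4 := by linarith
    -- Every μ below the threshold has the form -(α²/4 + δ²) with δ > 0, so excluding other fixed
    -- points excludes all other eigenvalues.
    set δ := √(-μ - α ^ 2 / 4) with hδ
    have hδ0 : 0 < δ := Real.sqrt_pos.2 hpos
    have hμδ : μ = -kap α δ ^ 2 := by
      rw [kap_sq, hδ, Real.sq_sqrt hpos.le]
      ring
    have hfix : couplingFn Φ hα β δ = δ := by
      by_contra hne
      exact he (hμδ ▸ eigenspace_eq_bot_of_not_fixed h hα hβ.1.1 hβ.1.2.1 hδ0 hne)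
    rw [Set.mem_singleton_iff, hμδ, h5 δ hδ0 hfix]
  · intro hμ
    rw [Set.mem_singleton_iff] at hμ
    subst hμ
    refine ⟨?_, fun hbot => ?_⟩
    · rw [kap_sq]
      nlinarith [pow_pos h1 2]
    · rw [hbot, finrank_bot] at hfin
      exact zero_ne_one hfin

theorem tendsto_couplingRoot (h : IsProfile Φ M S) (hα : 0 < α) (hne : ∀ c, ¬ ∀ᵐ u, Φ u = c) :
    Tendsto (fun β => couplingRoot Φ hα β / β ^ 2) (𝓝[≠] 0) (𝓝 (∫ p, leadingKernel α Φ p)) := by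
  have h1 := tendsto_couplingFn_zero h hα
  have h2 : Tendsto (fun β => couplingRoot Φ hα β / β ^ 2 - couplingFn Φ hα β 0 / β ^ 2) (𝓝[≠] 0)
      (𝓝 0) := by
    have h3 := (tendsto_sq_zero.const_mul (2 * couplingConst α M S)).mul h1
    rw [mul_zero, zero_mul] at h3
    refine squeeze_zero_norm' ?_ h3
    filter_upwards [eventually_isWeak h hα hne, self_mem_nhdsWithin] with β hβ hβ0
    have hβ2 : 0 < β ^ 2 := sq_pos_of_ne_zero hβ0
    obtain ⟨e1, e2, e3, e4, -⟩ := hβ.couplingRoot_spec h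
    rw [← sub_div, Real.norm_eq_abs, abs_div, abs_of_pos hβ2, ← mul_div_assoc]
    refine div_le_div_of_nonneg_right (e4.trans ?_) hβ2.le
    have := mul_le_mul_of_nonneg_left e3
      (mul_nonneg (couplingConst_nonneg hα M S) hβ2.le)
    linarith
  have h4 := h2.add h1
  rw [zero_add] at h4
  refine h4.congr fun β => ?_
  ring

theorem isLittleO_eigenvalue (h : IsProfile Φ M S) (hα : 0 < α) (hne : ∀ c, ¬ ∀ᵐ u, Φ u = c) :
    (fun β : ℝ => -kap α (couplingRoot Φ hα β) ^ 2 - (-α ^ 2 / 4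
      - (∫ p, leadingKernel α Φ p) ^ 2 * β ^ 4)) =o[𝓝[≠] 0] fun β : ℝ => β ^ 4 := by
  rw [isLittleO_iff_tendsto']
  · have h1 := ((tendsto_couplingRoot h hα hne).pow 2).const_sub ((∫ p, leadingKernel α Φ p) ^ 2)
    rw [sub_self] at h1
    refine h1.congr' ?_
    filter_upwards [self_mem_nhdsWithin] with β hβ
    have hβ0 : β ≠ 0 := hβ
    rw [kap_sq]
    field_simp
    ring
  · filter_upwards [self_mem_nhdsWithin] with β hβ h0
    exact absurd h0 (pow_ne_zero 4 hβ)

end Asymptotics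

end LeakyWire

end

/-! ### Conclusion for the scaled curves. -/

theorem theorem1 (α : ℝ) (hα : 0 < α) (γ : ℝ → LeakyWire.Plane) (V : Finset ℝ)
    (hγ : LeakyWire.IsAdmissible γ V) (hbent : ¬ LeakyWire.StraightOn γ Set.univ) :
    Integrable (fun z : ℝ × ℝ => LeakyWire.kernelA α γ V z.1 z.2) ∧
    ∃ β₀ : ℝ, 0 < β₀ ∧ ∃ lam : ℝ → ℝ,
      (∀ β : ℝ, 0 < |β| → |β| < β₀ →
        {μ : ℝ | μ < -α ^ 2 / 4 ∧ LeakyWire.IsEigenvalue α (LeakyWire.scaledCurve γ V β) μ}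
          = {lam β} ∧
        Module.finrank ℂ (LeakyWire.eigenspace α (LeakyWire.scaledCurve γ V β) (lam β)) = 1) ∧
      (fun β : ℝ => lam β - (-α ^ 2 / 4
          - (∫ z : ℝ × ℝ, LeakyWire.kernelA α γ V z.1 z.2) ^ 2 * β ^ 4))
        =o[𝓝[≠] 0] (fun β : ℝ => β ^ 4) := by
  obtain ⟨M, S, h⟩ := LeakyWire.exists_isProfile hγ
  have hA := LeakyWire.kernelA_ae_eq hγ hα
  have hne : ∀ c, ¬ ∀ᵐ u, LeakyWire.bending γ V u 0 = c := fun c =>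
    LeakyWire.not_bending_ae_const hγ hbent c
  refine ⟨(LeakyWire.integrable_leadingKernel h hα).congr hA.symm, ?_⟩
  obtain ⟨β₀, hβ₀, hw⟩ := Metric.eventually_nhds_iff.1
    (eventually_nhdsWithin_iff.1 (LeakyWire.eventually_isWeak h hα hne))
  -- For larger |β| a fixed point may fail to exist; `couplingRoot` then takes an arbitrary default
  -- value.
  refine ⟨β₀, hβ₀, fun β => -LeakyWire.kap α
    (LeakyWire.couplingRoot (fun u => LeakyWire.bending γ V u 0) hα β) ^ 2, fun β h0 h1 => ?_, ?_⟩
  -- `scaledCurve` is by definition the `profileCurve` of the bending based at 0.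
  · exact (hw (by simpa [Real.dist_eq] using h1) (abs_pos.1 h0)).eigenvalues h
  · rw [integral_congr_ae hA]
    exact LeakyWire.isLittleO_eigenvalue h hα hne
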